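/- Let $B_n$ be the braid group on $n$ strands with Artin generators $\sigma_1,\dots,\sigma_{n-1}$ (positive crossings), let $$a_{i,j}=(\sigma_i\cdots\sigma_{j-2})\,\sigma_{j-1}\,(\sigma_i\cdots\sigma_{j-2})^{-1}\qquad(1\le i<j\le n)$$ be the Birman–Ko–Lee (BKL) generators, so that $a_{i,i+1}=\sigma_i$, and let $\delta_n=\sigma_1\sigma_2\cdots\sigma_{n-1}$ be the dual Garside element. A word in the $a_{i,j}$ is BKL-positive if it contains no inverses. A staircase braid in $B_n$ is one that is given by a BKL-positive word containing $\delta_n$ as a subword. For coprime integers $p,q\ge 1$, the cable $K_{p,q}$ of a knot $K$ is the satellite with companion $K$ and pattern the torus knot $T_{p,q}$: the image, under an orientation-preserving embedding of the standard solid torus onto a tubular neighbourhood of $K$ that sends the standard longitude to the preferred (null-homologous) longitude of $K$, of the curve $T_{p,q}$ that winds $p$ times along the core and $q$ times around it. Let $p\ge 2$, and let $K$ be a knot that is the closure of a staircase braid $\delta_n P\in B_n$, where $P=a_{i_1,j_1}\cdots a_{i_m,j_m}$ is a BKL-positive word. Let $q\ge n$ be coprime to $p$. Then the cable $K_{p,q}$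 is the closure of a staircase braid on $pn$ strands. Explicitly, it is the closure of the braid given by the BKL-positive word $$\delta_{pn}\;\prod_{k=1}^{n-1}\bigl(a_{kp-1,(k+1)p-1}\,a_{kp-2,(k+1)p-2}\cdots a_{(k-1)p+1,kp+1}\bigr)\;(\sigma_1\cdots\sigma_{p-1})^{q-n}\;\prod_{l=1}^{m}\bigl(a_{pi_l,pj_l}\,a_{pi_l-1,pj_l-1}\cdots a_{p(i_l-1)+1,p(j_l-1)+1}\bigr).$$ -/

import Mathlib

open scoped ContDiff

noncomputable section

namespace StaircaseCable

/-! ### Knots and isotopy -/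

/-- Euclidean three-space as the product of a plane and a line, with coordinates `(x + y i, z)`
and the orientation `(x, y, z)`. -/
abbrev Space : Type := ℂ × ℝ

/-- A smooth oriented knot: a smooth embedding of the circle `ℝ / ℤ` in three-space, written as a
map on `ℝ` of period one. -/
structure IsKnot (γ : ℝ → Space) : Prop where
  smooth : ContDiff ℝ ∞ γ
  periodic : ∀ s, γ (s + 1) = γ s
  injective : ∀ s t, γ s = γ t → ∃ k : ℤ, s = t + k
  immersion : ∀ s, deriv γ s ≠ 0

/-- Two smooth oriented knots are isotopic if they are joined by a smooth family of knots. -/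
def Isotopic (γ₀ γ₁ : ℝ → Space) : Prop :=
  ∃ F : ℝ × ℝ → Space, ContDiff ℝ ∞ F ∧
    (∀ t ∈ Set.Icc (0 : ℝ) 1, IsKnot fun s => F (t, s)) ∧
    (∀ s, F (0, s) = γ₀ s) ∧ (∀ s, F (1, s) = γ₁ s)

/-! ### Satellites with torus knot pattern -/

/-- An orientation preserving smooth embedding in three-space of the solid torus
`{x ∈ ℂ | ‖x‖ ≤ 1} × ℝ / ℤ`, written as a map of period one in the second variable. -/
structure IsSolidTorus (h : ℂ × ℝ → Space) : Prop where
  smooth : ContDiff ℝ ∞ h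
  periodic : ∀ x s, h (x, s + 1) = h (x, s)
  injective : ∀ x y s t, ‖x‖ ≤ 1 → ‖y‖ ≤ 1 → h (x, s) = h (y, t) →
    x = y ∧ ∃ k : ℤ, s = t + k
  orientation : ∀ x s, ‖x‖ ≤ 1 → 0 < (fderiv ℝ h (x, s)).det

/-- The closed curve `γ`, on `[0, 1]`, is a loop in `X` which represents zero in the first homology
group of `X`, that is, in the abelianized fundamental group. -/
def NullHomologousIn (X : Set Space) (γ : ℝ → Space) : Prop :=
  ∃ (x : X) (l : Path x x), (∀ s : unitInterval, ((l s : X) : Space) = γ s) ∧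
    Abelianization.of (FundamentalGroup.fromPath (Path.Homotopic.Quotient.mk l)) = 1

/-- The core of a solid torus. -/
def core (h : ℂ × ℝ → Space) (s : ℝ) : Space := h (0, s)

/-- The longitude of a solid torus which is the image of `{1} × ℝ / ℤ`. -/
def longitude (h : ℂ × ℝ → Space) (s : ℝ) : Space := h (1, s)

/-- The torus knot `T_{p,q}` on the boundary of the standard solid torus `ℂ × ℝ / ℤ`: it runs `p`
times along the core while it turns `q` times around it. -/
def torusKnot (p q : ℕ) (s : ℝ) : ℂ × ℝ :=
  (Complex.exp (2 * Real.pi * q * s * Complex.I), p * s)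

/-- `L` is the cable `K_{p,q}`, the satellite with companion `K` and pattern `T_{p,q}`, as a knot
up to isotopy: `L` is the image of `T_{p,q}` under an orientation preserving embedding of the solid
torus whose core is `K` and which carries the standard longitude to the preferred longitude, the
one that is null-homologous in the complement of the core. -/
def IsCable (p q : ℕ) (K L : ℝ → Space) : Prop :=
  ∃ h : ℂ × ℝ → Space, IsSolidTorus h ∧
    NullHomologousIn (Set.range (core h))ᶜ (longitude h) ∧
    Isotopic (core h) K ∧
    Isotopic (fun s => h (torusKnot p q s)) L

/-! ### Braid words, geometric braids and their closures -/

/-- The letter `(i, true)` is the Artin generator `σ_i`, the letter `(i, false)` its inverse.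
The strands occupy the positions `1, …, n`. -/
abbrev ArtinLetter : Type := ℕ × Bool

/-- The motion, for the time `s ∈ [0, 1]`, of the strand that starts in position `k`, in the
geometric braid of one Artin letter: the points in the positions `i` and `i + 1` of the real line
change places by a half-turn around their midpoint, counterclockwise for `σ_i` and clockwise for
its inverse, and the other points rest. All time derivatives vanish at `s = 0` and at `s = 1`, so
that consecutive letters fit together smoothly. -/
def letterPath (a : ArtinLetter) (k : ℕ) (s : ℝ) : ℂ :=
  let c : ℂ := a.1 + 1 / 2
  let r : ℂ := Complex.exp ((if a.2 then 1 else -1) * Real.pi * Real.smoothTransition s * Complex.I)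
  if k = a.1 then c - r / 2 else if k = a.1 + 1 then c + r / 2 else k

/-- The motion, for the time `s ∈ [0, w.length]`, of the strand that starts in position `k`, in the
geometric braid of the word `w`, whose letters are performed from left to right. -/
def braidPath : List ArtinLetter → ℕ → ℝ → ℂ
  | [], k, _ => k
  | a :: w, k, s =>
    if s ≤ 1 then letterPath a k s else braidPath w (Equiv.swap a.1 (a.1 + 1) k) (s - 1)

/-- The permutation of a braid word: it sends the initial position of a strand to its final one. -/
def braidPerm : List ArtinLetter → Equiv.Perm ℕ
  | [] => 1
  | a :: w => braidPerm w * Equiv.swap a.1 (a.1 + 1)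

/-- The standard embedding of the open solid torus `ℂ × ℝ / ℤ` in three-space, onto the complement
of the vertical axis. It preserves orientations. The point `k ∈ ℂ` of the real line traces the unit
circle at height `k`. -/
def aroundAxis (z : ℂ) (u : ℝ) : Space :=
  (Complex.exp (z.im + 2 * Real.pi * u * Complex.I), z.re)

/-- The closure of the geometric braid of `w` on `n` strands, traversed from the first position on:
the parameter interval `[j / n, (j + 1) / n]` runs once around the axis along the strand that starts
in the position reached after `j` turns. If the permutation of `w` is an `n`-cycle, this traverses
every strand exactly once for `t ∈ [0, 1]`, and it is a knot; otherwise, the closure has several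
components, and the map is not a knot. -/
def braidClosure (n : ℕ) (w : List ArtinLetter) (t : ℝ) : Space :=
  aroundAxis
    (braidPath w ((braidPerm w ^ ⌊(n : ℝ) * t⌋) 1) (w.length * Int.fract ((n : ℝ) * t)))
    ((n : ℝ) * t)

/-! ### Band generators and staircase braids -/

/-- The pair `(i, j)` with `i < j` stands for the band generator `a_{i,j}` of Birman, Ko and Lee. -/
abbrev Band : Type := ℕ × ℕ

/-- The expression of a band generator in the Artin generators,
`a_{i,j} = (σ_i ⋯ σ_{j-2}) σ_{j-1} (σ_i ⋯ σ_{j-2})⁻¹`. -/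
def bandWord (b : Band) : List ArtinLetter :=
  let c := List.range' b.1 (b.2 - 1 - b.1)
  c.map (fun i => (i, true)) ++ [(b.2 - 1, true)] ++ c.reverse.map (fun i => (i, false))

/-- The Artin word of a product of positive band generators. -/
def artinWord (W : List Band) : List ArtinLetter := W.flatMap bandWord

/-- The list `W` is a positive word in the band generators of the braid group on `n` strands. -/
def IsBKLPositive (n : ℕ) (W : List Band) : Prop :=
  ∀ b ∈ W, 1 ≤ b.1 ∧ b.1 < b.2 ∧ b.2 ≤ n

/-- The dual Garside element `δ = σ_1 σ_2 ⋯ σ_{n-1}`, with `σ_i = a_{i,i+1}`. -/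
def dualGarside (n : ℕ) : List Band := (List.range' 1 (n - 1)).map fun i => (i, i + 1)

/-- A staircase braid word: a positive word in the band generators with `δ` as a subword. -/
def IsStaircase (n : ℕ) (W : List Band) : Prop :=
  IsBKLPositive n W ∧ dualGarside n <:+: W

/-- The knot `K` is the closure, up to isotopy, of the braid on `n` strands given by the positive
word `W` in the band generators. -/
def IsClosureOf (n : ℕ) (W : List Band) (K : ℝ → Space) : Prop :=
  Isotopic K (braidClosure n (artinWord W))

/-! ### The cabled staircase braid -/

/-- The cable `a_{pi,pj} a_{pi-1,pj-1} ⋯ a_{p(i-1)+1,p(j-1)+1}` of the band generator `a_{i,j}`. -/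
def cabledBand (p : ℕ) (b : Band) : List Band :=
  (List.range p).map fun k => (p * b.1 - k, p * b.2 - k)

/-- The positive part of the cable of the dual Garside element on `n` strands:
`δ_{pn} ∏_{k=1}^{n-1} (a_{kp-1,(k+1)p-1} a_{kp-2,(k+1)p-2} ⋯ a_{(k-1)p+1,kp+1})`. -/
def cabledDualGarside (p n : ℕ) : List Band :=
  dualGarside (p * n) ++ (List.range' 1 (n - 1)).flatMap fun k =>
    (List.range' 1 (p - 1)).map fun r => (k * p - r, (k + 1) * p - r)

/-- The word on `pn` strands obtained from `δ P`: the positive part of the cable of `δ`, then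
`q - n` positive `1 / p`-twists `σ_1 ⋯ σ_{p-1}` of the first `p` strands, then the cables of the
letters of `P`. It is used for `n ≤ q` only. -/
def cabledStaircase (p q n : ℕ) (P : List Band) : List Band :=
  cabledDualGarside p n ++ (List.replicate (q - n) (dualGarside p)).flatten ++
    P.flatMap (cabledBand p)

end StaircaseCable

end

open scoped ContDiff

noncomputable section

namespace StaircaseCable

open Equiv (Perm swap)

/-! ### Isotopy is an equivalence relation -/

/-! Write `T_c` for the `1/p`-twist of the block of strands `pc+1, …, pc+p` (`twist`). The argument
has an algebraic half, which shows that the given word is the `p`-strand parallel of the braid `δP`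
with a known number of `1/p`-twists, and a topological half, which compares this number with the
framing of the knot.

Algebra. The element `δ_{pn}` is `T_0 ⋯ T_{n-1}` times the product of the generators `a_{pk,p(k+1)}`
(`run_eq_twists`), and these generators are exactly what the factors written after `δ_{pn}` lack in
order to be the cables of the letters `σ_k` of `δ_n`. Hence the word represents `T_0 ⋯ T_{n-1}`,
then the cable of `δ_n`, then `T_0^{q-n}`, then the cable of `P` (`bands_cabledStaircase`). The
cable of a single `a_{i,j}` is the flat parallel of `a_{i,j}` followed by the inverse of a full
twist, that is of `p` many `1/p`-twists (`bands_cabledBand`, `cableSum_partialCable`). If `δP` has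
`E` letters, the total number of `1/p`-twists is therefore `κ = n + (q - n) - pE = q - pE`
(`cableSum_cabledStaircase`).

Topology. The closure of a parallel with `κ` such twists runs `p` times along `K` and turns `κ`
times around it, when turns are counted against the parallel copy of `K` that is pushed off radially
from the axis (`CableSum.closedHomotopic`). Against this copy the null-homologous longitude makes
`-E` turns, one for each crossing counted with sign (`nullHomologousIn_longitude`); the conjugating
letters of a band generator cancel, so its writhe is one. In a tube framed by the null-homologous
longitude, `T_{p,q}` thus makes `q - pE = κ` turns in the radial framing, and the two curves agree
up to isotopy (`isCable_cabledStaircase`).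

Three devices make this rigorous. Braids are homotopy classes of motions of labelled points, and
identities between them come from charts: configurations whose vertically aligned points are ordered
by prescribed heights form a contractible set, so a braid represented in a chart is determined by
its permutation (`Braid.InChart.eq`). Closed braids are functions of the number of turns around the
axis, and a merely continuous homotopy through closed braids yields a smooth isotopy by Fourier
approximation (`ClosedHomotopic.isotopic`). Homology is handled by an additive class for paths, not
only for loops, so that the longitude can be cut at the letters of the word and treated one crossing
at a time (`segClass_letter`). -/

theorem Isotopic.refl {γ : ℝ → Space} (h : IsKnot γ) : Isotopic γ γ :=
  ⟨fun x => γ x.2, h.smooth.comp contDiff_snd, fun _ _ => h, fun _ => rfl, fun _ => rfl⟩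

theorem Isotopic.isKnot_left {γ₀ γ₁ : ℝ → Space} (h : Isotopic γ₀ γ₁) : IsKnot γ₀ := by
  obtain ⟨F, -, hk, h0, -⟩ := h
  have := hk 0 (by simp)
  simpa only [h0] using this

theorem Isotopic.isKnot_right {γ₀ γ₁ : ℝ → Space} (h : Isotopic γ₀ γ₁) : IsKnot γ₁ := by
  obtain ⟨F, -, hk, -, h1⟩ := h
  have := hk 1 (by simp)
  simpa only [h1] using this

theorem Isotopic.symm {γ₀ γ₁ : ℝ → Space} (h : Isotopic γ₀ γ₁) : Isotopic γ₁ γ₀ := by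
  obtain ⟨F, hF, hk, h0, h1⟩ := h
  refine ⟨fun x => F (1 - x.1, x.2), hF.comp (by fun_prop), fun t ht => ?_, fun s => ?_,
    fun s => ?_⟩
  · exact hk (1 - t) ⟨by linarith [ht.2], by linarith [ht.1]⟩
  · simpa using h1 s
  · simpa using h0 s

/-- Each isotopy is reparametrized by a smooth step, so that the first rests at `γ₁` from time `1/3`
on and the second until time `2/3`. On the overlap both are constant, which makes the concatenation
at `1/2` smooth. -/
theorem Isotopic.trans {γ₀ γ₁ γ₂ : ℝ → Space} (h : Isotopic γ₀ γ₁) (h' : Isotopic γ₁ γ₂) :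
    Isotopic γ₀ γ₂ := by
  obtain ⟨F, hF, hk, h0, h1⟩ := h
  obtain ⟨G, hG, gk, g0, g1⟩ := h'
  have hS : ContDiff ℝ ∞ Real.smoothTransition := Real.smoothTransition.contDiff
  let A : ℝ × ℝ → Space := fun x => F (Real.smoothTransition (3 * x.1), x.2)
  let B : ℝ × ℝ → Space := fun x => G (Real.smoothTransition (3 * x.1 - 2), x.2)
  have hA : ContDiff ℝ ∞ A := hF.comp (by fun_prop)
  have hB : ContDiff ℝ ∞ B := hG.comp (by fun_prop)
  have hA1 : ∀ x : ℝ × ℝ, 1 / 3 ≤ x.1 → A x = γ₁ x.2 := fun x hx => by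
    simp only [A]
    rw [Real.smoothTransition.one_of_one_le (by linarith), h1]
  have hB0 : ∀ x : ℝ × ℝ, x.1 ≤ 2 / 3 → B x = γ₁ x.2 := fun x hx => by
    simp only [B]
    rw [Real.smoothTransition.zero_of_nonpos (by linarith), g0]
  refine ⟨fun x => if x.1 ≤ 1 / 2 then A x else B x, ?_, fun t ht => ?_, fun s => ?_,
    fun s => ?_⟩
  · rw [contDiff_iff_contDiffAt]
    intro x
    rcases lt_or_ge x.1 (2 / 3) with hx | hx
    · refine hA.contDiffAt.congr_of_eventuallyEq ?_
      filter_upwards [(isOpen_lt continuous_fst continuous_const).mem_nhds hx] with y hy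
      have hy : y.1 < 2 / 3 := hy
      by_cases h : y.1 ≤ 1 / 2
      · exact if_pos h
      · rw [if_neg h, hA1 y (by linarith), hB0 y hy.le]
    · refine hB.contDiffAt.congr_of_eventuallyEq ?_
      filter_upwards [(isOpen_lt continuous_const continuous_fst).mem_nhds
        (show (1 : ℝ) / 2 < x.1 by linarith)] with y hy
      have hy : 1 / 2 < y.1 := hy
      exact if_neg (not_le.2 hy)
  · by_cases h : t ≤ 1 / 2
    · simp only [h, if_true]
      exact hk (Real.smoothTransition (3 * t)) ⟨Real.smoothTransition.nonneg _, Real.smoothTransition.le_one _⟩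
    · simp only [h, if_false]
      exact gk (Real.smoothTransition (3 * t - 2)) ⟨Real.smoothTransition.nonneg _, Real.smoothTransition.le_one _⟩
  · simp only [show (0 : ℝ) ≤ 1 / 2 by norm_num, if_true, A]
    rw [Real.smoothTransition.zero_of_nonpos (by norm_num), h0]
  · simp only [show ¬ (1 : ℝ) ≤ 1 / 2 by norm_num, if_false, B]
    rw [Real.smoothTransition.one_of_one_le (by norm_num), g1]

/-! ### Closed braids as functions -/

/-- The height gives the real part of `z`, the logarithm of the distance from the axis gives the
imaginary part, and the angle gives `u` modulo one. -/
theorem aroundAxis_eq_iff {z z' : ℂ} {u u' : ℝ} :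
    aroundAxis z u = aroundAxis z' u' ↔ z = z' ∧ ∃ k : ℤ, u = u' + k := by
  simp only [aroundAxis, Prod.mk.injEq, Complex.exp_eq_exp_iff_exists_int]
  have hpi : (2 * Real.pi) ≠ 0 := by positivity
  constructor
  · rintro ⟨⟨k, hk⟩, h⟩
    have h1 := congrArg Complex.re hk
    have h2 := congrArg Complex.im hk
    simp at h1 h2
    refine ⟨Complex.ext h h1, k, ?_⟩
    apply mul_left_cancel₀ hpi
    linarith
  · rintro ⟨rfl, k, rfl⟩
    refine ⟨⟨k, ?_⟩, rfl⟩
    push_cast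
    ring

theorem contDiff_aroundAxis : ContDiff ℝ ∞ fun x : ℂ × ℝ => aroundAxis x.1 x.2 := by
  unfold aroundAxis
  have h1 : ContDiff ℝ ∞ fun x : ℂ × ℝ => (x.1.im : ℂ) :=
    Complex.ofRealCLM.contDiff.comp (Complex.imCLM.contDiff.comp contDiff_fst)
  have h2 : ContDiff ℝ ∞ fun x : ℂ × ℝ => (x.2 : ℂ) :=
    Complex.ofRealCLM.contDiff.comp contDiff_snd
  have h3 : ContDiff ℝ ∞ fun x : ℂ × ℝ => x.1.re := Complex.reCLM.contDiff.comp contDiff_fst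
  exact ((h1.add ((contDiff_const.mul h2).mul contDiff_const)).cexp).prodMk h3

theorem continuous_aroundAxis : Continuous fun x : ℂ × ℝ => aroundAxis x.1 x.2 :=
  contDiff_aroundAxis.continuous

/-- A continuous function which describes a closed braid on `N` strands that is connected: `B u`
is the position of the strand after `u` turns around the axis. -/
structure IsClosedBraid (N : ℕ) (B : ℝ → ℂ) : Prop where
  continuous : Continuous B
  periodic : ∀ u, B (u + N) = B u
  injective : ∀ (u : ℝ) (k : ℤ), B (u + k) = B u → (N : ℤ) ∣ k

/-- The closed curve in space of a closed braid. -/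
def knotOf (N : ℕ) (B : ℝ → ℂ) (t : ℝ) : Space := aroundAxis (B (N * t)) (N * t)

/-- Strands meeting at one angle have distinct positions, which gives injectivity; the immersion
condition is automatic, because the angle around the axis grows at the constant rate `2πN`. -/
theorem IsClosedBraid.isKnot {N : ℕ} {B : ℝ → ℂ} (hN : 0 < N) (h : IsClosedBraid N B)
    (hB : ContDiff ℝ ∞ B) : IsKnot (knotOf N B) := by
  have hN' : (N : ℝ) ≠ 0 := by positivity
  refine ⟨?_, fun s => ?_, fun s t hst => ?_, fun s => ?_⟩
  · exact contDiff_aroundAxis.comp ((hB.comp (by fun_prop)).prodMk (by fun_prop))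
  · unfold knotOf
    rw [aroundAxis_eq_iff]
    refine ⟨?_, N, by push_cast; ring⟩
    rw [mul_add, mul_one, h.periodic]
  · obtain ⟨h1, k, hk⟩ := aroundAxis_eq_iff.1 hst
    rw [hk] at h1
    obtain ⟨m, rfl⟩ := h.injective _ _ h1
    refine ⟨m, ?_⟩
    apply mul_left_cancel₀ hN'
    rw [hk]
    push_cast
    ring
  · let b : ℝ → ℂ := fun t => B (N * t)
    have hb : ContDiff ℝ ∞ b := hB.comp (by fun_prop)
    have hd : HasDerivAt b (deriv b s) s :=
      ((hb.differentiable (by simp)) s).hasDerivAt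
    have him : HasDerivAt (fun t => ((b t).im : ℂ)) (((deriv b s).im : ℝ) : ℂ) s :=
      (Complex.imCLM.hasFDerivAt.comp_hasDerivAt s hd).ofReal_comp
    have hre : HasDerivAt (fun t => (b t).re) (deriv b s).re s :=
      Complex.reCLM.hasFDerivAt.comp_hasDerivAt s hd
    have hu : HasDerivAt (fun t : ℝ => 2 * (Real.pi : ℂ) * ((N * t : ℝ) : ℂ) * Complex.I)
        (2 * (Real.pi : ℂ) * ((N * 1 : ℝ) : ℂ) * Complex.I) s :=
      ((((hasDerivAt_id s).const_mul (N : ℝ)).ofReal_comp).const_mul _).mul_const _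
    have htot := ((him.add hu).cexp).prodMk hre
    have : deriv (knotOf N B) s = _ := htot.deriv
    rw [this]
    intro h0
    have h1 := (Prod.mk.inj h0).1
    rcases mul_eq_zero.1 h1 with h2 | h2
    · exact Complex.exp_ne_zero _ h2
    · have h3 := congrArg Complex.im h2
      simp at h3
      exact hN.ne' h3

/-! ### Approximation of homotopies of closed braids by isotopies -/

/-- Trigonometric polynomials are dense in the continuous functions on the circle, and they are
smooth. -/
theorem exists_contDiff_near {T : ℝ} (hT : 0 < T) {B : ℝ → ℂ} (hB : Continuous B)
    (hper : Function.Periodic B T) {ε : ℝ} (hε : 0 < ε) :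
    ∃ g : ℝ → ℂ, ContDiff ℝ ∞ g ∧ Function.Periodic g T ∧ ∀ u, ‖g u - B u‖ < ε := by
  have : Fact (0 < T) := ⟨hT⟩
  let f : C(AddCircle T, ℂ) := ⟨hper.lift, by
    exact continuous_coinduced_dom.mpr hB⟩
  have hf : f ∈ (Submodule.span ℂ (Set.range (@fourier T))).topologicalClosure := by
    rw [span_fourier_closure_eq_top]; trivial
  obtain ⟨g, hg, hd⟩ := Metric.mem_closure_iff.1 hf ε hε
  refine ⟨fun u => g (u : AddCircle T), ?_, fun u => by simp, fun u => ?_⟩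
  · refine Submodule.span_induction (p := fun g _ => ContDiff ℝ ∞ fun u : ℝ => g (u : AddCircle T))
      ?_ ?_ ?_ ?_ hg
    · rintro _ ⟨n, rfl⟩
      simp only [fourier_coe_apply]
      have h2 : ContDiff ℝ ∞ fun x : ℝ => (x : ℂ) := Complex.ofRealCLM.contDiff
      exact ((contDiff_const.mul h2).div_const _).cexp
    · simpa using contDiff_const
    · intro x y _ _ hx hy
      simpa using hx.add hy
    · intro c x _ hx
      simpa using contDiff_const.mul hx
  · have := (ContinuousMap.dist_lt_iff hε).1 hd (u : AddCircle T)
    rw [dist_comm, dist_eq_norm] at this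
    exact this

/-- All convex combinations of `g₀` and `g₁` stay within `δ / 2` of `B`, whose distinct strands are
at least `δ` apart, so no two strands of the straight-line homotopy collide. -/
theorem isotopic_of_near {N : ℕ} (hN : 0 < N) {B g₀ g₁ : ℝ → ℂ} {δ : ℝ}
    (hgap : ∀ (u : ℝ) (k : ℤ), ‖B (u + k) - B u‖ < δ → (N : ℤ) ∣ k)
    (h0 : ContDiff ℝ ∞ g₀) (h1 : ContDiff ℝ ∞ g₁)
    (p0 : ∀ u, g₀ (u + N) = g₀ u) (p1 : ∀ u, g₁ (u + N) = g₁ u)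
    (n0 : ∀ u, ‖g₀ u - B u‖ < δ / 2) (n1 : ∀ u, ‖g₁ u - B u‖ < δ / 2) :
    Isotopic (knotOf N g₀) (knotOf N g₁) := by
  let G : ℝ → ℝ → ℂ := fun t u => (1 - t : ℝ) * g₀ u + (t : ℝ) * g₁ u
  have hofR : ContDiff ℝ ∞ fun x : ℝ => (x : ℂ) := Complex.ofRealCLM.contDiff
  have hG : ContDiff ℝ ∞ fun x : ℝ × ℝ => G x.1 x.2 := by
    refine ContDiff.add (ContDiff.mul (hofR.comp (by fun_prop)) (h0.comp contDiff_snd))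
      (ContDiff.mul (hofR.comp (by fun_prop)) (h1.comp contDiff_snd))
  refine ⟨fun x => knotOf N (G x.1) x.2, ?_, fun t ht => ?_, fun s => ?_, fun s => ?_⟩
  · have : ContDiff ℝ ∞ fun x : ℝ × ℝ => (G x.1 (N * x.2), N * x.2) :=
      (hG.comp (f := fun x : ℝ × ℝ => (x.1, N * x.2)) (by fun_prop)).prodMk (by fun_prop)
    exact contDiff_aroundAxis.comp this
  · have hGt : ContDiff ℝ ∞ (G t) := hG.comp (f := fun u : ℝ => (t, u)) (by fun_prop)
    have hnear : ∀ u, ‖G t u - B u‖ < δ / 2 := by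
      intro u
      have : G t u - B u = (1 - t : ℝ) * (g₀ u - B u) + (t : ℝ) * (g₁ u - B u) := by
        simp only [G]; push_cast; ring
      rw [this]
      have e0 := n0 u
      have e1 := n1 u
      calc _ ≤ ‖((1 - t : ℝ) : ℂ) * (g₀ u - B u)‖ + ‖(t : ℂ) * (g₁ u - B u)‖ := norm_add_le _ _
        _ = (1 - t) * ‖g₀ u - B u‖ + t * ‖g₁ u - B u‖ := by
          rw [norm_mul, norm_mul, Complex.norm_real, Complex.norm_real,
            Real.norm_of_nonneg (by linarith [ht.2]), Real.norm_of_nonneg ht.1]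
        _ < δ / 2 := by
          rcases eq_or_lt_of_le ht.1 with h | h
          · subst h; simpa using e0
          · nlinarith [ht.2, mul_le_mul_of_nonneg_left e0.le (sub_nonneg.2 ht.2),
              mul_lt_mul_of_pos_left e1 h]
    refine IsClosedBraid.isKnot hN ⟨hGt.continuous, fun u => ?_, fun u k hk => ?_⟩ hGt
    · simp only [G, p0, p1]
    · refine hgap u k ?_
      have : B (u + k) - B u = (G t u - B u) - (G t (u + k) - B (u + k)) := by rw [hk]; ring
      rw [this]
      calc _ ≤ _ := norm_sub_le _ _
        _ < δ := by linarith [hnear u, hnear (u + k)]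
  · simp [G]
  · simp [G]

/-- Two closed braids are homotopic if they are joined by a continuous family of closed braids. -/
def ClosedHomotopic (N : ℕ) (B₀ B₁ : ℝ → ℂ) : Prop :=
  ∃ H : ℝ × ℝ → ℂ, Continuous H ∧ (∀ t ∈ Set.Icc (0 : ℝ) 1, IsClosedBraid N fun u => H (t, u)) ∧
    (∀ u, H (0, u) = B₀ u) ∧ (∀ u, H (1, u) = B₁ u)

/-- By periodicity `u` may be taken in `[0, N]` and `k` among the finitely many residues modulo `N`.
For each nonzero residue the distance of the strands has a positive minimum on a compact set. -/
theorem exists_gap {N : ℕ} (hN : 0 < N) {H : ℝ × ℝ → ℂ} (hH : Continuous H)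
    (hb : ∀ t ∈ Set.Icc (0 : ℝ) 1, IsClosedBraid N fun u => H (t, u)) :
    ∃ δ > 0, ∀ t ∈ Set.Icc (0 : ℝ) 1, ∀ (u : ℝ) (k : ℤ), ‖H (t, u + k) - H (t, u)‖ < δ →
      (N : ℤ) ∣ k := by
  have hN' : (0 : ℝ) < N := by positivity
  have hK : IsCompact (Set.Icc (0 : ℝ) 1 ×ˢ Set.Icc (0 : ℝ) N) := isCompact_Icc.prod isCompact_Icc
  have key : ∀ k ∈ Finset.range N, ∃ δ > 0, k ≠ 0 → ∀ x ∈ Set.Icc (0 : ℝ) 1 ×ˢ Set.Icc (0 : ℝ) N,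
      δ ≤ ‖H (x.1, x.2 + k) - H x‖ := by
    intro k hk
    rcases eq_or_ne k 0 with rfl | hk0
    · exact ⟨1, one_pos, fun h => absurd rfl h⟩
    obtain ⟨x, hx, hmin⟩ := hK.exists_isMinOn ⟨(0, 0), by simp⟩
      (f := fun x : ℝ × ℝ => ‖H (x.1, x.2 + k) - H x‖) (by fun_prop)
    refine ⟨‖H (x.1, x.2 + k) - H x‖, ?_, fun _ y hy => hmin hy⟩
    rw [gt_iff_lt, norm_pos_iff, sub_ne_zero]
    intro h
    have := (hb x.1 hx.1).injective x.2 k (by simpa using h)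
    have h2 := Nat.le_of_dvd (by omega) (Int.natCast_dvd_natCast.1 this)
    have := Finset.mem_range.1 hk
    omega
  choose! d hd hd' using key
  obtain ⟨δ, hδ, hδ'⟩ : ∃ δ > 0, ∀ k ∈ Finset.range N, δ ≤ d k := by
    obtain ⟨k, hk, hmin⟩ := (Finset.range N).exists_min_image d ⟨0, by simpa using hN⟩
    exact ⟨d k, hd k hk, hmin⟩
  refine ⟨δ, hδ, fun t ht u k hlt => ?_⟩
  by_contra hdvd
  have hper : ∀ (u : ℝ) (m : ℤ), H (t, u + m * N) = H (t, u) := fun u m =>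
    (show Function.Periodic (fun u => H (t, u)) (N : ℝ) from (hb t ht).periodic).int_mul m u
  set r := (k % N).toNat with hr
  have hr0 : 0 ≤ k % (N : ℤ) := Int.emod_nonneg _ (by omega)
  have hrN : k % (N : ℤ) < N := Int.emod_lt_of_pos _ (by omega)
  have hrne : r ≠ 0 := by
    intro h
    exact hdvd (Int.dvd_of_emod_eq_zero (by omega))
  set v := toIcoMod hN' 0 u
  have hv := toIcoMod_mem_Ico hN' 0 u
  have hu : u = v + (toIcoDiv hN' 0 u : ℤ) * N := by
    have := toIcoMod_add_toIcoDiv_zsmul hN' 0 u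
    rw [zsmul_eq_mul] at this
    exact this.symm
  have hk : (k : ℝ) = (r : ℝ) + (k / N : ℤ) * N := by
    have h1 : (k : ℤ) = (r : ℤ) + (k / N) * N := by
      rw [hr, Int.toNat_of_nonneg hr0]
      linarith [Int.emod_add_mul_ediv k N]
    exact_mod_cast h1
  have e1 : H (t, u + k) = H (t, v + r) := by
    rw [← hper (v + r) (toIcoDiv hN' 0 u + k / N)]
    congr 2
    push_cast
    linarith
  have e2 : H (t, u) = H (t, v) := by rw [hu, hper]
  rw [e1, e2] at hlt
  have hmem : r ∈ Finset.range N := by rw [Finset.mem_range]; omega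
  have := hd' r hmem hrne (t, v) ⟨ht, by simpa using hv.1, by simpa using hv.2.le⟩
  have := hδ' r hmem
  simp only at *
  linarith

/-- The homotopy is sampled at finitely many times and each sample is replaced by a nearby smooth
closed braid; neighbouring ones are joined by `isotopic_of_near`. Thus all later deformations need
only be continuous. -/
theorem ClosedHomotopic.isotopic {N : ℕ} (hN : 0 < N) {B₀ B₁ : ℝ → ℂ}
    (h : ClosedHomotopic N B₀ B₁) (h0 : ContDiff ℝ ∞ B₀) (h1 : ContDiff ℝ ∞ B₁) :
    Isotopic (knotOf N B₀) (knotOf N B₁) := by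
  obtain ⟨H, hH, hb, e0, e1⟩ := h
  have hN' : (0 : ℝ) < N := by positivity
  obtain ⟨δ, hδ, hgap⟩ := exists_gap hN hH hb
  have hper : ∀ t ∈ Set.Icc (0 : ℝ) 1, Function.Periodic (fun u => H (t, u)) (N : ℝ) :=
    fun t ht => (hb t ht).periodic
  -- uniform continuity in the first variable
  obtain ⟨η, hη, huc⟩ : ∃ η > 0, ∀ t ∈ Set.Icc (0 : ℝ) 1, ∀ t' ∈ Set.Icc (0 : ℝ) 1,
      |t - t'| < η → ∀ u, ‖H (t, u) - H (t', u)‖ < δ / 4 := by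
    have hK : IsCompact (Set.Icc (0 : ℝ) 1 ×ˢ Set.Icc (0 : ℝ) N) :=
      isCompact_Icc.prod isCompact_Icc
    obtain ⟨η, hη, hu⟩ := Metric.uniformContinuousOn_iff.1
      (hK.uniformContinuousOn_of_continuous hH.continuousOn) (δ / 4) (by positivity)
    refine ⟨η, hη, fun t ht t' ht' htt u => ?_⟩
    have hv := toIcoMod_mem_Ico hN' 0 u
    have hu' : u = toIcoMod hN' 0 u + (toIcoDiv hN' 0 u : ℤ) * N := by
      have := toIcoMod_add_toIcoDiv_zsmul hN' 0 u
      rw [zsmul_eq_mul] at this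
      exact this.symm
    generalize toIcoMod hN' 0 u = v at *
    generalize toIcoDiv hN' 0 u = m at *
    subst hu'
    have := hu (t, v) ⟨ht, by simpa using hv.1, by simpa using hv.2.le⟩
      (t', v) ⟨ht', by simpa using hv.1, by simpa using hv.2.le⟩
      (by simpa [Prod.dist_eq, Real.dist_eq] using htt)
    rw [dist_eq_norm] at this
    have p1 := (hper t ht).int_mul m v
    have p2 := (hper t' ht').int_mul m v
    rw [p1, p2]
    exact this
  obtain ⟨M, hM⟩ := exists_nat_one_div_lt hη
  -- Sample times with step below `η`, capped at one so that they make sense for every index of the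
  -- induction.
  set τ : ℕ → ℝ := fun i => min 1 (i / (M + 1 : ℝ)) with hτ
  have hτm : ∀ i, τ i ∈ Set.Icc (0 : ℝ) 1 := fun i => ⟨le_min zero_le_one (by positivity),
    min_le_left _ _⟩
  have hex : ∀ i, ∃ g : ℝ → ℂ, ContDiff ℝ ∞ g ∧ Function.Periodic g N ∧
      ∀ u, ‖g u - H (τ i, u)‖ < δ / 4 := fun i =>
    exists_contDiff_near hN' (hb _ (hτm i)).continuous (hper _ (hτm i)) (by positivity)
  choose g hg hgp hgn using hex
  have hstep : ∀ i (g₁ : ℝ → ℂ), ContDiff ℝ ∞ g₁ → Function.Periodic g₁ N →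
      (∀ u, ‖g₁ u - H (τ i, u)‖ < δ / 2) → Isotopic (knotOf N (g i)) (knotOf N g₁) :=
    fun i g₁ a b c => isotopic_of_near hN (B := fun u => H (τ i, u)) (δ := δ)
      (hgap _ (hτm i)) (hg i) a (hgp i) b
      (fun u => (hgn i u).trans (by linarith)) c
  have hchain : ∀ i, Isotopic (knotOf N (g 0)) (knotOf N (g i)) := by
    intro i
    induction i with
    | zero =>
      exact Isotopic.refl (hstep 0 (g 0) (hg 0) (hgp 0)
        fun u => (hgn 0 u).trans (by linarith)).isKnot_left
    | succ i ih =>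
      refine ih.trans (hstep i _ (hg _) (hgp _) fun u => ?_)
      have h1 := hgn (i + 1) u
      have h2 := huc (τ (i + 1)) (hτm _) (τ i) (hτm _) (by
        refine lt_of_le_of_lt (abs_min_sub_min_le_max _ _ _ _) ?_
        refine lt_of_le_of_lt ?_ hM
        rw [sub_self, abs_zero]
        refine max_le (by positivity) ?_
        rw [← sub_div]
        push_cast
        rw [add_sub_cancel_left, abs_of_nonneg (by positivity)]) u
      calc ‖g (i + 1) u - H (τ i, u)‖
          = ‖(g (i + 1) u - H (τ (i + 1), u)) + (H (τ (i + 1), u) - H (τ i, u))‖ := by congr 1; ring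
        _ ≤ _ := norm_add_le _ _
        _ < δ / 2 := by linarith
  have hτ0 : τ 0 = 0 := by simp [hτ]
  have hτ1 : τ (M + 1) = 1 := by
    simp only [hτ]
    push_cast
    rw [div_self (by positivity), min_self]
  have hz : (0 : ℝ) ∈ Set.Icc (0 : ℝ) 1 := by simp
  have ho : (1 : ℝ) ∈ Set.Icc (0 : ℝ) 1 := by simp
  have c0 : Isotopic (knotOf N (g 0)) (knotOf N B₀) := hstep 0 B₀ h0
    (fun u => by simpa only [e0] using hper 0 hz u)
    (fun u => by rw [hτ0, e0, sub_self, norm_zero]; positivity)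
  have c1 : Isotopic (knotOf N (g (M + 1))) (knotOf N B₁) := hstep (M + 1) B₁ h1
    (fun u => by simpa only [e1] using hper 1 ho u)
    (fun u => by rw [hτ1, e1, sub_self, norm_zero]; positivity)
  exact c0.symm.trans ((hchain (M + 1)).trans c1)

theorem ClosedHomotopic.trans {N : ℕ} {B₀ B₁ B₂ : ℝ → ℂ} (h : ClosedHomotopic N B₀ B₁)
    (h' : ClosedHomotopic N B₁ B₂) : ClosedHomotopic N B₀ B₂ := by
  obtain ⟨F, hF, hk, h0, h1⟩ := h
  obtain ⟨G, hG, gk, g0, g1⟩ := h'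
  refine ⟨fun x => if x.1 ≤ 1 / 2 then F (2 * x.1, x.2) else G (2 * x.1 - 1, x.2), ?_,
    fun t ht => ?_, fun s => ?_, fun s => ?_⟩
  · refine Continuous.if_le (by fun_prop) (by fun_prop) continuous_fst continuous_const ?_
    rintro ⟨t, u⟩ ht
    simp only at ht
    subst ht
    norm_num [h1, g0]
  · by_cases h : t ≤ 1 / 2
    · simp only [h, if_true]
      exact hk _ ⟨by linarith [ht.1], by linarith⟩
    · simp only [h, if_false]
      exact gk _ ⟨by linarith, by linarith [ht.2]⟩
  · norm_num [h0]
  · norm_num [g1]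

theorem ClosedHomotopic.symm {N : ℕ} {B₀ B₁ : ℝ → ℂ} (h : ClosedHomotopic N B₀ B₁) :
    ClosedHomotopic N B₁ B₀ := by
  obtain ⟨F, hF, hk, h0, h1⟩ := h
  refine ⟨fun x => F (1 - x.1, x.2), hF.comp (by fun_prop), fun t ht => ?_, fun s => ?_,
    fun s => ?_⟩
  · exact hk (1 - t) ⟨by linarith [ht.2], by linarith [ht.1]⟩
  · simpa using h1 s
  · simpa using h0 s

open Equiv (Perm)

/-! ### Configuration spaces and their charts -/

/-- Configurations of distinct points in the plane, labelled by `Λ`. -/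
abbrev Conf (Λ : Type*) : Type _ := {Z : Λ → ℂ // Function.Injective Z}

/-- Relabelling of the points of a configuration, or forgetting some of them. -/
def Conf.comp {Λ Λ' : Type*} (f : Λ' ↪ Λ) : C(Conf Λ, Conf Λ') where
  toFun Z := ⟨Z.1 ∘ f, Z.2.comp f.injective⟩
  continuous_toFun := by
    refine Continuous.subtype_mk (continuous_pi fun k => ?_) _
    exact (continuous_apply (f k)).comp continuous_subtype_val

@[simp]
theorem Conf.comp_apply {Λ Λ' : Type*} (f : Λ' ↪ Λ) (Z : Conf Λ) (k : Λ') :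
    (Conf.comp f Z).1 k = Z.1 (f k) := rfl

/-- Configurations that can be pushed straight to heights `η`, without collisions: whenever two
points are vertically aligned, they are ordered as `η` prescribes. -/
def chart {Λ : Type*} (η : Λ → ℝ) : Set (Λ → ℂ) :=
  {Z | ∀ x y, η x < η y → (Z x).re = (Z y).re → (Z x).im < (Z y).im}

theorem injective_of_mem_chart {Λ : Type*} {η : Λ → ℝ} (hη : Function.Injective η) {Z : Λ → ℂ}
    (hZ : Z ∈ chart η) : Function.Injective Z := by
  intro x y h
  rcases lt_trichotomy (η x) (η y) with h1 | h1 | h1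
  · exact absurd (congrArg Complex.im h) (hZ x y h1 (congrArg Complex.re h)).ne
  · exact hη h1
  · exact absurd (congrArg Complex.im h) (hZ y x h1 (congrArg Complex.re h.symm)).ne'

/-- The star centre puts all points on the imaginary axis at their heights. Moving towards it scales
real parts by a common factor, so that no new alignments arise before the centre, and mixes two
correctly ordered pairs of imaginary parts. -/
theorem starConvex_chart {Λ : Type*} (η : Λ → ℝ) :
    StarConvex ℝ (fun x => (η x : ℂ) * Complex.I) (chart η) := by
  intro Z hZ a b ha hb hab x y hxy hre
  simp only [Pi.add_apply, Pi.smul_apply, Complex.add_re, Complex.add_im, Complex.real_smul,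
    Complex.re_ofReal_mul, Complex.im_ofReal_mul,
    Complex.I_re, Complex.I_im, mul_zero, mul_one, zero_add] at hre ⊢
  rcases eq_or_lt_of_le hb with rfl | hb'
  · have : a = 1 := by linarith
    subst this
    simpa using hxy
  · have := hZ x y hxy (mul_left_cancel₀ hb'.ne' hre)
    nlinarith [mul_le_mul_of_nonneg_left hxy.le ha, mul_lt_mul_of_pos_left this hb']

/-- A nonempty chart is star convex, hence contractible, and it consists of injective
configurations. -/
theorem homotopic_of_mem_chart {Λ : Type*} {η : Λ → ℝ} (hη : Function.Injective η) {x y : Conf Λ}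
    (p q : Path x y) (hp : ∀ s, (p s).1 ∈ chart η) (hq : ∀ s, (q s).1 ∈ chart η) :
    p.Homotopic q := by
  have hx : x.1 ∈ chart η := by simpa using hp 0
  have hy : y.1 ∈ chart η := by simpa using hp 1
  have : ContractibleSpace (chart η) := (starConvex_chart η).contractibleSpace ⟨_, hx⟩
  let f : C(chart η, Conf Λ) :=
    ⟨fun Z => ⟨Z.1, injective_of_mem_chart hη Z.2⟩, continuous_subtype_val.subtype_mk _⟩
  let lift (p : Path x y) (hp : ∀ s, (p s).1 ∈ chart η) :
      Path (⟨x.1, hx⟩ : chart η) ⟨y.1, hy⟩ :=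
    { toFun := fun s => ⟨(p s).1, hp s⟩
      continuous_toFun := (continuous_subtype_val.comp p.continuous).subtype_mk _
      source' := by simp
      target' := by simp }
  exact (SimplyConnectedSpace.paths_homotopic (lift p hp) (lift q hq)).map f

/-! ### Groups of motions in the plane -/

/-- The action of a permutation of the labels. -/
def act {Λ : Type*} (π : Perm Λ) : C(Conf Λ, Conf Λ) := Conf.comp π.toEmbedding

@[simp]
theorem act_apply {Λ : Type*} (π : Perm Λ) (Z : Conf Λ) (k : Λ) : (act π Z).1 k = Z.1 (π k) := rfl

theorem act_act {Λ : Type*} (π π' : Perm Λ) (Z : Conf Λ) : act π (act π' Z) = act (π' * π) Z := rfl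

theorem act_one {Λ : Type*} (Z : Conf Λ) : act 1 Z = Z := rfl


def base : Conf ℕ := ⟨fun k => k, Nat.cast_injective⟩

@[simp]
theorem base_apply (k : ℕ) : base.1 k = k := rfl

/-- A motion of the points of a configuration which permutes them. -/
structure Motion {Λ : Type} (x₀ : Conf Λ) where
  /-- The resulting permutation. -/
  perm : Perm Λ
  /-- The motion of the strands. -/
  path : Path x₀ (act perm x₀)

namespace Motion

variable {Λ : Type} {x₀ : Conf Λ}

/-- Homotopy of motions. -/
def Equivalent (m m' : Motion x₀) : Prop :=
  m.perm = m'.perm ∧ ∃ p : Path x₀ (act m'.perm x₀), (∀ s, p s = m.path s) ∧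
    p.Homotopic m'.path

theorem Equivalent.of_path {π : Perm Λ} {p q : Path x₀ (act π x₀)} (h : p.Homotopic q) :
    Equivalent ⟨π, p⟩ ⟨π, q⟩ := ⟨rfl, p, fun _ => rfl, h⟩

theorem Equivalent.of_eq {m m' : Motion x₀} (h : m.perm = m'.perm)
    (h' : ∀ s, m.path s = m'.path s) : Equivalent m m' :=
  ⟨h, m'.path, fun s => (h' s).symm, Path.Homotopic.refl _⟩

/-- The endpoint of a path depends on its permutation. Putting both motions over one permutation
turns equivalence into plain homotopy of paths, free of casts. -/
theorem Equivalent.elim {m m' : Motion x₀} (h : Equivalent m m') :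
    ∃ (π : Perm Λ) (p q : Path x₀ (act π x₀)), m = ⟨π, p⟩ ∧ m' = ⟨π, q⟩ ∧ p.Homotopic q := by
  obtain ⟨π, p⟩ := m
  obtain ⟨π', q⟩ := m'
  obtain ⟨h1, r, hr, h2⟩ := h
  dsimp only at h1
  subst h1
  have : r = p := Path.ext (funext hr)
  subst this
  exact ⟨π, r, q, rfl, rfl, h2⟩

instance setoid : Setoid (Motion x₀) where
  r := Equivalent
  iseqv :=
    { refl := fun m => Equivalent.of_path (Path.Homotopic.refl _)
      symm := fun h => by
        obtain ⟨π, p, q, rfl, rfl, k⟩ := h.elim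
        exact Equivalent.of_path k.symm
      trans := fun h h' => by
        obtain ⟨π, p, q, rfl, rfl, k⟩ := h.elim
        obtain ⟨π', p', q', h1, rfl, k'⟩ := h'.elim
        cases h1
        exact Equivalent.of_path (k.trans k') }

/-- The second motion is relabelled by the permutation of the first, so that it continues the
strands already moving. Products run from left to right while permutations compose from right to
left. -/
instance : Mul (Motion x₀) where
  mul m m' := ⟨m'.perm * m.perm, m.path.trans (m'.path.map (act m.perm).continuous)⟩

instance : One (Motion x₀) where
  one := ⟨1, Path.refl x₀⟩

instance : Inv (Motion x₀) where
  inv m := ⟨m.perm⁻¹, (m.path.symm.map (act m.perm⁻¹).continuous).cast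
    (by rw [act_act, mul_inv_cancel, act_one]) rfl⟩

theorem perm_mul (m m' : Motion x₀) : (m * m').perm = m'.perm * m.perm := rfl
theorem path_mul (m m' : Motion x₀) :
    (m * m').path = m.path.trans (m'.path.map (act m.perm).continuous) := rfl
theorem path_mul_apply (m m' : Motion x₀) (s : unitInterval) :
    (m * m').path s = if h : (s : ℝ) ≤ 1 / 2 then
      m.path ⟨2 * s, (unitInterval.mul_pos_mem_iff zero_lt_two).2 ⟨s.2.1, h⟩⟩
    else act m.perm (m'.path ⟨2 * s - 1, unitInterval.two_mul_sub_one_mem_iff.2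
      ⟨(not_le.1 h).le, s.2.2⟩⟩) :=
  Path.trans_apply _ _ _
theorem perm_one : (1 : Motion x₀).perm = 1 := rfl
theorem path_one : (1 : Motion x₀).path = Path.refl x₀ := rfl
theorem path_inv_apply (m : Motion x₀) (s : unitInterval) :
    m⁻¹.path s = act m.perm⁻¹ (m.path.symm s) := rfl

theorem mul_congr {m₁ m₂ m₁' m₂' : Motion x₀} (h : m₁ ≈ m₂) (h' : m₁' ≈ m₂') :
    m₁ * m₁' ≈ m₂ * m₂' := by
  obtain ⟨π, p, q, rfl, rfl, k⟩ := Equivalent.elim h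
  obtain ⟨π', p', q', rfl, rfl, k'⟩ := Equivalent.elim h'
  exact Equivalent.of_path (Path.Homotopic.hcomp k (k'.map (act π)))

theorem inv_congr {m₁ m₂ : Motion x₀} (h : m₁ ≈ m₂) : m₁⁻¹ ≈ m₂⁻¹ := by
  obtain ⟨π, p, q, rfl, rfl, k⟩ := Equivalent.elim h
  exact Equivalent.of_path ((k.symm₂.map (act π⁻¹)).pathCast _ _)

theorem mul_assoc_equiv (a b c : Motion x₀) : a * b * c ≈ a * (b * c) := by
  refine ⟨rfl, (a * b * c).path, fun _ => rfl, ?_⟩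
  have h := Path.Homotopy.transAssoc a.path (b.path.map (act a.perm).continuous)
    ((c.path.map (act b.perm).continuous).map (act a.perm).continuous)
  have e : (a * (b * c)).path = a.path.trans ((b.path.map (act a.perm).continuous).trans
      ((c.path.map (act b.perm).continuous).map (act a.perm).continuous)) := by
    rw [← Path.map_trans]
    rfl
  rw [e]
  exact ⟨h⟩

theorem one_mul_equiv (a : Motion x₀) : 1 * a ≈ a :=
  ⟨rfl, (1 * a).path, fun _ => rfl, ⟨Path.Homotopy.reflTrans a.path⟩⟩

theorem mul_one_equiv (a : Motion x₀) : a * 1 ≈ a := by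
  refine ⟨rfl, (a * 1).path, fun _ => rfl, ?_⟩
  have e : (a * 1).path = a.path.trans (Path.refl (act a.perm x₀)) := by
    rw [path_mul]
    congr 1
  rw [e]
  exact ⟨Path.Homotopy.transRefl a.path⟩

theorem inv_mul_equiv (a : Motion x₀) : a⁻¹ * a ≈ 1 := by
  have hp : (a⁻¹ * a).perm = 1 := mul_inv_cancel a.perm
  have hb : act a.perm⁻¹ (act a.perm x₀) = x₀ := by rw [act_act, mul_inv_cancel, act_one]
  refine ⟨hp, ((a.path.symm.trans a.path).map (act a.perm⁻¹).continuous).cast hb.symm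
    (by rw [perm_one, act_one, hb]), fun s => ?_, ?_⟩
  · rw [path_mul_apply]
    simp only [Path.cast_coe, Path.map_coe, Function.comp_apply, Path.trans_apply]
    split_ifs <;> rfl
  · have h0 : (a.path.symm.trans a.path).Homotopic (Path.refl _) :=
      ⟨(Path.Homotopy.reflSymmTrans a.path).symm⟩
    have h := ((h0.map (act a.perm⁻¹)).pathCast hb.symm
        (show act 1 x₀ = _ by rw [act_one, hb]))
    refine h.trans ?_
    have : (1 : Motion x₀).path = ((Path.refl (act a.perm x₀)).map
      (act a.perm⁻¹).continuous).cast hb.symm (show act 1 x₀ = _ by rw [act_one, hb]) := by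
      ext s
      simp [path_one, hb]
      rfl
    rw [this]

/-- A motion that is described by a function of time. -/
def ofFun (π : Perm Λ) (f : ℝ → Λ → ℂ) (hc : ∀ k, Continuous fun s => f s k)
    (hinj : ∀ s ∈ Set.Icc (0 : ℝ) 1, Function.Injective (f s)) (h0 : ∀ k, f 0 k = x₀.1 k)
    (h1 : ∀ k, f 1 k = x₀.1 (π k)) : Motion x₀ where
  perm := π
  path :=
    { toFun := fun s => ⟨f s, hinj s s.2⟩
      continuous_toFun := Continuous.subtype_mk
        (continuous_pi fun k => (hc k).comp continuous_subtype_val) _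
      source' := Subtype.ext (funext fun k => by simpa using h0 k)
      target' := Subtype.ext (funext fun k => by simpa using h1 k) }

/-- The motion stays in a chart. -/
def InChart (η : Λ → ℝ) (m : Motion x₀) : Prop := ∀ s, (m.path s).1 ∈ chart η

/-- Heights belong to strands and not to positions, so for the second factor they are transported by
the permutation of the first. -/
theorem InChart.mul {η : Λ → ℝ} {m m' : Motion x₀} (h : InChart η m)
    (h' : InChart (η ∘ m.perm.symm) m') : InChart η (m * m') := by
  intro s
  rw [path_mul_apply]
  split_ifs
  · exact h _
  · intro x y hxy hre
    refine h' ⟨2 * (s : ℝ) - 1, _⟩ (m.perm x) (m.perm y) (by simpa using hxy) hre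

theorem InChart.equiv {η : Λ → ℝ} (hη : Function.Injective η) {m m' : Motion x₀} (h : InChart η m)
    (h' : InChart η m') (hp : m.perm = m'.perm) : m ≈ m' := by
  obtain ⟨π, p⟩ := m
  obtain ⟨π', p'⟩ := m'
  dsimp only at hp
  subst hp
  exact Equivalent.of_path (homotopic_of_mem_chart hη p p' h h')

end Motion

/-- The group of homotopy classes of motions of a configuration, in the plane, which permute its
points. -/
def Braid {Λ : Type} (x₀ : Conf Λ) : Type := Quotient (Motion.setoid (x₀ := x₀))

namespace Braid

variable {Λ : Type} {x₀ : Conf Λ}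

/-- The class of a motion. -/
def mk (m : Motion x₀) : Braid x₀ := Quotient.mk _ m

theorem mk_eq {m m' : Motion x₀} : mk m = mk m' ↔ m ≈ m' := Quotient.eq

theorem exists_rep (g : Braid x₀) : ∃ m, mk m = g := Quotient.exists_rep g

instance : Group (Braid x₀) where
  mul := Quotient.map₂ (· * ·) fun _ _ h _ _ h' => Motion.mul_congr h h'
  one := mk 1
  inv := Quotient.map (·⁻¹) fun _ _ h => Motion.inv_congr h
  mul_assoc := by
    rintro ⟨a⟩ ⟨b⟩ ⟨c⟩
    exact Quotient.sound (Motion.mul_assoc_equiv a b c)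
  one_mul := by
    rintro ⟨a⟩
    exact Quotient.sound (Motion.one_mul_equiv a)
  mul_one := by
    rintro ⟨a⟩
    exact Quotient.sound (Motion.mul_one_equiv a)
  inv_mul_cancel := by
    rintro ⟨a⟩
    exact Quotient.sound (Motion.inv_mul_equiv a)

theorem mk_mul (m m' : Motion x₀) : mk (m * m') = mk m * mk m' := rfl
theorem mk_inv (m : Motion x₀) : mk m⁻¹ = (mk m)⁻¹ := rfl

/-- The permutation of a braid, as an antihomomorphism. -/
def perm (g : Braid x₀) : Perm Λ := Quotient.lift Motion.perm (fun m m' (h : Motion.Equivalent m m') => h.1) g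

@[simp] theorem perm_mk (m : Motion x₀) : perm (mk m) = m.perm := rfl
@[simp] theorem perm_mul (g h : Braid x₀) : perm (g * h) = perm h * perm g := by
  obtain ⟨m, rfl⟩ := exists_rep g
  obtain ⟨m', rfl⟩ := exists_rep h
  rfl
@[simp] theorem perm_one : perm (1 : Braid x₀) = 1 := rfl

/-- The braid is represented by a motion in a chart. -/
def InChart (η : Λ → ℝ) (g : Braid x₀) : Prop := ∃ m, mk m = g ∧ m.InChart η

theorem InChart.mul {η : Λ → ℝ} {g h : Braid x₀} (hg : InChart η g)
    (hh : InChart (η ∘ (perm g).symm) h) : InChart η (g * h) := by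
  obtain ⟨m, rfl, hm⟩ := hg
  obtain ⟨m', rfl, hm'⟩ := hh
  exact ⟨m * m', rfl, hm.mul hm'⟩

/-- This is the source of all braid identities below: heights are found for which both sides are
represented in the chart, and then only permutations have to be compared. -/
theorem InChart.eq {η : Λ → ℝ} (hη : Function.Injective η) {g h : Braid x₀} (hg : InChart η g)
    (hh : InChart η h) (hp : perm g = perm h) : g = h := by
  obtain ⟨m, rfl, hm⟩ := hg
  obtain ⟨m', rfl, hm'⟩ := hh
  exact mk_eq.2 (hm.equiv hη hm' hp)

theorem inChart_one {η : ℕ → ℝ} : InChart η (1 : Braid base) := by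
  refine ⟨1, rfl, fun s x y hxy hre => ?_⟩
  have hre : ((x : ℂ)).re = ((y : ℂ)).re := hre
  simp only [Complex.natCast_re, Nat.cast_inj] at hre
  subst hre
  exact absurd hxy (lt_irrefl _)

end Braid

/-! ### Artin words as motions -/

/-- The sign of a letter. -/
def letterSign (a : ArtinLetter) : ℝ := if a.2 then 1 else -1

theorem letterSign_sq (a : ArtinLetter) : letterSign a * letterSign a = 1 := by
  unfold letterSign; split_ifs <;> norm_num

theorem exp_letterSign (a : ArtinLetter) (x : ℝ) :
    Complex.exp ((if a.2 then 1 else -1) * Real.pi * x * Complex.I) =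
      (Real.cos (Real.pi * x) : ℂ) + ((letterSign a * Real.sin (Real.pi * x) : ℝ) : ℂ) *
        Complex.I := by
  have : ((if a.2 then (1 : ℂ) else -1) * Real.pi * x * Complex.I) =
      ((letterSign a * (Real.pi * x) : ℝ) : ℂ) * Complex.I := by
    unfold letterSign
    split_ifs <;> push_cast <;> ring
  rw [this, Complex.exp_mul_I, ← Complex.ofReal_cos, ← Complex.ofReal_sin]
  unfold letterSign
  split_ifs
  · simp
  · rw [neg_one_mul, Real.cos_neg, Real.sin_neg, neg_one_mul]

theorem letterPath_re (a : ArtinLetter) (k : ℕ) (s : ℝ) : (letterPath a k s).re =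
    if k = a.1 then a.1 + 1 / 2 - Real.cos (Real.pi * Real.smoothTransition s) / 2
    else if k = a.1 + 1 then a.1 + 1 / 2 + Real.cos (Real.pi * Real.smoothTransition s) / 2
    else k := by
  unfold letterPath
  rw [exp_letterSign]
  generalize Real.cos (Real.pi * Real.smoothTransition s) = C
  generalize letterSign a * Real.sin (Real.pi * Real.smoothTransition s) = S
  dsimp only
  split_ifs <;> simp

theorem letterPath_im (a : ArtinLetter) (k : ℕ) (s : ℝ) : (letterPath a k s).im =
    if k = a.1 then - (letterSign a * Real.sin (Real.pi * Real.smoothTransition s) / 2)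
    else if k = a.1 + 1 then letterSign a * Real.sin (Real.pi * Real.smoothTransition s) / 2
    else 0 := by
  unfold letterPath
  rw [exp_letterSign]
  generalize Real.cos (Real.pi * Real.smoothTransition s) = C
  generalize letterSign a * Real.sin (Real.pi * Real.smoothTransition s) = S
  dsimp only
  split_ifs <;> simp

theorem sin_smoothTransition_nonneg (s : ℝ) :
    0 ≤ Real.sin (Real.pi * Real.smoothTransition s) :=
  Real.sin_nonneg_of_nonneg_of_le_pi (mul_nonneg Real.pi_pos.le (Real.smoothTransition.nonneg s))
    (by nlinarith [Real.pi_pos, Real.smoothTransition.le_one s])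

theorem letterPath_of_nonpos (a : ArtinLetter) (k : ℕ) {s : ℝ} (hs : s ≤ 0) :
    letterPath a k s = k := by
  apply Complex.ext
  · rw [letterPath_re, Real.smoothTransition.zero_of_nonpos hs]
    split_ifs with h1 h2
    · rw [h1]; norm_num
    · rw [h2]; norm_num
      ring
    · simp
  · rw [letterPath_im, Real.smoothTransition.zero_of_nonpos hs]
    split_ifs <;> simp

theorem letterPath_of_one_le (a : ArtinLetter) (k : ℕ) {s : ℝ} (hs : 1 ≤ s) :
    letterPath a k s = (swap a.1 (a.1 + 1) k : ℕ) := by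
  apply Complex.ext
  · rw [letterPath_re, Real.smoothTransition.one_of_one_le hs, Equiv.swap_apply_def]
    split_ifs with h1 h2
    · norm_num
      ring
    · norm_num
    · simp
  · rw [letterPath_im, Real.smoothTransition.one_of_one_le hs]
    split_ifs <;> simp

theorem contDiff_letterPath (a : ArtinLetter) (k : ℕ) : ContDiff ℝ ∞ (letterPath a k) := by
  have hS : ContDiff ℝ ∞ fun s => ((Real.smoothTransition s : ℝ) : ℂ) :=
    Complex.ofRealCLM.contDiff.comp Real.smoothTransition.contDiff
  have hr : ContDiff ℝ ∞ fun s => Complex.exp ((if a.2 then 1 else -1) * Real.pi *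
      Real.smoothTransition s * Complex.I) := ((contDiff_const.mul hS).mul contDiff_const).cexp
  unfold letterPath
  by_cases h1 : k = a.1
  · simp only [h1, if_true]
    exact contDiff_const.sub (hr.div_const _)
  · by_cases h2 : k = a.1 + 1
    · simp only [h2, Nat.succ_ne_self, if_false, if_true]
      exact contDiff_const.add (hr.div_const _)
    · simp only [h1, h2, if_false]
      exact contDiff_const

/-- The two moving points are aligned only when the cosine vanishes; then the sine is one and the
sign of the letter decides which point is above. Their real parts stay in `[i, i + 1]`, so they are
never aligned with a resting point. -/
theorem letterPath_mem_chart (a : ArtinLetter) {η : ℕ → ℝ}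
    (h : 0 < letterSign a * (η (a.1 + 1) - η a.1)) (s : ℝ) :
    (fun k => letterPath a k s) ∈ chart η := by
  obtain ⟨i, b⟩ := a
  intro x y hxy hre
  dsimp only at hre h ⊢
  rw [letterPath_re, letterPath_re] at hre
  rw [letterPath_im, letterPath_im]
  dsimp only at hre ⊢
  have hc := Real.neg_one_le_cos (Real.pi * Real.smoothTransition s)
  have hc' := Real.cos_le_one (Real.pi * Real.smoothTransition s)
  have hs := sin_smoothTransition_nonneg s
  have hsc := Real.sin_sq_add_cos_sq (Real.pi * Real.smoothTransition s)
  set C := Real.cos (Real.pi * Real.smoothTransition s)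
  set S := Real.sin (Real.pi * Real.smoothTransition s)
  have key : ∀ z : ℕ, z ≠ i → z ≠ i + 1 → (i : ℝ) ≤ z → (z : ℝ) ≤ i + 1 → False := by
    intro z h1 h2 h3 h4
    have h3 : i ≤ z := by exact_mod_cast h3
    have h4 : z ≤ i + 1 := by exact_mod_cast h4
    omega
  have hS1 : C = 0 → S = 1 := fun h => by
    rw [h] at hsc
    nlinarith
  have hsq := letterSign_sq (i, b)
  split_ifs at hre ⊢ with h1 h2 h3 h4 h5 h6 h7 h8
  · subst h1; subst h2; exact absurd hxy (lt_irrefl _)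
  · subst h1; subst h3
    rw [hS1 (by linarith)]
    have : 0 < letterSign (x, b) := by
      by_contra hn
      nlinarith
    linarith
  · exact (key y h2 h3 (by linarith) (by linarith)).elim
  · subst h4; subst h5
    rw [hS1 (by linarith)]
    have : letterSign (y, b) < 0 := by
      by_contra hn
      nlinarith
    linarith
  · subst h4; subst h6; exact absurd hxy (lt_irrefl _)
  · exact (key y h5 h6 (by linarith) (by linarith)).elim
  · exact (key x h1 h4 (by linarith) (by linarith)).elim
  · exact (key x h1 h4 (by linarith) (by linarith)).elim
  · have : x = y := by exact_mod_cast hre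
    subst this
    exact absurd hxy (lt_irrefl _)

theorem letterPath_injective (a : ArtinLetter) (s : ℝ) :
    Function.Injective fun k => letterPath a k s := by
  have hinj : Function.Injective fun k : ℕ => letterSign a * (k : ℝ) := by
    intro x y hxy
    have h := letterSign_sq a
    have : letterSign a ≠ 0 := fun h0 => by rw [h0] at h; norm_num at h
    exact_mod_cast mul_left_cancel₀ this hxy
  refine injective_of_mem_chart hinj (letterPath_mem_chart a ?_ s)
  have h := letterSign_sq a
  push_cast
  nlinarith

theorem braidPath_of_nonpos (w : List ArtinLetter) (k : ℕ) {s : ℝ} (hs : s ≤ 0) :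
    braidPath w k s = k := by
  cases w with
  | nil => rfl
  | cons a w =>
    rw [braidPath, if_pos (by linarith), letterPath_of_nonpos a k hs]

/-- As a sum, in which each term is constant where the other one moves, the path is visibly smooth;
the definition by cases does not show this. -/
theorem braidPath_cons (a : ArtinLetter) (w : List ArtinLetter) (k : ℕ) (s : ℝ) :
    braidPath (a :: w) k s = letterPath a k s +
      (braidPath w (swap a.1 (a.1 + 1) k) (s - 1) - (swap a.1 (a.1 + 1) k : ℕ)) := by
  rw [braidPath]
  split_ifs with h
  · rw [braidPath_of_nonpos w _ (by linarith)]
    ring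
  · rw [letterPath_of_one_le a k (by linarith)]
    ring

theorem braidPath_cons_of_le {a : ArtinLetter} {w : List ArtinLetter} {k : ℕ} {s : ℝ}
    (h : s ≤ 1) : braidPath (a :: w) k s = letterPath a k s := by
  rw [braidPath, if_pos h]

theorem braidPath_cons_of_ge {a : ArtinLetter} {w : List ArtinLetter} {k : ℕ} {s : ℝ}
    (h : 1 ≤ s) : braidPath (a :: w) k s = braidPath w (swap a.1 (a.1 + 1) k) (s - 1) := by
  rw [braidPath_cons, letterPath_of_one_le a k h]
  ring

theorem braidPath_of_length_le (w : List ArtinLetter) (k : ℕ) {s : ℝ} (hs : w.length ≤ s) :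
    braidPath w k s = (braidPerm w k : ℕ) := by
  induction w generalizing k s with
  | nil => rfl
  | cons a w ih =>
    rw [List.length_cons] at hs
    push_cast at hs
    have h0 : (0 : ℝ) ≤ w.length := Nat.cast_nonneg _
    rw [braidPath_cons_of_ge (by linarith), ih _ (by linarith)]
    rfl

theorem contDiff_braidPath (w : List ArtinLetter) (k : ℕ) : ContDiff ℝ ∞ (braidPath w k) := by
  induction w generalizing k with
  | nil => exact contDiff_const
  | cons a w ih =>
    have : braidPath (a :: w) k = fun s => letterPath a k s +
      (braidPath w (swap a.1 (a.1 + 1) k) (s - 1) - (swap a.1 (a.1 + 1) k : ℕ)) :=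
      funext fun s => braidPath_cons a w k s
    rw [this]
    exact (contDiff_letterPath a k).add (((ih _).comp (by fun_prop)).sub contDiff_const)

theorem braidPath_injective (w : List ArtinLetter) (s : ℝ) :
    Function.Injective fun k => braidPath w k s := by
  induction w generalizing s with
  | nil => exact Nat.cast_injective
  | cons a w ih =>
    rcases le_total s 1 with h | h
    · simpa only [braidPath_cons_of_le h] using letterPath_injective a s
    · simp only [braidPath_cons_of_ge h]
      exact (ih (s - 1)).comp (swap a.1 (a.1 + 1)).injective

/-- The motion of one Artin letter. -/
def letterMotion (a : ArtinLetter) : Motion base :=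
  Motion.ofFun (swap a.1 (a.1 + 1)) (fun s k => letterPath a k s)
    (fun k => (contDiff_letterPath a k).continuous) (fun s _ => letterPath_injective a s)
    (fun k => letterPath_of_nonpos a k le_rfl) (fun k => letterPath_of_one_le a k le_rfl)

/-- The motion of an Artin word. -/
def wordMotion (w : List ArtinLetter) : Motion base :=
  Motion.ofFun (braidPerm w) (fun s k => braidPath w k (w.length * s))
    (fun k => (contDiff_braidPath w k).continuous.comp (by fun_prop))
    (fun s _ => braidPath_injective w _)
    (fun k => braidPath_of_nonpos w k (by simp)) (fun k => braidPath_of_length_le w k (by simp))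

theorem Motion.Equivalent.of_homotopic {m m' : Motion base} (h : m.perm = m'.perm)
    {p q : Path base (act m'.perm base)} (hpq : p.Homotopic q) (hp : ∀ s, p s = m.path s)
    (hq : ∀ s, q s = m'.path s) : m ≈ m' := by
  refine ⟨h, p, hp, ?_⟩
  have : q = m'.path := Path.ext (funext hq)
  rwa [← this]

/-- The straight path between two real numbers. -/
def realSegment (a b : ℝ) : Path a b where
  toFun s := (1 - s) * a + s * b
  continuous_toFun := by fun_prop
  source' := by simp
  target' := by simp

/-- Both sides run through the same configurations at different speeds. They are images of two paths
in `ℝ` with equal endpoints, and `ℝ` is simply connected. -/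
theorem wordMotion_cons (a : ArtinLetter) (w : List ArtinLetter) :
    wordMotion (a :: w) ≈ letterMotion a * wordMotion w := by
  let M : C(ℝ, Conf ℕ) := ⟨fun s => ⟨fun k => braidPath (a :: w) k s, braidPath_injective _ s⟩,
    Continuous.subtype_mk
      (continuous_pi fun k => (contDiff_braidPath (a :: w) k).continuous) _⟩
  have h0 : base = M 0 := Subtype.ext (funext fun k =>
    (braidPath_of_nonpos (a :: w) k le_rfl).symm)
  have h1 : act (letterMotion a * wordMotion w).perm base = M (w.length + 1) :=
    Subtype.ext (funext fun k => (braidPath_of_length_le (a :: w) k (by simp)).symm)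
  have hh := ((SimplyConnectedSpace.paths_homotopic (realSegment 0 (w.length + 1))
    ((realSegment 0 1).trans (realSegment 1 (w.length + 1)))).map M).pathCast h0 h1
  refine Motion.Equivalent.of_homotopic rfl hh (fun s => ?_) fun s => ?_
  · refine Subtype.ext (funext fun k => ?_)
    show braidPath (a :: w) k ((1 - s) * 0 + s * (w.length + 1)) =
      braidPath (a :: w) k (((a :: w).length : ℝ) * s)
    congr 1
    rw [List.length_cons]
    push_cast
    ring
  · rw [Motion.path_mul_apply]
    simp only [Path.cast_coe, Path.map_coe, Function.comp_apply, Path.trans_apply]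
    split_ifs with h
    · refine Subtype.ext (funext fun k => ?_)
      show braidPath (a :: w) k ((1 - 2 * s) * 0 + 2 * s * 1) = letterPath a k (2 * s)
      rw [braidPath_cons_of_le (by linarith)]
      congr 1
      ring
    · refine Subtype.ext (funext fun k => ?_)
      show braidPath (a :: w) k ((1 - (2 * s - 1)) * 1 + (2 * s - 1) * (w.length + 1)) =
        braidPath w (swap a.1 (a.1 + 1) k) (w.length * (2 * s - 1))
      have h3 : (0 : ℝ) ≤ w.length := Nat.cast_nonneg _
      rw [braidPath_cons_of_ge (by nlinarith [s.2.1, s.2.2])]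
      congr 1
      ring

/-- The braid of a letter. -/
def letter (a : ArtinLetter) : Braid base := Braid.mk (letterMotion a)

/-- The braid of an Artin word. -/
def ofWord (w : List ArtinLetter) : Braid base := (w.map letter).prod

theorem mk_wordMotion (w : List ArtinLetter) : Braid.mk (wordMotion w) = ofWord w := by
  induction w with
  | nil =>
    refine Braid.mk_eq.2 (Motion.Equivalent.of_eq rfl fun s => ?_)
    refine Subtype.ext (funext fun k => ?_)
    rfl
  | cons a w ih =>
    rw [Braid.mk_eq.2 (wordMotion_cons a w), Braid.mk_mul, ih]
    simp [ofWord, letter]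

theorem ofWord_append (w w' : List ArtinLetter) : ofWord (w ++ w') = ofWord w * ofWord w' := by
  simp [ofWord]

@[simp] theorem ofWord_nil : ofWord [] = 1 := rfl

@[simp] theorem perm_letter (a : ArtinLetter) : (letter a).perm = swap a.1 (a.1 + 1) := rfl

theorem inChart_letter {a : ArtinLetter} {η : ℕ → ℝ}
    (h : 0 < letterSign a * (η (a.1 + 1) - η a.1)) : (letter a).InChart η :=
  ⟨letterMotion a, rfl, fun s => letterPath_mem_chart a h s⟩

/-- The braid of the Artin generator `σ_i`. -/
def sigma (i : ℕ) : Braid base := letter (i, true)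

theorem inChart_sigma {i : ℕ} {η : ℕ → ℝ} (h : η i < η (i + 1)) : (sigma i).InChart η :=
  inChart_letter (by simpa [letterSign] using h)

@[simp] theorem perm_sigma (i : ℕ) : (sigma i).perm = swap i (i + 1) := rfl

theorem inChart_letter_false {i : ℕ} {η : ℕ → ℝ} (h : η (i + 1) < η i) :
    (letter (i, false)).InChart η :=
  inChart_letter (by simpa [letterSign] using h)

theorem letter_false (i : ℕ) : letter (i, false) = (sigma i)⁻¹ := by
  symm
  rw [inv_eq_iff_mul_eq_one]
  refine Braid.InChart.eq (η := fun k : ℕ => (k : ℝ)) Nat.cast_injective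
    ((inChart_sigma (by simp)).mul (inChart_letter_false ?_)) Braid.inChart_one ?_
  · simp
  · simp

theorem commute_sigma {i j : ℕ} (h : i + 2 ≤ j) : Commute (sigma i) (sigma j) := by
  refine Braid.InChart.eq (η := fun k : ℕ => (k : ℝ)) Nat.cast_injective
    ((inChart_sigma (by simp)).mul (inChart_sigma ?_))
    ((inChart_sigma (by simp)).mul (inChart_sigma ?_)) ?_
  · simp only [perm_sigma, Equiv.symm_swap, Function.comp_apply]
    rw [Equiv.swap_apply_of_ne_of_ne (by omega) (by omega),
      Equiv.swap_apply_of_ne_of_ne (by omega) (by omega)]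
    simp
  · simp only [perm_sigma, Equiv.symm_swap, Function.comp_apply]
    rw [Equiv.swap_apply_of_ne_of_ne (by omega) (by omega),
      Equiv.swap_apply_of_ne_of_ne (by omega) (by omega)]
    simp
  · simp only [Braid.perm_mul, perm_sigma]
    refine Equiv.ext fun k => ?_
    simp only [Equiv.Perm.mul_apply, Equiv.swap_apply_def]
    split_ifs <;> omega

theorem commute_letter {a b : ArtinLetter} (h : a.1 + 2 ≤ b.1) : Commute (letter a) (letter b) := by
  obtain ⟨i, c⟩ := a
  obtain ⟨j, d⟩ := b
  have := commute_sigma (show i + 2 ≤ j from h)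
  cases c <;> cases d
  · rw [letter_false, letter_false]; exact this.inv_inv
  · rw [letter_false]; exact this.inv_left
  · rw [letter_false]; exact this.inv_right
  · exact this

theorem commute_ofWord {w w' : List ArtinLetter} (h : ∀ a ∈ w, ∀ b ∈ w', a.1 + 2 ≤ b.1) :
    Commute (ofWord w) (ofWord w') := by
  refine Commute.list_prod_left _ _ fun x hx => Commute.list_prod_right _ _ fun y hy => ?_
  obtain ⟨a, ha, rfl⟩ := List.mem_map.1 hx
  obtain ⟨b, hb, rfl⟩ := List.mem_map.1 hy
  exact commute_letter (h a ha b hb)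

/-! ### Runs of generators and band generators -/

/-- The braid `σ_i ⋯ σ_{i+m-1}`. -/
def run (i m : ℕ) : Braid base := ofWord ((List.range' i m).map fun k => (k, true))

/-- The braid of a band generator. -/
def band (b : Band) : Braid base := ofWord (bandWord b)

@[simp] theorem run_zero (i : ℕ) : run i 0 = 1 := rfl

theorem run_succ (i m : ℕ) : run i (m + 1) = sigma i * run (i + 1) m := by
  simp [run, ofWord, sigma, List.range'_succ]

theorem run_add (i m l : ℕ) : run i (m + l) = run i m * run (i + m) l := by
  simp [run, ← ofWord_append, ← List.map_append, List.range'_append_1]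

theorem run_succ' (i m : ℕ) : run i (m + 1) = run i m * sigma (i + m) := by
  rw [run_add, run_succ, run_zero, mul_one]

theorem ofWord_reverse_false (l : List ℕ) :
    ofWord (l.reverse.map fun k => (k, false)) = (ofWord (l.map fun k => (k, true)))⁻¹ := by
  induction l with
  | nil => simp
  | cons a l ih =>
    rw [List.reverse_cons, List.map_append, ofWord_append, ih, List.map_cons]
    simp [ofWord, letter_false, sigma]

theorem band_eq (i m : ℕ) : band (i, i + 1 + m) = run i (m + 1) * (run i m)⁻¹ := by
  have h1 : i + 1 + m - 1 - i = m := by omega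
  have h2 : i + 1 + m - 1 = i + m := by omega
  unfold band bandWord
  dsimp only
  rw [h1, h2, ofWord_append, ofWord_append, ofWord_reverse_false, run_succ']
  simp [run, ofWord, sigma]

theorem band_zero (i : ℕ) : band (i, i + 1) = sigma i := by
  have := band_eq i 0
  simpa [run_succ] using this

theorem band_succ (i m : ℕ) :
    band (i, i + 1 + (m + 1)) = sigma i * band (i + 1, i + 1 + 1 + m) * (sigma i)⁻¹ := by
  rw [band_eq, band_eq, run_succ i (m + 1), run_succ i m]
  group

theorem perm_run_apply (i m k : ℕ) : (run i m).perm k =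
    if k = i then i + m else if i < k ∧ k ≤ i + m then k - 1 else k := by
  induction m generalizing i k with
  | zero =>
    simp only [run_zero, Braid.perm_one, Equiv.Perm.one_apply]
    split_ifs <;> omega
  | succ m ih =>
    rw [run_succ, Braid.perm_mul, perm_sigma, Equiv.Perm.mul_apply, ih, Equiv.swap_apply_def]
    split_ifs <;> omega

/-- In `σ_i ⋯ σ_{i+m-1}` the strand that starts in position `i` travels below all the strands it
passes, and no other strands cross. -/
theorem inChart_run {i m : ℕ} {η : ℕ → ℝ} (h : ∀ k, i < k → k ≤ i + m → η i < η k) :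
    (run i m).InChart η := by
  induction m generalizing i η with
  | zero => exact Braid.inChart_one
  | succ m ih =>
    rw [run_succ]
    refine (inChart_sigma (h _ (by omega) (by omega))).mul (ih fun k hk hk' => ?_)
    simp only [perm_sigma, Equiv.symm_swap, Function.comp_apply]
    rw [Equiv.swap_apply_right, Equiv.swap_apply_of_ne_of_ne (by omega) (by omega)]
    exact h k (by omega) (by omega)

theorem Braid.perm_inv (g : Braid base) : g⁻¹.perm = g.perm⁻¹ := by
  obtain ⟨m, rfl⟩ := Braid.exists_rep g
  rfl

theorem perm_band' (i m : ℕ) : (band (i, i + 1 + m)).perm = swap i (i + 1 + m) := by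
  induction m generalizing i with
  | zero => simp [band_zero]
  | succ m ih =>
    rw [band_succ, Braid.perm_mul, Braid.perm_mul, ih, Braid.perm_inv, perm_sigma]
    refine Equiv.ext fun k => ?_
    simp only [Equiv.swap_inv, Equiv.Perm.mul_apply, Equiv.swap_apply_def]
    split_ifs <;> omega

theorem perm_band {i j : ℕ} (h : i < j) : (band (i, j)).perm = swap i j := by
  obtain ⟨m, rfl⟩ : ∃ m, j = i + 1 + m := ⟨j - i - 1, by omega⟩
  exact perm_band' i m

/-- The strands `i` and `j` change places below all strands between them, with `i` below `j`. The
induction conjugates by one more generator, whose two letters have opposite signs and see the strand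
in between on the same side. -/
theorem inChart_band {i j : ℕ} (hij : i < j) {η : ℕ → ℝ} (h : η i < η j)
    (h' : ∀ k, i < k → k < j → η j < η k) : (band (i, j)).InChart η := by
  obtain ⟨m, rfl⟩ : ∃ m, j = i + 1 + m := ⟨j - i - 1, by omega⟩
  clear hij
  induction m generalizing i η with
  | zero =>
    have := inChart_sigma (i := i) (η := η) h
    simpa [band_zero] using this
  | succ m ih =>
    rw [band_succ, ← letter_false]
    have hi := h' (i + 1) (by omega) (by omega)
    refine ((inChart_sigma (by linarith)).mul (ih ?_ fun k hk hk' => ?_)).mul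
      (inChart_letter_false ?_)
    · simp only [perm_sigma, Equiv.symm_swap, Function.comp_apply]
      rw [Equiv.swap_apply_right, Equiv.swap_apply_of_ne_of_ne (by omega) (by omega)]
      rwa [show i + 1 + 1 + m = i + 1 + (m + 1) by omega]
    · simp only [perm_sigma, Equiv.symm_swap, Function.comp_apply]
      rw [Equiv.swap_apply_of_ne_of_ne (a := i) (by omega) (by omega),
        Equiv.swap_apply_of_ne_of_ne (a := i) (by omega) (by omega)]
      rw [show i + 1 + 1 + m = i + 1 + (m + 1) by omega]
      exact h' k (by omega) (by omega)
    · rw [Braid.perm_mul, perm_band', perm_sigma]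
      have e1 : (swap (i + 1) (i + 1 + 1 + m) * swap i (i + 1)).symm (i + 1) = i + 1 + (m + 1) := by
        rw [Equiv.symm_apply_eq, Equiv.Perm.mul_apply,
          Equiv.swap_apply_of_ne_of_ne (a := i) (by omega) (by omega),
          show i + 1 + 1 + m = i + 1 + (m + 1) by omega, Equiv.swap_apply_right]
      have e2 : (swap (i + 1) (i + 1 + 1 + m) * swap i (i + 1)).symm i = i + 1 := by
        rw [Equiv.symm_apply_eq, Equiv.Perm.mul_apply, Equiv.swap_apply_right,
          Equiv.swap_apply_of_ne_of_ne (by omega) (by omega)]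
      rw [Function.comp_apply, Function.comp_apply, e1, e2]
      exact hi

/-- On both sides strand `i` is lowest and strand `i + 1` second lowest: on the right, strand `i +
1` first passes below the others to the last position and is then exchanged with strand `i`. One
chart with these heights contains both sides. -/
theorem run_eq_run_mul_band {i m : ℕ} :
    run i (m + 1) = run (i + 1) m * band (i, i + 1 + m) := by
  let η : ℕ → ℝ := fun k => if k = i then -2 else if k = i + 1 then -1 else k
  have hη : Function.Injective η := by
    intro x y hxy
    have hx : (0 : ℝ) ≤ x := Nat.cast_nonneg x
    have hy : (0 : ℝ) ≤ y := Nat.cast_nonneg y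
    simp only [η] at hxy
    split_ifs at hxy
    all_goals first | omega | (exfalso; linarith) | exact_mod_cast hxy
  have h0 : η i = -2 := by simp [η]
  have h1 : η (i + 1) = -1 := by simp [η]
  have h2 : ∀ k, i + 1 < k → 0 ≤ η k := fun k hk => by
    simp only [η]
    rw [if_neg (by omega), if_neg (by omega)]
    positivity
  have hsymm : ∀ x y, (run (i + 1) m).perm x = y → (run (i + 1) m).perm.symm y = x :=
    fun x y h => by rw [← h, Equiv.symm_apply_apply]
  have e1 : (run (i + 1) m).perm.symm i = i := hsymm _ _ (by
    rw [perm_run_apply]; split_ifs <;> omega)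
  have e2 : (run (i + 1) m).perm.symm (i + 1 + m) = i + 1 := hsymm _ _ (by
    rw [perm_run_apply]; split_ifs <;> omega)
  refine Braid.InChart.eq hη (inChart_run fun k hk hk' => ?_)
    ((inChart_run fun k hk hk' => ?_).mul (inChart_band (by omega) ?_ fun k hk hk' => ?_)) ?_
  · rcases eq_or_lt_of_le (Nat.succ_le_of_lt hk) with h | h
    · rw [h0, ← h, Nat.succ_eq_add_one, h1]; norm_num
    · linarith [h2 k h]
  · linarith [h2 k hk]
  · rw [Function.comp_apply, Function.comp_apply, e1, e2, h0, h1]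
    norm_num
  · have e3 : (run (i + 1) m).perm.symm k = k + 1 := hsymm _ _ (by
      rw [perm_run_apply]; split_ifs <;> omega)
    rw [Function.comp_apply, Function.comp_apply, e2, e3, h1]
    linarith [h2 (k + 1) (by omega)]
  · refine Equiv.ext fun k => ?_
    rw [Braid.perm_mul, perm_band (by omega), Equiv.Perm.mul_apply, perm_run_apply, perm_run_apply,
      Equiv.swap_apply_def]
    split_ifs <;> omega

/-! ### Motions along straight lines -/

/-- The motion in which the real parts move uniformly, while the points dip to depths that are
given by `h`. -/
def niceFun (π : Perm ℕ) (h : ℕ → ℝ) (s : ℝ) (x : ℕ) : ℂ :=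
  ⟨x + ((π x : ℝ) - x) * s, -(h x * (s * (1 - s)))⟩

/-- Whenever two strands cross, the one of lower height is the deeper one. -/
def NiceFor (η : ℕ → ℝ) (π : Perm ℕ) (h : ℕ → ℝ) : Prop :=
  ∀ x y, η x < η y → (x < y ∧ π y < π x ∨ y < x ∧ π x < π y) → h y < h x

theorem niceFun_mem_chart {η h : ℕ → ℝ} {π : Perm ℕ} (H : NiceFor η π h) {s : ℝ}
    (hs : s ∈ Set.Icc (0 : ℝ) 1) : niceFun π h s ∈ chart η := by
  intro x y hxy hre
  simp only [niceFun] at hre ⊢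
  have hne : x ≠ y := fun h => by rw [h] at hxy; exact lt_irrefl _ hxy
  have hs0 : 0 < s := by
    rcases eq_or_lt_of_le hs.1 with h | h
    · subst h
      exact absurd (by simpa using hre) hne
    · exact h
  have hs1 : s < 1 := by
    rcases eq_or_lt_of_le hs.2 with h | h
    · subst h
      exact absurd (by simpa using hre) hne
    · exact h
  have hlt : h y < h x := by
    refine H x y hxy ?_
    rcases lt_or_gt_of_ne hne with h1 | h1
    · refine Or.inl ⟨h1, ?_⟩
      by_contra hn
      have h1' : (x : ℝ) < y := by exact_mod_cast h1
      have h2' : (π x : ℝ) ≤ π y := by exact_mod_cast not_lt.1 hn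
      nlinarith
    · refine Or.inr ⟨h1, ?_⟩
      by_contra hn
      have h1' : (y : ℝ) < x := by exact_mod_cast h1
      have h2' : (π y : ℝ) ≤ π x := by exact_mod_cast not_lt.1 hn
      nlinarith
  have : 0 < s * (1 - s) := mul_pos hs0 (by linarith)
  nlinarith

/-- The braid is represented by a motion along straight lines, with depths `h`. -/
def IsNice (h : ℕ → ℝ) (g : Braid base) : Prop :=
  ∃ m, Braid.mk m = g ∧ ∀ s k, (m.path s).1 k = niceFun g.perm h s k

/-- A straight motion lies in every chart that agrees with its depths at the pairs of strands that
cross. This permits a change of chart in the middle of an induction. -/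
theorem IsNice.inChart {h η : ℕ → ℝ} {g : Braid base} (hg : IsNice h g) (H : NiceFor η g.perm h) :
    g.InChart η := by
  obtain ⟨m, rfl, hm⟩ := hg
  refine ⟨m, rfl, fun s => ?_⟩
  have : (m.path s).1 = niceFun (Braid.mk m).perm h s := funext (hm s)
  rw [this]
  exact niceFun_mem_chart H s.2

/-- If the straight motion lies in the same chart, it represents the same braid, since it has the
same permutation. -/
theorem Braid.InChart.isNice {h η : ℕ → ℝ} (hη : Function.Injective η) {g : Braid base}
    (hg : g.InChart η) (H : NiceFor η g.perm h) : IsNice h g := by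
  let m : Motion base := Motion.ofFun g.perm (niceFun g.perm h)
    (fun k => by
      have : Continuous fun s : ℝ => ((k + ((g.perm k : ℝ) - k) * s : ℝ) : ℂ) +
        ((-(h k * (s * (1 - s))) : ℝ) : ℂ) * Complex.I := by fun_prop
      refine this.congr fun s => ?_
      simp only [niceFun]
      rw [Complex.mk_eq_add_mul_I])
    (fun s hs => injective_of_mem_chart hη (niceFun_mem_chart H hs))
    (fun k => by apply Complex.ext <;> simp [niceFun])
    (fun k => by apply Complex.ext <;> simp [niceFun])
  have hm : m.InChart η := fun s => niceFun_mem_chart H s.2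
  exact ⟨m, Braid.InChart.eq hη ⟨m, rfl, hm⟩ hg rfl, fun s k => rfl⟩

theorem isNice_run (i m : ℕ) : IsNice (fun k => if k = i then 1 else 0) (run i m) := by
  let η : ℕ → ℝ := fun k => if k = i then -1 else k
  have hη : Function.Injective η := by
    intro x y hxy
    have hx : (0 : ℝ) ≤ x := Nat.cast_nonneg x
    have hy : (0 : ℝ) ≤ y := Nat.cast_nonneg y
    simp only [η] at hxy
    split_ifs at hxy
    all_goals first | omega | (exfalso; linarith) | exact_mod_cast hxy
  refine Braid.InChart.isNice hη (inChart_run fun k hk _ => ?_) fun x y hxy hc => ?_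
  · have hk' : (0 : ℝ) ≤ k := Nat.cast_nonneg k
    simp only [η]
    rw [if_pos trivial, if_neg (by omega)]
    linarith
  · rw [perm_run_apply, perm_run_apply] at hc
    simp only [η] at hxy
    have hy : (0 : ℝ) ≤ x := Nat.cast_nonneg x
    have h1 : x = i := by
      by_contra hx
      rw [if_neg hx] at hxy
      split_ifs at hxy
      · linarith
      · have : x < y := by exact_mod_cast hxy
        split_ifs at hc <;> omega
    have h2 : y ≠ i := fun h => by rw [h1, h] at hxy; exact lt_irrefl _ hxy
    simp [h1, h2]

/-- The depths in the straight motion of a band generator. -/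
def bandDepth (b : Band) (k : ℕ) : ℝ := if k = b.1 then 2 else if k = b.2 then 1 else 0

theorem isNice_band {i j : ℕ} (hij : i < j) : IsNice (bandDepth (i, j)) (band (i, j)) := by
  let η : ℕ → ℝ := fun k => if k = i then -2 else if k = j then -1 else k
  have hη : Function.Injective η := by
    intro x y hxy
    have hx : (0 : ℝ) ≤ x := Nat.cast_nonneg x
    have hy : (0 : ℝ) ≤ y := Nat.cast_nonneg y
    simp only [η] at hxy
    split_ifs at hxy
    all_goals first | omega | (exfalso; linarith) | exact_mod_cast hxy
  refine Braid.InChart.isNice hη (inChart_band hij ?_ fun k hk hk' => ?_) fun x y hxy hc => ?_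
  · simp only [η]
    rw [if_pos trivial, if_neg (by omega), if_pos trivial]
    norm_num
  · have hk' : (0 : ℝ) ≤ k := Nat.cast_nonneg k
    simp only [η]
    rw [if_neg (by omega), if_pos trivial, if_neg (by omega), if_neg (by omega)]
    linarith
  · rw [perm_band hij, Equiv.swap_apply_def, Equiv.swap_apply_def] at hc
    simp only [η] at hxy
    have hx : (0 : ℝ) ≤ x := Nat.cast_nonneg x
    have hy : (0 : ℝ) ≤ y := Nat.cast_nonneg y
    simp only [bandDepth]
    split_ifs at hxy ⊢ <;> first | omega | norm_num
    all_goals first | (exfalso; linarith) | skip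
    have : x < y := by exact_mod_cast hxy
    split_ifs at hc <;> omega

/-! ### The cable of a band generator -/

/-- The first `k` band generators of the cable of a band generator between the slots
`a + 1, …, a + p` and `b + 1, …, b + p`, followed by `k` twists of the first slot. -/
def partialCable (a b p : ℕ) : ℕ → Braid base
  | 0 => 1
  | k + 1 => band (a + (k + 1), b + (k + 1)) * partialCable a b p k * run (a + 1) (p - 1)

/-- The depths in the straight motion of `partialCable`. -/
def cableDepth (a b p k x : ℕ) : ℝ :=
  if a < x ∧ x ≤ a + k then 2
  else if (a + k < x ∧ x ≤ a + p) ∨ (b < x ∧ x ≤ b + k) then 1 else 0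

/-- The first `k` strands of the first slot enter the second slot in order, and the strands they
replace fill the first slot from the right. For `k = p` the two slots are exchanged without any
internal permutation; the `k` twists are what restores the order. -/
theorem perm_partialCable {a b p : ℕ} (h : a + p ≤ b) {k : ℕ} (hk : k ≤ p) (x : ℕ) :
    (partialCable a b p k).perm x =
      if a < x ∧ x ≤ a + k then x + b - a
      else if a + k < x ∧ x ≤ a + p then x - k
      else if b < x ∧ x ≤ b + k then x + a + p - k - b else x := by
  induction k generalizing x with
  | zero =>
    simp only [partialCable, Braid.perm_one, Equiv.Perm.one_apply]
    split_ifs <;> omega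
  | succ k ih =>
    rw [partialCable, Braid.perm_mul, Braid.perm_mul, perm_band (by omega), Equiv.Perm.mul_apply,
      Equiv.Perm.mul_apply, ih (by omega), perm_run_apply, Equiv.swap_apply_def]
    split_ifs <;> omega

theorem cableDepth_lt {a b p k x y : ℕ} (h : a + p ≤ b) (hk : k ≤ p)
    (d : a < x ∧ x ≤ a + k ∧ ¬ (a < y ∧ y ≤ a + k) ∨
      ((a + k < x ∧ x ≤ a + p) ∨ (b < x ∧ x ≤ b + k)) ∧ (y ≤ a ∨ a + p < y) ∧
        ¬ (b < y ∧ y ≤ b + k)) : cableDepth a b p k y < cableDepth a b p k x := by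
  unfold cableDepth
  rcases d with ⟨d1, d2, d3⟩ | ⟨d1, d2, d3⟩
  · rw [if_pos (show a < x ∧ x ≤ a + k from ⟨d1, d2⟩), if_neg d3]
    split_ifs <;> norm_num
  · rw [if_neg (by omega), if_neg (by omega), if_neg (by omega), if_pos d1]
    norm_num

/-- Heights for `partialCable a b p (k + 1)`, from bottom to top: the strands of the first slot that
still have to move, the strand in position `b + k + 1`, the other strands of the second slot, and
the remaining strands. -/
def cableHeight (a b p k x : ℕ) : ℤ :=
  if a < x ∧ x ≤ a + (k + 1) then x - 3 * (b + p + 1)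
  else if x = b + (k + 1) then x - 2 * (b + p + 1)
  else if (a + (k + 1) < x ∧ x ≤ a + p) ∨ (b < x ∧ x ≤ b + k) then x - (b + p + 1) else x

theorem cableHeight_cases {a b p k : ℕ} (h : a + p ≤ b) (hk : k + 1 ≤ p) (x : ℕ) :
    a < x ∧ x ≤ a + (k + 1) ∧ cableHeight a b p k x = x - 3 * (b + p + 1) ∨
      x = b + (k + 1) ∧ cableHeight a b p k x = x - 2 * (b + p + 1) ∨
      ((a + (k + 1) < x ∧ x ≤ a + p) ∨ (b < x ∧ x ≤ b + k)) ∧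
        cableHeight a b p k x = x - (b + p + 1) ∨
      ((x ≤ a ∨ a + p < x) ∧ (x ≤ b ∨ b + (k + 1) < x)) ∧ cableHeight a b p k x = x := by
  unfold cableHeight
  split_ifs <;> omega

theorem cableHeight_injective {a b p k : ℕ} (h : a + p ≤ b) (hk : k + 1 ≤ p) :
    Function.Injective fun x => (cableHeight a b p k x : ℝ) := by
  intro x y hxy
  have hxy : cableHeight a b p k x = cableHeight a b p k y := by
    simpa only [Int.cast_inj] using hxy
  have h1 := cableHeight_cases h hk x
  have h2 := cableHeight_cases h hk y
  omega

theorem niceFor_partialCable {a b p k : ℕ} (h : a + p ≤ b) (hk : k + 1 ≤ p) :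
    NiceFor (fun x => (cableHeight a b p k x : ℝ)) (partialCable a b p (k + 1)).perm
      (cableDepth a b p (k + 1)) := by
  intro x y hxy hc
  have hxy : cableHeight a b p k x < cableHeight a b p k y := by
    simpa only [Int.cast_lt] using hxy
  refine cableDepth_lt h hk ?_
  have h1 := cableHeight_cases h hk x
  have h2 := cableHeight_cases h hk y
  rw [perm_partialCable h hk, perm_partialCable h hk] at hc
  generalize cableHeight a b p k x = ex at *
  generalize cableHeight a b p k y = ey at *
  by_contra d
  split_ifs at hc <;> omega

/-- The heights are those of the strands after the initial band generator has exchanged the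
positions `a + k + 1` and `b + k + 1`. -/
theorem niceFor_partialCable_swap {a b p k : ℕ} (h : a + p ≤ b) (hk : k + 1 ≤ p) :
    NiceFor ((fun x => (cableHeight a b p k x : ℝ)) ∘ swap (a + (k + 1)) (b + (k + 1)))
      (partialCable a b p k).perm (cableDepth a b p k) := by
  intro x y hxy hc
  have hxy : cableHeight a b p k (swap (a + (k + 1)) (b + (k + 1)) x) <
      cableHeight a b p k (swap (a + (k + 1)) (b + (k + 1)) y) := by
    simpa only [Function.comp_apply, Int.cast_lt] using hxy
  refine cableDepth_lt h (by omega) ?_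
  have h1 := cableHeight_cases h hk (swap (a + (k + 1)) (b + (k + 1)) x)
  have h2 := cableHeight_cases h hk (swap (a + (k + 1)) (b + (k + 1)) y)
  rw [perm_partialCable h (by omega), perm_partialCable h (by omega)] at hc
  generalize cableHeight a b p k (swap (a + (k + 1)) (b + (k + 1)) x) = ex at *
  generalize cableHeight a b p k (swap (a + (k + 1)) (b + (k + 1)) y) = ey at *
  rw [Equiv.swap_apply_def] at h1 h2
  by_contra d
  split_ifs at h1 <;> split_ifs at h2 <;> split_ifs at hc <;> omega

/-- One set of heights serves all three factors: the band generator by `inChart_band`, the shorter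
partial cable through its straight representative, and the final twist because the strand then in
position `a + 1` is the lowest of its slot. -/
theorem inChart_partialCable {a b p k : ℕ} (h : a + p ≤ b) (hk : k + 1 ≤ p)
    (ih : IsNice (cableDepth a b p k) (partialCable a b p k)) :
    (partialCable a b p (k + 1)).InChart fun x => (cableHeight a b p k x : ℝ) := by
  have hlt : ∀ x y, cableHeight a b p k x < cableHeight a b p k y →
      (cableHeight a b p k x : ℝ) < cableHeight a b p k y := fun x y h => by exact_mod_cast h
  refine ((inChart_band (by omega) (hlt _ _ ?_) fun x hx hx' => hlt _ _ ?_).mul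
    (ih.inChart ?_)).mul (inChart_run fun y hy hy' => ?_)
  · have h1 := cableHeight_cases h hk (a + (k + 1))
    have h2 := cableHeight_cases h hk (b + (k + 1))
    omega
  · have h1 := cableHeight_cases h hk x
    have h2 := cableHeight_cases h hk (b + (k + 1))
    omega
  · rw [perm_band (by omega)]
    exact niceFor_partialCable_swap h hk
  · refine hlt _ _ ?_
    have key : ∀ y x, (band (a + (k + 1), b + (k + 1)) * partialCable a b p k).perm.symm y = x →
        y = (partialCable a b p k).perm (swap (a + (k + 1)) (b + (k + 1)) x) := by
      intro y x hx
      rw [Equiv.symm_apply_eq, Braid.perm_mul, perm_band (by omega)] at hx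
      exact hx
    obtain ⟨x, hx⟩ : ∃ x, (band (a + (k + 1), b + (k + 1)) *
      partialCable a b p k).perm.symm (a + 1) = x := ⟨_, rfl⟩
    obtain ⟨x', hx'⟩ : ∃ x, (band (a + (k + 1), b + (k + 1)) *
      partialCable a b p k).perm.symm y = x := ⟨_, rfl⟩
    rw [hx, hx']
    have e1 := key _ _ hx
    have e2 := key _ _ hx'
    rw [perm_partialCable h (by omega), Equiv.swap_apply_def] at e1 e2
    have h1 := cableHeight_cases h hk x
    have h2 := cableHeight_cases h hk x'
    generalize cableHeight a b p k x = ex at *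
    generalize cableHeight a b p k x' = ex' at *
    clear ih hlt key hx hx'
    split_ifs at e1 <;> split_ifs at e2 <;> omega

theorem isNice_partialCable {a b p : ℕ} (h : a + p ≤ b) {k : ℕ} (hk : k ≤ p) :
    IsNice (cableDepth a b p k) (partialCable a b p k) := by
  induction k with
  | zero =>
    refine Braid.InChart.isNice (η := fun k : ℕ => (k : ℝ)) Nat.cast_injective Braid.inChart_one ?_
    intro x y _ hc
    simp only [partialCable, Braid.perm_one, Equiv.Perm.one_apply] at hc
    omega
  | succ k ih =>
    exact (inChart_partialCable h hk (ih (by omega))).isNice (cableHeight_injective h hk)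
      (niceFor_partialCable h hk)

theorem partialCable_eq (a b p k : ℕ) : partialCable a b p k =
    ((List.range k).map fun t => band (a + (k - t), b + (k - t))).prod *
      run (a + 1) (p - 1) ^ k := by
  induction k with
  | zero => simp [partialCable]
  | succ k ih =>
    rw [partialCable, ih, List.range_succ_eq_map, List.map_cons, List.prod_cons, List.map_map,
      pow_succ]
    simp only [mul_assoc, Nat.sub_zero]
    congr 4
    funext t
    simp only [Function.comp_apply, Nat.succ_eq_add_one, Nat.add_sub_add_right]

/-! ### The cabled staircase braid as a product of twists and cables -/

/-- The braid of a word in the band generators. -/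
def bands (W : List Band) : Braid base := (W.map band).prod

theorem ofWord_artinWord (W : List Band) : ofWord (artinWord W) = bands W := by
  induction W with
  | nil => rfl
  | cons b W ih =>
    have : artinWord (b :: W) = bandWord b ++ artinWord W := by simp [artinWord]
    rw [this, ofWord_append, ih]
    simp [bands, band]

theorem bands_append (W W' : List Band) : bands (W ++ W') = bands W * bands W' := by
  simp [bands]

theorem bands_flatMap {α : Type*} (l : List α) (f : α → List Band) :
    bands (l.flatMap f) = (l.map fun x => bands (f x)).prod := by
  induction l with
  | nil => rfl
  | cons a l ih => rw [List.flatMap_cons, bands_append, ih, List.map_cons, List.prod_cons]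

/-- A `1 / p`-twist of the strands `p c + 1, …, p c + p`. -/
def twist (p c : ℕ) : Braid base := run (p * c + 1) (p - 1)

theorem bands_dualGarside (m : ℕ) : bands (dualGarside m) = run 1 (m - 1) := by
  simp [bands, dualGarside, run, ofWord, Function.comp_def, band_zero, sigma]

theorem mem_bandWord {i j : ℕ} (h : i < j) {a : ArtinLetter} (ha : a ∈ bandWord (i, j)) :
    i ≤ a.1 ∧ a.1 + 1 ≤ j := by
  simp only [bandWord, List.mem_append, List.mem_map, List.mem_singleton, List.mem_reverse,
    List.mem_range'_1] at ha
  rcases ha with (⟨k, hk, rfl⟩ | rfl) | ⟨k, hk, rfl⟩ <;> dsimp only <;> omega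

theorem commute_band_run {i j i' m : ℕ} (h : i < j) (h' : j + 1 ≤ i') :
    Commute (band (i, j)) (run i' m) := by
  refine commute_ofWord fun a ha b hb => ?_
  obtain ⟨k, hk, rfl⟩ := List.mem_map.1 hb
  have := mem_bandWord h ha
  rw [List.mem_range'_1] at hk
  dsimp only
  omega

theorem commute_band_band {i j i' j' : ℕ} (h : i < j) (h' : j + 1 ≤ i') (h'' : i' < j') :
    Commute (band (i, j)) (band (i', j')) := by
  refine commute_ofWord fun a ha b hb => ?_
  have := mem_bandWord h ha
  have := mem_bandWord h'' hb
  omega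

/-- When a block is added, `run_eq_run_mul_band` splits the new generators into the twist of that
block and one band generator that links it to the previous block. The twist commutes with the
earlier band generators, which end before the block starts, and can be moved to the left. -/
theorem run_eq_twists {p : ℕ} (hp : 1 ≤ p) (n : ℕ) :
    run 1 (p * (n + 1) - 1) = ((List.range (n + 1)).map (twist p)).prod *
      ((List.range' 1 n).map fun k => band (p * k, p * (k + 1))).prod := by
  induction n with
  | zero => simp [twist]
  | succ n ih =>
    have h1 : p * (n + 1) = p * n + p := by ring
    have h2 : p * (n + 1 + 1) = p * n + p + p := by ring
    have e : run 1 (p * (n + 1 + 1) - 1) = run 1 (p * (n + 1) - 1) *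
        (twist p (n + 1) * band (p * (n + 1), p * (n + 1 + 1))) := by
      have e1 : p * (n + 1 + 1) - 1 = (p * (n + 1) - 1) + ((p - 1) + 1) := by omega
      have e2 : 1 + (p * (n + 1) - 1) = p * (n + 1) := by omega
      have e3 : p * (n + 1) + 1 + (p - 1) = p * (n + 1 + 1) := by omega
      rw [e1, run_add, e2, run_eq_run_mul_band, e3]
      rfl
    have hc : Commute (((List.range' 1 n).map fun k => band (p * k, p * (k + 1))).prod)
        (twist p (n + 1)) := by
      refine Commute.list_prod_left _ _ fun x hx => ?_
      obtain ⟨k, hk, rfl⟩ := List.mem_map.1 hx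
      rw [List.mem_range'_1] at hk
      have h3 : p * (k + 1) = p * k + p := by ring
      have h4 : p * (k + 1) ≤ p * (n + 1) := Nat.mul_le_mul_left p (by omega)
      exact commute_band_run (by omega) (by omega)
    rw [e, ih, List.range_succ (n := n + 1), List.map_append, List.prod_append,
      List.range'_1_concat, List.map_append, List.prod_append]
    simp only [List.map_cons, List.map_nil, List.prod_cons, List.prod_nil, mul_one]
    rw [mul_assoc, ← mul_assoc _ (twist p (n + 1)), hc.eq, mul_assoc, mul_assoc,
      Nat.add_comm 1 n]

/-- Used to interleave the linking generators `a_{pk,p(k+1)}` with the remaining factors of the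
cables of `σ_1, …, σ_{n-1}`. -/
theorem prod_mul_prod_of_commute {M : Type*} [Monoid M] (f g : ℕ → M) (m : ℕ)
    (h : ∀ k l, 1 ≤ l → l < k → k ≤ m → Commute (g l) (f k)) :
    ((List.range' 1 m).map f).prod * ((List.range' 1 m).map g).prod =
      ((List.range' 1 m).map fun k => f k * g k).prod := by
  induction m with
  | zero => simp
  | succ m ih =>
    have hc : Commute (((List.range' 1 m).map g).prod) (f (1 + m)) := by
      refine Commute.list_prod_left _ _ fun x hx => ?_
      obtain ⟨k, hk, rfl⟩ := List.mem_map.1 hx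
      rw [List.mem_range'_1] at hk
      exact h _ _ (by omega) (by omega) (by omega)
    have ih := ih fun k l h1 h2 h3 => h k l h1 h2 (by omega)
    simp only [List.range'_1_concat, List.map_append, List.prod_append, List.map_cons,
      List.map_nil, List.prod_cons, List.prod_nil, mul_one]
    rw [← ih, mul_assoc, ← mul_assoc (f (1 + m)), ← hc.eq]
    simp only [mul_assoc]

theorem bands_cabledBand_succ {p : ℕ} (hp : 1 ≤ p) (k : ℕ) :
    bands (cabledBand p (k, k + 1)) = band (p * k, p * (k + 1)) *
      bands ((List.range' 1 (p - 1)).map fun r => (k * p - r, (k + 1) * p - r)) := by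
  obtain ⟨m, rfl⟩ : ∃ m, p = m + 1 := ⟨p - 1, by omega⟩
  simp only [bands, cabledBand, List.map_map, List.range_eq_range', List.range'_succ,
    List.map_cons, List.prod_cons, Function.comp_def, Nat.sub_zero, Nat.add_sub_cancel, zero_add,
    mul_comm (m + 1)]

/-- After the twists are split off from `δ_{pn}`, each linking generator `a_{pk,p(k+1)}` moves right
past the factors for smaller `l`, which end at strand `(l+1)p - 1 < pk`, and completes the cable of
`σ_k`. -/
theorem bands_cabledStaircase {p q n : ℕ} (hp : 1 ≤ p) (hn : 1 ≤ n) (P : List Band) :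
    bands (cabledStaircase p q n P) = ((List.range n).map (twist p)).prod *
      ((dualGarside n).map fun b => bands (cabledBand p b)).prod * twist p 0 ^ (q - n) *
      (P.map fun b => bands (cabledBand p b)).prod := by
  obtain ⟨m, rfl⟩ : ∃ m, n = m + 1 := ⟨n - 1, by omega⟩
  have h1 : bands ((List.replicate (q - (m + 1)) (dualGarside p)).flatten) =
      twist p 0 ^ (q - (m + 1)) := by
    induction q - (m + 1) with
    | zero => rfl
    | succ l ih =>
      rw [List.replicate_succ, List.flatten_cons, bands_append, ih, bands_dualGarside, pow_succ']
      rfl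
  have h2 : bands (cabledDualGarside p (m + 1)) = ((List.range (m + 1)).map (twist p)).prod *
      ((dualGarside (m + 1)).map fun b => bands (cabledBand p b)).prod := by
    rw [cabledDualGarside, bands_append, bands_dualGarside, run_eq_twists hp, bands_flatMap,
      mul_assoc, Nat.add_sub_cancel, prod_mul_prod_of_commute]
    · simp only [dualGarside, List.map_map, Nat.add_sub_cancel, Function.comp_def,
        bands_cabledBand_succ hp]
    · intro k l hl hlk hk
      refine Commute.list_prod_left _ _ fun x hx => ?_
      obtain ⟨b, hb, rfl⟩ := List.mem_map.1 hx
      obtain ⟨r, hr, rfl⟩ := List.mem_map.1 hb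
      rw [List.mem_range'_1] at hr
      have h3 : (l + 1) * p ≤ p * k := by
        rw [mul_comm]; exact Nat.mul_le_mul_left p hlk
      have h4 : (l + 1) * p = l * p + p := by ring
      have h5 : p * (k + 1) = p * k + p := by ring
      have h6 : p ≤ l * p := Nat.le_mul_of_pos_left p hl
      exact commute_band_band (by omega) (by omega) (by omega)
  rw [cabledStaircase, bands_append, bands_append, h1, h2, bands_flatMap]

/-- A cabled band generator followed by a full twist of its first block is the flat parallel, so the
cabled generator itself carries a negative full twist. -/
theorem bands_cabledBand {p i j : ℕ} (hi : 1 ≤ i) (hij : i < j) :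
    bands (cabledBand p (i, j)) =
      partialCable (p * (i - 1)) (p * (j - 1)) p p * (twist p (i - 1) ^ p)⁻¹ := by
  rw [partialCable_eq, twist, mul_inv_cancel_right]
  simp only [bands, cabledBand, List.map_map]
  congr 1
  refine List.map_congr_left fun k hk => ?_
  rw [List.mem_range] at hk
  have h1 : p * i = p * (i - 1) + p := by
    obtain ⟨a, rfl⟩ : ∃ a, i = a + 1 := ⟨i - 1, by omega⟩
    rw [Nat.add_sub_cancel]; ring
  have h2 : p * j = p * (j - 1) + p := by
    obtain ⟨a, rfl⟩ : ∃ a, j = a + 1 := ⟨j - 1, by omega⟩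
    rw [Nat.add_sub_cancel]; ring
  simp only [Function.comp_apply]
  rw [show p * i - k = p * (i - 1) + (p - k) by omega,
    show p * j - k = p * (j - 1) + (p - k) by omega]

/-! ### Gluing functions over unit intervals -/

/-- Closed braids are described by a piece for each turn `⌊u⌋` with inner time `fract u`; matching
at integers suffices for continuity, since near any point only two adjacent intervals matter. -/
theorem continuous_glue {E : Type*} [TopologicalSpace E] {F : ℤ → ℝ → E}
    (hF : ∀ k, ContinuousOn (F k) (Set.Icc 0 1)) (h : ∀ k, F k 1 = F (k + 1) 0) :
    Continuous fun u : ℝ => F ⌊u⌋ (Int.fract u) := by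
  have key : ∀ k : ℤ, ContinuousOn (fun u : ℝ => F ⌊u⌋ (Int.fract u)) (Set.Icc (k : ℝ) (k + 1)) := by
    intro k
    have : ContinuousOn (fun u : ℝ => F k (u - k)) (Set.Icc (k : ℝ) (k + 1)) := by
      refine (hF k).comp (by fun_prop) fun u hu => ⟨?_, ?_⟩ <;> linarith [hu.1, hu.2]
    refine this.congr fun u hu => ?_
    rcases eq_or_lt_of_le hu.2 with rfl | hlt
    · have : ⌊(k : ℝ) + 1⌋ = k + 1 := by
        rw [show (k : ℝ) + 1 = ((k + 1 : ℤ) : ℝ) by push_cast; ring, Int.floor_intCast]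
      have h2 : Int.fract ((k : ℝ) + 1) = 0 := by
        rw [Int.fract, this]; push_cast; ring
      simp only [this, h2, add_sub_cancel_left, h]
    · have : ⌊u⌋ = k := Int.floor_eq_iff.2 ⟨hu.1, hlt⟩
      simp only [Int.fract, this]
  refine continuous_iff_continuousAt.2 fun u => ?_
  have h1 := (key (⌊u⌋ - 1)).union_of_isClosed (key ⌊u⌋) isClosed_Icc isClosed_Icc
  push_cast at h1
  rw [sub_add_cancel, Set.Icc_union_Icc_eq_Icc (by linarith) (by linarith)] at h1
  exact h1.continuousAt (Icc_mem_nhds (by linarith [Int.floor_le u]) (Int.lt_floor_add_one u))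

/-! ### The cyclic shift of a row of points -/

section ShiftLine

variable (p : ℕ) [NeZero p]

/-- In the cyclic shift of the points `0, …, p - 1`, the point `j` moves to `j - 1` on the real line,
and `0` moves to `p - 1` below the others. -/
def shiftPiece (j : ZMod p) (s : ℝ) : ℂ :=
  if j = 0 then ⟨((p : ℝ) - 1) * s, -(s * (1 - s))⟩ else ⟨(j.val : ℝ) - s, 0⟩

/-- The periodic motion of a point under repeated cyclic shifts. -/
def shiftLine (y : ℝ) : ℂ := shiftPiece p (-(⌊y⌋ : ZMod p)) (Int.fract y)

theorem continuous_shiftPiece (j : ZMod p) : Continuous (shiftPiece p j) := by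
  unfold shiftPiece
  split_ifs
  · have : Continuous fun s : ℝ => ((((p : ℝ) - 1) * s : ℝ) : ℂ) +
        ((-(s * (1 - s)) : ℝ) : ℂ) * Complex.I := by fun_prop
    exact this.congr fun s => (Complex.mk_eq_add_mul_I _ _).symm
  · have : Continuous fun s : ℝ => (((j.val : ℝ) - s : ℝ) : ℂ) := by fun_prop
    exact this.congr fun s => by apply Complex.ext <;> simp

theorem val_sub_one {j : ZMod p} (hj : j ≠ 0) : ((j - 1).val : ℝ) = j.val - 1 := by
  have h1 : 0 < j.val := Nat.pos_of_ne_zero fun h => hj ((ZMod.val_eq_zero j).1 h)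
  have h2 : j - 1 = ((j.val - 1 : ℕ) : ZMod p) := by
    rw [Nat.cast_sub h1, ZMod.natCast_zmod_val]; simp
  rw [h2, ZMod.val_cast_of_lt (by have := ZMod.val_lt j; omega), Nat.cast_sub h1]
  simp

theorem val_neg_one_real : ((-1 : ZMod p).val : ℝ) = p - 1 := by
  obtain ⟨m, rfl⟩ : ∃ m, p = m + 1 := ⟨p - 1, by have := NeZero.ne p; omega⟩
  rw [ZMod.val_neg_one]
  push_cast
  ring

theorem shiftPiece_zero (j : ZMod p) : shiftPiece p j 0 = j.val := by
  unfold shiftPiece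
  split_ifs with h
  · subst h
    apply Complex.ext <;> simp
  · apply Complex.ext <;> simp [-ZMod.natCast_val]

theorem shiftPiece_one (j : ZMod p) : shiftPiece p j 1 = (j - 1).val := by
  unfold shiftPiece
  split_ifs with h
  · subst h
    rw [zero_sub, ← Complex.ofReal_natCast, val_neg_one_real]
    apply Complex.ext <;> simp
  · rw [← Complex.ofReal_natCast, val_sub_one p h]
    apply Complex.ext <;> simp

theorem continuous_shiftLine : Continuous (shiftLine p) := by
  refine continuous_glue (F := fun k s => shiftPiece p (-(k : ZMod p)) s)
    (fun k => (continuous_shiftPiece p _).continuousOn) fun k => ?_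
  rw [shiftPiece_one, shiftPiece_zero]
  congr 2
  push_cast
  ring

theorem shiftLine_add_intCast (y : ℝ) (k : ℤ) :
    shiftLine p (y + k) = shiftPiece p (-(⌊y⌋ : ZMod p) - k) (Int.fract y) := by
  rw [shiftLine, Int.floor_add_intCast, Int.fract_add_intCast]
  congr 1
  push_cast
  ring

theorem shiftLine_congr (y : ℝ) {k k' : ℤ} (h : (k : ZMod p) = k') :
    shiftLine p (y + k) = shiftLine p (y + k') := by
  rw [shiftLine_add_intCast, shiftLine_add_intCast, h]

theorem shiftPiece_injective {s : ℝ} (h0 : 0 ≤ s) (h1 : s < 1) {j j' : ZMod p}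
    (h : shiftPiece p j s = shiftPiece p j' s) : j = j' := by
  rcases eq_or_lt_of_le h0 with rfl | h0
  · rw [shiftPiece_zero, shiftPiece_zero] at h
    exact ZMod.val_injective p (by exact_mod_cast h)
  unfold shiftPiece at h
  split_ifs at h with h2 h3 h3
  · rw [h2, h3]
  · have := congrArg Complex.im h
    simp only at this
    nlinarith
  · have := congrArg Complex.im h
    simp only at this
    nlinarith
  · have := congrArg Complex.re h
    simp only [sub_left_inj, Nat.cast_inj] at this
    exact ZMod.val_injective p this

theorem shiftLine_add_injective (y : ℝ) {k k' : ℤ}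
    (h : shiftLine p (y + k) = shiftLine p (y + k')) : (k : ZMod p) = k' := by
  rw [shiftLine_add_intCast, shiftLine_add_intCast] at h
  have := shiftPiece_injective p (Int.fract_nonneg y) (Int.fract_lt_one y) h
  exact sub_right_injective this

theorem shiftPiece_re_mem {s : ℝ} (h0 : 0 ≤ s) (h1 : s ≤ 1) (j : ZMod p) :
    0 ≤ (shiftPiece p j s).re ∧ (shiftPiece p j s).re ≤ p - 1 := by
  have hp : (1 : ℝ) ≤ p := by exact_mod_cast NeZero.one_le
  unfold shiftPiece
  split_ifs with h
  · constructor <;> dsimp only <;> nlinarith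
  · have h2 : 1 ≤ j.val := Nat.pos_of_ne_zero fun h' => h ((ZMod.val_eq_zero j).1 h')
    have h3 : j.val + 1 ≤ p := ZMod.val_lt j
    have h2 : (1 : ℝ) ≤ j.val := by exact_mod_cast h2
    have h3 : (j.val : ℝ) + 1 ≤ p := by exact_mod_cast h3
    constructor <;> dsimp only <;> linarith

theorem shiftPiece_im_mem {s : ℝ} (h0 : 0 ≤ s) (h1 : s ≤ 1) (j : ZMod p) :
    -(1 / 4) ≤ (shiftPiece p j s).im ∧ (shiftPiece p j s).im ≤ 0 := by
  unfold shiftPiece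
  split_ifs with h
  · constructor <;> dsimp only <;> nlinarith [sq_nonneg (s - 1 / 2)]
  · constructor <;> dsimp only <;> norm_num

/-- The row has width `p - 1` and depth at most `1 / 4`. The strict bound by `p` keeps rows around
different points disjoint after scaling the centres by `p`. -/
theorem norm_shiftLine_sub_lt (y y' : ℝ) : ‖shiftLine p y - shiftLine p y'‖ < p := by
  have hp : (1 : ℝ) ≤ p := by exact_mod_cast NeZero.one_le
  have a := shiftPiece_re_mem p (Int.fract_nonneg y) (Int.fract_lt_one y).le (-(⌊y⌋ : ZMod p))
  have b := shiftPiece_re_mem p (Int.fract_nonneg y') (Int.fract_lt_one y').le (-(⌊y'⌋ : ZMod p))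
  have c := shiftPiece_im_mem p (Int.fract_nonneg y) (Int.fract_lt_one y).le (-(⌊y⌋ : ZMod p))
  have d := shiftPiece_im_mem p (Int.fract_nonneg y') (Int.fract_lt_one y').le (-(⌊y'⌋ : ZMod p))
  change ‖shiftPiece p (-(⌊y⌋ : ZMod p)) (Int.fract y) -
    shiftPiece p (-(⌊y'⌋ : ZMod p)) (Int.fract y')‖ < p
  refine (Complex.norm_le_abs_re_add_abs_im _).trans_lt ?_
  have h1 : |(shiftPiece p (-(⌊y⌋ : ZMod p)) (Int.fract y) -
    shiftPiece p (-(⌊y'⌋ : ZMod p)) (Int.fract y')).re| ≤ p - 1 := by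
    rw [Complex.sub_re, abs_le]; constructor <;> linarith
  have h2 : |(shiftPiece p (-(⌊y⌋ : ZMod p)) (Int.fract y) -
    shiftPiece p (-(⌊y'⌋ : ZMod p)) (Int.fract y')).im| ≤ 1 / 4 := by
    rw [Complex.sub_im, abs_le]; constructor <;> linarith
  linarith

theorem shiftLine_neg_val (r : ZMod p) : shiftLine p (0 - r.val) = r.val := by
  have h := shiftLine_add_intCast p 0 (-(r.val : ℤ))
  push_cast at h
  rw [← sub_eq_add_neg] at h
  rw [h]
  simp [shiftPiece_zero]

end ShiftLine

/-! ### Cables of configurations -/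

section Cable

variable {n : ℕ}

/-- A positive number, at most one, which is at most the distance between any two of the points. -/
def gap (z : Fin n → ℂ) : ℝ :=
  (Finset.univ : Finset (Option (Fin n × Fin n))).inf' ⟨none, Finset.mem_univ _⟩ fun x =>
    x.elim 1 fun ab => if ab.1 = ab.2 then 1 else ‖z ab.1 - z ab.2‖

theorem gap_le_one (z : Fin n → ℂ) : gap z ≤ 1 := Finset.inf'_le _ (Finset.mem_univ none)

theorem gap_le (z : Fin n → ℂ) {a b : Fin n} (h : a ≠ b) : gap z ≤ ‖z a - z b‖ := by
  refine (Finset.inf'_le _ (Finset.mem_univ (some (a, b)))).trans ?_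
  simp [h]

theorem gap_pos {z : Fin n → ℂ} (hz : Function.Injective z) : 0 < gap z := by
  refine (Finset.lt_inf'_iff _).2 fun x _ => ?_
  rcases x with _ | ⟨a, b⟩
  · exact one_pos
  · dsimp only [Option.elim]
    split_ifs with h
    · exact one_pos
    · exact norm_pos_iff.2 (sub_ne_zero.2 fun h' => h (hz h'))

theorem one_le_gap {z : Fin n → ℂ} (hz : ∀ a b, a ≠ b → 1 ≤ ‖z a - z b‖) : 1 ≤ gap z := by
  refine (Finset.le_inf'_iff _ _).2 fun x _ => ?_
  rcases x with _ | ⟨a, b⟩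
  · exact le_rfl
  · dsimp only [Option.elim]
    split_ifs with h
    · exact le_rfl
    · exact hz a b h

theorem continuous_gap : Continuous (gap (n := n)) := by
  refine Continuous.finset_inf'_apply _ fun x _ => ?_
  rcases x with _ | ⟨a, b⟩
  · exact continuous_const
  · dsimp only [Option.elim]
    split_ifs
    · exact continuous_const
    · fun_prop

theorem gap_comp (z : Fin n → ℂ) (σ : Perm (Fin n)) : gap (z ∘ σ) = gap z := by
  have key : ∀ (w : Fin n → ℂ) (τ : Perm (Fin n)), gap w ≤ gap (w ∘ τ) := by
    intro w τ
    refine (Finset.le_inf'_iff _ _).2 fun x _ => ?_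
    rcases x with _ | ⟨a, b⟩
    · exact gap_le_one w
    · dsimp only [Option.elim]
      split_ifs with h
      · exact gap_le_one w
      · exact gap_le w fun h' => h (τ.injective h')
  refine le_antisymm ?_ (key z σ)
  have h := key (z ∘ σ) σ⁻¹
  have e : (z ∘ σ) ∘ (σ⁻¹ : Perm (Fin n)) = z := by ext; simp
  rwa [e] at h

variable (p : ℕ) [NeZero p]

/-- Every point of a configuration is replaced by a row of `p` points, which are shifted cyclically
according to `ψ`. -/
def cable (z : Fin n → ℂ) (ψ : Fin n → ℝ) (x : Fin n × ZMod p) : ℂ :=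
  p * z x.1 + (1 - p) + gap z * shiftLine p (ψ x.1 - x.2.val)

/-- Centres are at least `p * gap` apart, while offsets in the rows differ by less than `p * gap`.
-/
theorem cable_ne_of_ne {z : Fin n → ℂ} (hz : Function.Injective z) (ψ : Fin n → ℝ)
    {x y : Fin n × ZMod p} (h : x.1 ≠ y.1) : cable p z ψ x ≠ cable p z ψ y := by
  intro he
  have hp : (0 : ℝ) < p := by exact_mod_cast Nat.pos_of_ne_zero (NeZero.ne p)
  have h1 : (p : ℂ) * (z x.1 - z y.1) =
      -(gap z * (shiftLine p (ψ x.1 - x.2.val) - shiftLine p (ψ y.1 - y.2.val))) := by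
    unfold cable at he
    linear_combination he
  have h2 := congrArg norm h1
  rw [norm_neg, norm_mul, norm_mul, Complex.norm_natCast, Complex.norm_real, Real.norm_eq_abs,
    abs_of_pos (gap_pos hz)] at h2
  have h3 := gap_le z h
  have h4 := norm_shiftLine_sub_lt p (ψ x.1 - x.2.val) (ψ y.1 - y.2.val)
  nlinarith [gap_pos hz, mul_lt_mul_of_pos_left h4 (gap_pos hz), mul_le_mul_of_nonneg_left h3 hp.le]

theorem cable_injective {z : Fin n → ℂ} (hz : Function.Injective z) (ψ : Fin n → ℝ) :
    Function.Injective (cable p z ψ) := by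
  rintro ⟨a, r⟩ ⟨b, r'⟩ h
  by_cases hab : a = b
  · subst hab
    have hg : ((gap z : ℝ) : ℂ) ≠ 0 := by exact_mod_cast (gap_pos hz).ne'
    have h1 := mul_left_cancel₀ hg (add_left_cancel h)
    have h2 := shiftLine_add_injective p (ψ a) (k := -(r.val : ℤ)) (k' := -(r'.val : ℤ)) (by
      push_cast
      simpa only [← sub_eq_add_neg] using h1)
    push_cast at h2
    rw [neg_inj, ZMod.natCast_zmod_val, ZMod.natCast_zmod_val] at h2
    rw [h2]
  · exact absurd h (cable_ne_of_ne p hz ψ hab)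

/-- On integer translates `shiftLine` depends only on the integer modulo `p`, so whole shifts of a
row amount to a relabelling. This lets cabled motions be concatenated. -/
theorem cable_comp (z : Fin n → ℂ) (ψ : Fin n → ℝ) (σ : Perm (Fin n)) (e : Fin n → ℤ) (a : Fin n)
    (r : ZMod p) : cable p (z ∘ σ) (fun a => ψ (σ a) + e a) (a, r) =
      cable p z ψ (σ a, r - e a) := by
  unfold cable
  rw [gap_comp]
  have : shiftLine p (ψ (σ a) + e a - r.val) = shiftLine p (ψ (σ a) - ((r - e a).val : ℝ)) := by
    have := shiftLine_congr p (ψ (σ a)) (k := e a - (r.val : ℤ)) (k' := -((r - e a).val : ℤ)) (by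
      push_cast
      rw [ZMod.natCast_zmod_val, ZMod.natCast_zmod_val]
      ring)
    push_cast at this
    rw [← add_sub_assoc, ← sub_eq_add_neg] at this
    exact this
  simp only [Function.comp_apply, this]

theorem continuous_cable (x : Fin n × ZMod p) :
    Continuous fun y : (Fin n → ℂ) × (Fin n → ℝ) => cable p y.1 y.2 x := by
  have h1 : Continuous fun y : (Fin n → ℂ) × (Fin n → ℝ) =>
      shiftLine p (y.2 x.1 - x.2.val) := (continuous_shiftLine p).comp (by fun_prop)
  have h2 : Continuous fun y : (Fin n → ℂ) × (Fin n → ℝ) => ((gap y.1 : ℝ) : ℂ) :=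
    Complex.continuous_ofReal.comp (continuous_gap.comp continuous_fst)
  unfold cable
  fun_prop

/-- The positions of the strands of the cable. -/
def slot (n : ℕ) : Fin n × ZMod p ↪ ℕ where
  toFun x := p * x.1 + x.2.val + 1
  inj' := by
    rintro ⟨a, r⟩ ⟨b, r'⟩ h
    have h1 := ZMod.val_lt r
    have h2 := ZMod.val_lt r'
    have h : p * (a : ℕ) + r.val + 1 = p * (b : ℕ) + r'.val + 1 := h
    have h : r.val + p * a = r'.val + p * b := by omega
    have hr : r.val = r'.val := by
      have := congrArg (· % p) h
      simpa [Nat.add_mul_mod_self_left, Nat.mod_eq_of_lt h1, Nat.mod_eq_of_lt h2] using this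
    rw [hr] at h
    have ha := Nat.eq_of_mul_eq_mul_left (Nat.pos_of_ne_zero (NeZero.ne p)) (Nat.add_left_cancel h)
    rw [Fin.ext ha, ZMod.val_injective p hr]

theorem slot_apply (a : Fin n) (r : ZMod p) : slot p n (a, r) = p * a + r.val + 1 := rfl

/-- The initial configuration of the strands of the cable. -/
def slotBase (n : ℕ) : Conf (Fin n × ZMod p) := Conf.comp (slot p n) base

theorem slotBase_apply (a : Fin n) (r : ZMod p) :
    (slotBase p n).1 (a, r) = p * a + r.val + 1 := by
  simp [slotBase, slot_apply]

theorem gap_succ : gap (fun a : Fin n => ((a : ℕ) : ℂ) + 1) = 1 := by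
  refine le_antisymm (gap_le_one _) (one_le_gap fun a b h => ?_)
  have : (((a : ℕ) : ℂ) + 1 - (((b : ℕ) : ℂ) + 1)) = (((a : ℤ) - (b : ℤ) : ℤ) : ℂ) := by
    push_cast; ring
  rw [this, Complex.norm_intCast]
  have : ((a : ℤ) - (b : ℤ)) ≠ 0 := fun h' => h (Fin.ext (by omega))
  exact_mod_cast Int.one_le_abs this

theorem cable_succ_apply (ψ : Fin n → ℝ) (a : Fin n) (r : ZMod p) :
    cable p (fun a : Fin n => ((a : ℕ) : ℂ) + 1) ψ (a, r) =
      p * a + 1 + shiftLine p (ψ a - r.val) := by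
  unfold cable
  rw [gap_succ]
  push_cast
  ring

theorem cable_succ (x : Fin n × ZMod p) :
    cable p (fun a : Fin n => ((a : ℕ) : ℂ) + 1) 0 x = (slotBase p n).1 x := by
  obtain ⟨a, r⟩ := x
  rw [cable_succ_apply, slotBase_apply]
  simp only [Pi.zero_apply, shiftLine_neg_val]
  ring

end Cable

/-! ### Braids which are cables of braids -/

/-- A motion of some of the points. -/
def Motion.restrict {Λ Λ' : Type} {x₀ : Conf Λ} (m : Motion x₀) (f : Λ' ↪ Λ) (π : Perm Λ')
    (h : ∀ k, m.perm (f k) = f (π k)) : Motion (Conf.comp f x₀) where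
  perm := π
  path := (m.path.map (Conf.comp f).continuous).cast rfl
    (Subtype.ext (funext fun k => by simp [h]))

variable (p : ℕ) [NeZero p] {n : ℕ}

/-- The permutation of a cable. -/
def cablePerm (σ : Perm (Fin n)) (e : Fin n → ℤ) : Perm (Fin n × ZMod p) where
  toFun x := (σ x.1, x.2 - e x.1)
  invFun x := (σ.symm x.1, x.2 + e (σ.symm x.1))
  left_inv x := by simp
  right_inv x := by simp

/-- The positions `1, …, n` of the strands of the first braid in the cable. -/
def succEmb (n : ℕ) : Fin n ↪ ℕ := ⟨fun a => (a : ℕ) + 1, fun a b h => Fin.ext (by simpa using h)⟩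

/-- The points in the positions `1, …, n`. -/
def strands (n : ℕ) (z : Conf ℕ) (a : Fin n) : ℂ := z.1 (a + 1)

theorem strands_injective (z : Conf ℕ) : Function.Injective (strands n z) :=
  z.2.comp (succEmb n).injective

theorem continuous_strands : Continuous (strands n) :=
  continuous_pi fun a => (continuous_apply ((a : ℕ) + 1)).comp continuous_subtype_val

theorem strands_base : strands n base = fun a : Fin n => ((a : ℕ) : ℂ) + 1 := by
  ext a
  simp [strands]

theorem strands_act {z : Conf ℕ} {π : Perm ℕ} {σ : Perm (Fin n)}
    (h : ∀ a : Fin n, π (a + 1) = (σ a : ℕ) + 1) : strands n (act π z) = strands n z ∘ σ := by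
  ext a
  simp [strands, h]

/-- The cable of a motion, in which the points that replace the one in position `a + 1` are
shifted according to `ψ a`. -/
def Motion.cable (m : Motion base) (σ : Perm (Fin n))
    (h : ∀ a : Fin n, m.perm (a + 1) = (σ a : ℕ) + 1) (e : Fin n → ℤ)
    (ψ : Path (0 : Fin n → ℝ) fun a => (e a : ℝ)) : Motion (slotBase p n) where
  perm := cablePerm p σ e
  path :=
    { toFun := fun s => ⟨StaircaseCable.cable p (strands n (m.path s)) (ψ s),
        cable_injective p (strands_injective _) _⟩
      continuous_toFun := Continuous.subtype_mk (continuous_pi fun x =>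
        (continuous_cable p x).comp
          ((continuous_strands.comp m.path.continuous).prodMk ψ.continuous)) _
      source' := Subtype.ext (funext fun x => by
        simp only [Path.source, strands_base, cable_succ])
      target' := Subtype.ext (funext fun ⟨a, r⟩ => by
        simp only [Path.target, strands_act h]
        have := cable_comp p (strands n base) 0 σ e a r
        simp only [Pi.zero_apply, zero_add] at this
        rw [this, strands_base, cable_succ]
        rfl) }

/-- The braid `g` is, on the strands `1, …, p n`, the cable of the braid `g'` on `n` strands, where
the strand which starts in position `a + 1` of `g'` is replaced by `p` strands with `e a` cyclic
shifts. -/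
def CableRel (g g' : Braid base) (e : Fin n → ℤ) : Prop :=
  ∃ (m m' : Motion base) (μ ν : Motion (slotBase p n)) (σ : Perm (Fin n))
    (ψ : Path (0 : Fin n → ℝ) fun a => (e a : ℝ)),
    Braid.mk m = g ∧ Braid.mk m' = g' ∧ Braid.mk μ = Braid.mk ν ∧
    (∀ a : Fin n, m'.perm (a + 1) = (σ a : ℕ) + 1) ∧
    (∀ x, μ.perm x = (σ x.1, x.2 - e x.1)) ∧
    (∀ s x, (μ.path s).1 x = (m.path s).1 (slot p n x)) ∧
    ∀ s x, (ν.path s).1 x = cable p (strands n (m'.path s)) (ψ s) x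

variable {p}

theorem CableRel.perm_slot {m : Motion base} {μ : Motion (slotBase p n)}
    (h : ∀ s x, (μ.path s).1 x = (m.path s).1 (slot p n x)) (x : Fin n × ZMod p) :
    m.perm (slot p n x) = slot p n (μ.perm x) := by
  have h1 := h 1 x
  rw [μ.path.target, m.path.target] at h1
  have h1 : ((slot p n (μ.perm x) : ℕ) : ℂ) = (m.perm (slot p n x) : ℕ) := h1
  exact_mod_cast h1.symm

/-- Cabling respects concatenation; the shifts of the second factor are read at the strands' new
positions. Since this depends on a permutation, only the total number of shifts is tracked later. -/
theorem CableRel.mul {g₁ g₂ g₁' g₂' : Braid base} {e₁ e₂ : Fin n → ℤ}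
    (h₁ : CableRel p g₁ g₁' e₁) (h₂ : CableRel p g₂ g₂' e₂) :
    ∃ σ : Perm (Fin n), CableRel p (g₁ * g₂) (g₁' * g₂') fun a => e₂ (σ a) + e₁ a := by
  obtain ⟨m₁, m₁', μ₁, ν₁, σ₁, ψ₁, rfl, rfl, k₁, hσ₁, hp₁, hμ₁, hν₁⟩ := h₁
  obtain ⟨m₂, m₂', μ₂, ν₂, σ₂, ψ₂, rfl, rfl, k₂, hσ₂, hp₂, hμ₂, hν₂⟩ := h₂
  have hpν : ν₁.perm = μ₁.perm := congrArg Braid.perm k₁.symm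
  have hf : Continuous fun v : Fin n → ℝ => fun a => v (σ₁ a) + (e₁ a : ℝ) := by fun_prop
  let ψ : Path (0 : Fin n → ℝ) fun a => ((e₂ (σ₁ a) + e₁ a : ℤ) : ℝ) :=
    ψ₁.trans ((ψ₂.map hf).cast (by ext a; simp) (by ext a; simp))
  refine ⟨σ₁, m₁ * m₂, m₁' * m₂', μ₁ * μ₂, ν₁ * ν₂, σ₂ * σ₁, ψ, rfl, rfl, ?_, ?_, ?_, ?_, ?_⟩
  · rw [Braid.mk_mul, Braid.mk_mul, k₁, k₂]
  · intro a
    rw [Motion.perm_mul, Equiv.Perm.mul_apply, hσ₁, hσ₂]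
    rfl
  · intro x
    rw [Motion.perm_mul, Equiv.Perm.mul_apply, hp₁, hp₂]
    ext <;> simp
    ring
  · intro s x
    rw [Motion.path_mul_apply, Motion.path_mul_apply]
    split_ifs with hs
    · exact hμ₁ _ _
    · rw [act_apply, act_apply, hμ₂, CableRel.perm_slot hμ₁]
  · intro s x
    rw [Motion.path_mul_apply, Motion.path_mul_apply]
    simp only [ψ, Path.trans_apply]
    split_ifs with hs
    · exact hν₁ _ _
    · rw [act_apply, hν₂, strands_act hσ₁, hpν, hp₁]
      exact (cable_comp p _ _ σ₁ e₁ x.1 x.2).symm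

theorem CableRel.inv {g g' : Braid base} {e : Fin n → ℤ} (h : CableRel p g g' e) :
    ∃ σ : Perm (Fin n), CableRel p g⁻¹ g'⁻¹ fun a => -e (σ a) := by
  obtain ⟨m, m', μ, ν, σ, ψ, rfl, rfl, k, hσ, hp, hμ, hν⟩ := h
  have hpν : ν.perm = μ.perm := congrArg Braid.perm k.symm
  have hf : Continuous fun v : Fin n → ℝ => fun a => v (σ⁻¹ a) - (e (σ⁻¹ a) : ℝ) := by fun_prop
  let ψ' : Path (0 : Fin n → ℝ) fun a => ((-e (σ⁻¹ a) : ℤ) : ℝ) :=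
    (ψ.symm.map hf).cast (by ext a; simp) (by ext a; simp)
  have hσ' : ∀ a : Fin n, m'.perm⁻¹ (a + 1) = ((σ⁻¹ : Perm (Fin n)) a : ℕ) + 1 := by
    intro a
    rw [Equiv.Perm.inv_eq_iff_eq, hσ]
    simp
  have hp' : ∀ x, μ.perm⁻¹ x = (σ⁻¹ x.1, x.2 - ((-e (σ⁻¹ x.1) : ℤ) : ZMod p)) := by
    intro x
    rw [Equiv.Perm.inv_eq_iff_eq, hp]
    simp
  refine ⟨σ⁻¹, m⁻¹, m'⁻¹, μ⁻¹, ν⁻¹, σ⁻¹, ψ', rfl, rfl, ?_, hσ', hp', ?_, ?_⟩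
  · rw [Braid.mk_inv, Braid.mk_inv, k]
  · intro s x
    rw [Motion.path_inv_apply, Motion.path_inv_apply, act_apply, act_apply, Path.symm_apply,
      Path.symm_apply, Function.comp_apply, Function.comp_apply, hμ]
    have : m.perm⁻¹ (slot p n x) = slot p n (μ.perm⁻¹ x) := by
      rw [Equiv.Perm.inv_eq_iff_eq, CableRel.perm_slot hμ]
      simp
    rw [this]
  · intro s x
    rw [Motion.path_inv_apply, Motion.path_inv_apply, act_apply, Path.symm_apply,
      Path.symm_apply, Function.comp_apply, Function.comp_apply, hν, strands_act hσ', hpν, hp']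
    rw [← cable_comp p _ _ σ⁻¹ (fun a => -e (σ⁻¹ a)) x.1 x.2]
    congr 1
    ext a
    simp [ψ', sub_eq_add_neg]

theorem CableRel.one : CableRel p 1 1 (0 : Fin n → ℤ) := by
  refine ⟨1, 1, 1, (1 : Motion base).cable p 1 (fun a => rfl) 0 ((Path.refl 0).cast rfl (by ext; simp)),
    1, (Path.refl 0).cast rfl (by ext; simp), rfl, rfl, ?_, fun a => rfl, fun x => by
      simp [Motion.perm_one], fun s x => rfl, fun s x => rfl⟩
  refine Braid.mk_eq.2 (Motion.Equivalent.of_eq ?_ fun s => ?_)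
  · ext x <;> simp [Motion.perm_one, Motion.cable, cablePerm]
  · refine Subtype.ext (funext fun x => ?_)
    change (slotBase p n).1 x = cable p (strands n base) 0 x
    rw [strands_base, cable_succ]

/-- The braid `g` is the cable of `g'`, with a total of `k` cyclic shifts. -/
def CableSum (p n : ℕ) [NeZero p] (g g' : Braid base) (k : ℤ) : Prop :=
  ∃ e : Fin n → ℤ, CableRel p g g' e ∧ ∑ a, e a = k

theorem CableSum.mul {g₁ g₂ g₁' g₂' : Braid base} {k₁ k₂ : ℤ}
    (h₁ : CableSum p n g₁ g₁' k₁) (h₂ : CableSum p n g₂ g₂' k₂) :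
    CableSum p n (g₁ * g₂) (g₁' * g₂') (k₁ + k₂) := by
  obtain ⟨e₁, h₁, rfl⟩ := h₁
  obtain ⟨e₂, h₂, rfl⟩ := h₂
  obtain ⟨σ, h⟩ := h₁.mul h₂
  exact ⟨_, h, by rw [Finset.sum_add_distrib, Equiv.sum_comp σ e₂, add_comm]⟩

theorem CableSum.inv {g g' : Braid base} {k : ℤ} (h : CableSum p n g g' k) :
    CableSum p n g⁻¹ g'⁻¹ (-k) := by
  obtain ⟨e, h, rfl⟩ := h
  obtain ⟨σ, h⟩ := h.inv
  exact ⟨_, h, by rw [Finset.sum_neg_distrib, Equiv.sum_comp σ e]⟩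

theorem CableSum.one : CableSum p n 1 1 0 := ⟨0, CableRel.one, by simp⟩

theorem CableSum.pow {g g' : Braid base} {k : ℤ} (h : CableSum p n g g' k) (l : ℕ) :
    CableSum p n (g ^ l) (g' ^ l) (l * k) := by
  induction l with
  | zero => simpa using CableSum.one
  | succ l ih =>
    rw [pow_succ, pow_succ]
    have := ih.mul h
    rwa [show (l : ℤ) * k + k = (l + 1 : ℕ) * k by push_cast; ring] at this

theorem CableSum.list_prod {α : Type*} (f f' : α → Braid base) (k : ℤ) (l : List α)
    (h : ∀ a ∈ l, CableSum p n (f a) (f' a) k) :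
    CableSum p n (l.map f).prod (l.map f').prod (l.length * k) := by
  induction l with
  | nil => simpa using CableSum.one
  | cons a l ih =>
    have := (h a (by simp)).mul (ih fun b hb => h b (by simp [hb]))
    simp only [List.map_cons, List.prod_cons, List.length_cons]
    rwa [show k + (l.length : ℤ) * k = (l.length + 1 : ℕ) * k by push_cast; ring] at this

/-! ### Twists and cables of band generators -/

variable {p : ℕ} [NeZero p] {n : ℕ}

theorem shiftLine_sub_val {s : ℝ} (h0 : 0 ≤ s) (h1 : s ≤ 1) (r : ZMod p) :
    shiftLine p (s - r.val) = shiftPiece p r s := by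
  rcases eq_or_lt_of_le h1 with rfl | h1
  · have h := shiftLine_add_intCast p 0 (1 - (r.val : ℤ))
    push_cast at h
    rw [zero_add] at h
    rw [h, shiftPiece_one]
    simp [shiftPiece_zero, -ZMod.natCast_val, ZMod.natCast_zmod_val]
  · have h := shiftLine_add_intCast p s (-(r.val : ℤ))
    push_cast at h
    rw [← sub_eq_add_neg] at h
    rw [h, Int.floor_eq_zero_iff.2 ⟨h0, h1⟩, Int.fract_eq_self.2 ⟨h0, h1⟩]
    simp

theorem slot_lt {a b : Fin n} (h : a < b) (r r' : ZMod p) :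
    slot p n (a, r) ≤ p * a + p ∧ p * (a : ℕ) + p ≤ p * b ∧ p * b < slot p n (b, r') := by
  have h1 := ZMod.val_lt r
  have h2 : p * ((a : ℕ) + 1) ≤ p * b := Nat.mul_le_mul_left p h
  rw [slot_apply, slot_apply]
  rw [mul_add, mul_one] at h2
  omega

theorem slot_mem (a : Fin n) (r : ZMod p) :
    p * a < slot p n (a, r) ∧ slot p n (a, r) ≤ p * a + p := by
  have h1 := ZMod.val_lt r
  rw [slot_apply]
  omega

theorem val_sub_one_nat {j : ZMod p} (hj : j ≠ 0) : (j - 1).val = j.val - 1 := by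
  have h1 : 0 < j.val := Nat.pos_of_ne_zero fun h => hj ((ZMod.val_eq_zero j).1 h)
  have h := val_sub_one p hj
  have : ((j - 1).val : ℝ) = ((j.val - 1 : ℕ) : ℝ) := by rw [h, Nat.cast_sub h1]; simp
  exact_mod_cast this

theorem perm_twist (a b : Fin n) (r : ZMod p) :
    (twist p a).perm (slot p n (b, r)) = slot p n (b, r - if b = a then 1 else 0) := by
  have hr := ZMod.val_lt r
  rw [twist, perm_run_apply]
  rcases lt_trichotomy b a with h | rfl | h
  · have h1 := slot_lt h r r
    rw [if_neg h.ne, sub_zero, if_neg (by omega), if_neg (by omega)]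
  · rw [if_pos rfl, slot_apply, slot_apply]
    by_cases h0 : r = 0
    · subst h0
      have : ((0 - 1 : ZMod p).val : ℝ) = ((p - 1 : ℕ) : ℝ) := by
        rw [zero_sub, val_neg_one_real, Nat.cast_sub NeZero.one_le, Nat.cast_one]
      have : (0 - 1 : ZMod p).val = p - 1 := by exact_mod_cast this
      rw [this]
      simp
      omega
    · have h1 : r.val ≠ 0 := fun h => h0 ((ZMod.val_eq_zero r).1 h)
      rw [val_sub_one_nat h0]
      split_ifs <;> omega
  · have h1 := slot_lt h r r
    rw [if_neg h.ne', sub_zero, if_neg (by omega), if_neg (by omega)]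

/-- The straight motion of the twist coincides, point by point, with the cable of the resting
configuration in which row `a` makes one cyclic shift: the leftmost strand dips while the others
move one step to the left. -/
theorem cableSum_twist (a : Fin n) : CableSum p n (twist p a) 1 1 := by
  let e : Fin n → ℤ := fun b => if b = a then 1 else 0
  obtain ⟨m, hm, hm'⟩ := isNice_run (p * a + 1) (p - 1)
  change Braid.mk m = twist p a at hm
  let ψ : Path (0 : Fin n → ℝ) fun b => (e b : ℝ) :=
    { toFun := fun s b => (s : ℝ) * e b
      continuous_toFun := by fun_prop
      source' := by ext; simp
      target' := by ext; simp }
  have hperm : ∀ x, m.perm (slot p n x) = slot p n (cablePerm p 1 e x) := by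
    rintro ⟨b, r⟩
    rw [← Braid.perm_mk, hm, perm_twist]
    simp [cablePerm, e]
  refine ⟨e, ⟨m, 1, m.restrict (slot p n) (cablePerm p 1 e) hperm,
    (1 : Motion base).cable p 1 (fun a => rfl) e ψ, 1, ψ, hm, rfl, ?_, fun a => rfl, fun x => rfl,
    fun s x => rfl, fun s x => rfl⟩, by simp [e]⟩
  refine Braid.mk_eq.2 (Motion.Equivalent.of_eq rfl fun s => Subtype.ext (funext fun x => ?_))
  obtain ⟨b, r⟩ := x
  change (m.path s).1 (slot p n (b, r)) = cable p (strands n base) (fun b => (s : ℝ) * e b) (b, r)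
  have hr := ZMod.val_lt r
  rw [strands_base, cable_succ_apply, hm']
  change niceFun (twist p a).perm _ s _ = _
  rw [niceFun, perm_twist]
  rcases eq_or_ne b a with rfl | h
  · simp only [e, if_true, Int.cast_one, mul_one]
    rw [shiftLine_sub_val s.2.1 s.2.2]
    unfold shiftPiece
    split_ifs with h1 h2 h2
    · subst h2
      rw [zero_sub, slot_apply, slot_apply]
      apply Complex.ext
      · push_cast
        rw [val_neg_one_real]
        simp
      · simp
    · rw [slot_apply] at h1
      exact absurd ((ZMod.val_eq_zero r).1 (by omega)) h2
    · subst h2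
      simp [slot_apply] at h1
    · rw [slot_apply, slot_apply]
      apply Complex.ext
      · push_cast
        rw [val_sub_one p h2]
        simp [-ZMod.natCast_val]
        ring
      · simp
  · simp only [e, if_neg h, Int.cast_zero, mul_zero, sub_zero]
    rw [shiftLine_neg_val, if_neg, slot_apply]
    · rw [← Complex.ofReal_natCast]
      apply Complex.ext
      · simp [-ZMod.natCast_val]
        ring
      · simp [-ZMod.natCast_val]
    · rcases lt_or_gt_of_ne h with h | h
      · have h1 := slot_lt h r r
        omega
      · have h1 := slot_lt h r r
        omega

/-- If two points of different rows are aligned, their centres cannot have equal imaginary parts,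
since the centres would then be too far apart horizontally. So the order of the centres is strict
and is inherited by the points. -/
theorem cable_mem_chart {z : Fin n → ℂ} (hz : Function.Injective z) {θ : Fin n → ℝ}
    (hθ : ∀ a b, a ≠ b → θ a ≤ θ b → (z a).im ≤ (z b).im) {η : Fin n × ZMod p → ℝ}
    (hη : ∀ x y, η x < η y → x.1 ≠ y.1 → θ x.1 ≤ θ y.1) : cable p z 0 ∈ chart η := by
  have hp : (0 : ℝ) < p := by exact_mod_cast Nat.pos_of_ne_zero (NeZero.ne p)
  have e : ∀ x : Fin n × ZMod p, (cable p z 0 x).re = p * (z x.1).re + (1 - p) + gap z * x.2.val ∧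
      (cable p z 0 x).im = p * (z x.1).im := by
    intro x
    simp only [cable, Pi.zero_apply, shiftLine_neg_val]
    constructor <;> simp [-ZMod.natCast_val]
  intro x y hxy hre
  rw [(e x).1, (e y).1] at hre
  rw [(e x).2, (e y).2]
  by_cases hxy1 : x.1 = y.1
  · rw [hxy1, add_right_inj] at hre
    have h2 := mul_left_cancel₀ (gap_pos hz).ne' hre
    have h3 : x = y := Prod.ext hxy1 (ZMod.val_injective p (by exact_mod_cast h2))
    exact absurd hxy (by rw [h3]; exact lt_irrefl _)
  · refine mul_lt_mul_of_pos_left (lt_of_le_of_ne (hθ _ _ hxy1 (hη x y hxy hxy1)) fun him => ?_) hp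
    have h1 := gap_le z hxy1
    have h2 : z x.1 - z y.1 = (((z x.1).re - (z y.1).re : ℝ) : ℂ) := by
      apply Complex.ext <;> simp [him]
    rw [h2, Complex.norm_real, Real.norm_eq_abs] at h1
    have h3 : (p : ℝ) * ((z x.1).re - (z y.1).re) = gap z * ((y.2.val : ℝ) - x.2.val) := by
      linarith
    have h4 := congrArg abs h3
    rw [abs_mul, abs_mul, abs_of_pos hp, abs_of_pos (gap_pos hz)] at h4
    have h5 : |(y.2.val : ℝ) - x.2.val| < p := by
      have a1 : (x.2.val : ℝ) < p := by exact_mod_cast ZMod.val_lt x.2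
      have a2 : (y.2.val : ℝ) < p := by exact_mod_cast ZMod.val_lt y.2
      have a3 : (0 : ℝ) ≤ x.2.val := Nat.cast_nonneg _
      have a4 : (0 : ℝ) ≤ y.2.val := Nat.cast_nonneg _
      rw [abs_lt]; constructor <;> linarith
    nlinarith [gap_pos hz, mul_lt_mul_of_pos_left h5 (gap_pos hz), mul_le_mul_of_nonneg_left h1 hp.le]

theorem perm_partialCable_slot {a b : Fin n} (h : a < b) (c : Fin n) (r : ZMod p) :
    (partialCable (p * a) (p * b) p p).perm (slot p n (c, r)) = slot p n (swap a b c, r) := by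
  have hr := ZMod.val_lt r
  have h1 := slot_lt h r r
  rw [perm_partialCable h1.2.1 le_rfl, Equiv.swap_apply_def]
  by_cases hca : c = a
  · subst hca
    rw [if_pos rfl, slot_apply, slot_apply]
    rw [slot_apply, slot_apply] at h1
    split_ifs <;> omega
  by_cases hcb : c = b
  · subst hcb
    rw [if_neg hca, if_pos rfl, slot_apply, slot_apply]
    rw [slot_apply, slot_apply] at h1
    split_ifs <;> omega
  rw [if_neg hca, if_neg hcb]
  have h2 : ∀ d : Fin n, c ≠ d → slot p n (c, r) ≤ p * d ∨ p * d + p < slot p n (c, r) := by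
    intro d hd
    rcases lt_or_gt_of_ne hd with hd | hd
    · have := slot_lt hd r r; omega
    · have := slot_lt hd r r; omega
  have h3 := h2 a hca
  have h4 := h2 b hcb
  split_ifs <;> omega

/-- Both the partial cable with `k = p` and the unshifted cable of the band generator exchange two
rows, the row of `a` below that of `b` and both below the rest. They lie in one chart and have the
same permutation. -/
theorem cableSum_partialCable {a b : Fin n} (h : a < b) :
    CableSum p n (partialCable (p * a) (p * b) p p) (band ((a : ℕ) + 1, (b : ℕ) + 1)) 0 := by
  have hab := slot_lt h (0 : ZMod p) 0
  have hlt : (a : ℕ) + 1 < (b : ℕ) + 1 := Nat.add_lt_add_right h 1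
  obtain ⟨m, hm, hm'⟩ := isNice_partialCable hab.2.1 le_rfl
  obtain ⟨m', hn, hn'⟩ := isNice_band hlt
  have hσ : ∀ c : Fin n, m'.perm (c + 1) = (swap a b c : Fin n) + 1 := by
    intro c
    rw [← Braid.perm_mk, hn, perm_band hlt, Equiv.swap_apply_def,
      Equiv.swap_apply_def]
    simp only [Nat.add_right_cancel_iff, ← Fin.ext_iff]
    split_ifs <;> rfl
  have hperm : ∀ x, m.perm (slot p n x) = slot p n (cablePerm p (swap a b) 0 x) := by
    rintro ⟨c, r⟩
    rw [← Braid.perm_mk, hm, perm_partialCable_slot h]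
    simp [cablePerm]
  let ψ : Path (0 : Fin n → ℝ) fun b => (((0 : Fin n → ℤ) b : ℤ) : ℝ) :=
    (Path.refl 0).cast rfl (by ext; simp)
  -- Subtracting `M` for each unit of depth puts the rows of `a`, of `b` and the others in separate
  -- ranges, since all positions are at most `M`.
  let M : ℤ := p * n
  let ζ : Fin n → ℤ := fun c => if c = a then 2 else if c = b then 1 else 0
  let η : Fin n × ZMod p → ℤ := fun x => slot p n x - ζ x.1 * M
  have hslot : ∀ x : Fin n × ZMod p, 0 < (slot p n x : ℤ) ∧ (slot p n x : ℤ) ≤ M := by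
    rintro ⟨c, r⟩
    have h1 := slot_mem c r
    have h2 : p * ((c : ℕ) + 1) ≤ p * n := Nat.mul_le_mul_left p c.2
    rw [mul_add, mul_one] at h2
    simp only [M]
    omega
  have hζ : ∀ x y, η x < η y → ζ y.1 ≤ ζ x.1 := by
    intro x y hxy
    by_contra hlt
    have h1 := hslot x
    have h2 := hslot y
    simp only [η] at hxy
    have : (ζ x.1 + 1) * M ≤ ζ y.1 * M := mul_le_mul_of_nonneg_right (by omega) (by omega)
    nlinarith
  have hη : Function.Injective fun x => (η x : ℝ) := by
    intro x y hxy
    have hxy : (η x : ℝ) = η y := hxy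
    have hxy : η x = η y := by exact_mod_cast hxy
    have h1 := hslot x
    have h2 := hslot y
    have hz : ζ x.1 = ζ y.1 := by
      simp only [η] at hxy
      rcases lt_trichotomy (ζ x.1) (ζ y.1) with h3 | h3 | h3
      · have : (ζ x.1 + 1) * M ≤ ζ y.1 * M := mul_le_mul_of_nonneg_right (by omega) (by omega)
        nlinarith
      · exact h3
      · have : (ζ y.1 + 1) * M ≤ ζ x.1 * M := mul_le_mul_of_nonneg_right (by omega) (by omega)
        nlinarith
    simp only [η, hz] at hxy
    exact (slot p n).injective (by omega)
  refine ⟨0, ⟨m, m', m.restrict (slot p n) (cablePerm p (swap a b) 0) hperm,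
    m'.cable p (swap a b) hσ 0 ψ, swap a b, ψ, hm, hn, ?_, hσ, fun x => rfl,
    fun s x => rfl, fun s x => rfl⟩, by simp⟩
  refine Braid.mk_eq.2 (Motion.InChart.equiv hη (fun s => ?_) (fun s => ?_) rfl)
  · have hdepth : ∀ x : Fin n × ZMod p,
        cableDepth (p * a) (p * b) p p (slot p n x) = ζ x.1 := by
      rintro ⟨c, r⟩
      have h1 := slot_mem c r
      simp only [cableDepth, ζ]
      by_cases hca : c = a
      · subst hca
        rw [if_pos h1, if_pos rfl]
        norm_num
      have h2 : ∀ d : Fin n, c ≠ d → slot p n (c, r) ≤ p * d ∨ p * d + p < slot p n (c, r) := by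
        intro d hd
        rcases lt_or_gt_of_ne hd with hd | hd
        · have := slot_lt hd r r; omega
        · have := slot_lt hd r r; omega
      have h3 := h2 a hca
      by_cases hcb : c = b
      · subst hcb
        rw [if_neg (by omega), if_pos (by omega), if_neg hca, if_pos rfl]
        norm_num
      have h4 := h2 b hcb
      rw [if_neg (by omega), if_neg (by omega), if_neg hca, if_neg hcb]
      norm_num
    intro x y hxy hre
    change ((m.path s).1 (slot p n x)).re = ((m.path s).1 (slot p n y)).re at hre
    change ((m.path s).1 (slot p n x)).im < ((m.path s).1 (slot p n y)).im
    have hne : x ≠ y := fun h => by rw [h] at hxy; exact lt_irrefl _ hxy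
    have hxy' : (η x : ℝ) < η y := hxy
    have hxy' : η x < η y := by exact_mod_cast hxy'
    rw [hm', hm'] at hre ⊢
    simp only [niceFun, hdepth] at hre ⊢
    rw [perm_partialCable_slot h, perm_partialCable_slot h] at hre
    have hs0 : (0 : ℝ) < s := by
      refine lt_of_le_of_ne s.2.1 fun hs => hne ((slot p n).injective ?_)
      rw [← hs] at hre
      simpa using hre
    have hs1 : (s : ℝ) < 1 := by
      refine lt_of_le_of_ne s.2.2 fun hs => hne ?_
      rw [hs] at hre
      have h5 := (slot p n).injective (show slot p n (swap a b x.1, x.2) =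
        slot p n (swap a b y.1, y.2) by
          have : ((slot p n (swap a b x.1, x.2) : ℕ) : ℝ) = slot p n (swap a b y.1, y.2) := by
            linarith
          exact_mod_cast this)
      rw [Prod.mk.injEq] at h5
      exact Prod.ext ((swap a b).injective h5.1) h5.2
    -- Strands of equal depth either rest or belong to one row, which moves rigidly; they are never
    -- aligned.
    have hlt : ζ y.1 < ζ x.1 := by
      refine lt_of_le_of_ne (hζ x y hxy') fun he => ?_
      have hcc : ∀ c : Fin n, ζ c = 0 → swap a b c = c := by
        intro c hc
        have h6 : c ≠ a := fun h6 => by simp [ζ, h6] at hc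
        have h7 : c ≠ b := fun h7 => by simp [ζ, h7, h.ne'] at hc
        exact Equiv.swap_apply_of_ne_of_ne h6 h7
      have hsame : ∀ c d : Fin n, ζ c = ζ d → ζ c ≠ 0 → c = d := by
        intro c d h6 h7
        simp only [ζ] at h6 h7
        split_ifs at h6 h7 <;> simp_all
      by_cases h0 : ζ x.1 = 0
      · rw [hcc _ h0, hcc _ (he.trans h0)] at hre
        refine hne ((slot p n).injective ?_)
        have : ((slot p n x : ℕ) : ℝ) = slot p n y := by simpa using hre
        exact_mod_cast this
      · have h6 := hsame _ _ he.symm h0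
        have h7 : (slot p n (swap a b x.1, x.2) : ℝ) - slot p n x =
            slot p n (swap a b y.1, y.2) - slot p n y := by
          rw [show x = (x.1, x.2) from rfl, show y = (y.1, y.2) from rfl, h6]
          simp only [slot_apply]
          push_cast
          ring
        refine hne ((slot p n).injective ?_)
        have : ((slot p n x : ℕ) : ℝ) = slot p n y := by
          rw [h7] at hre
          linarith
        exact_mod_cast this
    have hlt' : (ζ y.1 : ℝ) < ζ x.1 := by exact_mod_cast hlt
    have : 0 < (s : ℝ) * (1 - s) := mul_pos hs0 (by linarith)
    nlinarith [mul_lt_mul_of_pos_right hlt' this]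
  · change cable p (strands n (m'.path s)) 0 ∈ chart _
    have him : ∀ c, (strands n (m'.path s) c).im = -(ζ c * (s * (1 - s))) := by
      intro c
      rw [strands, hn']
      simp only [niceFun, bandDepth, Nat.add_right_cancel_iff, ← Fin.ext_iff, ζ]
      split_ifs <;> norm_num
    refine cable_mem_chart (strands_injective _) (θ := fun c => -(ζ c : ℝ)) (fun c d _ hcd => ?_)
      fun x y hxy _ => ?_
    · rw [him, him]
      have : 0 ≤ (s : ℝ) * (1 - s) := mul_nonneg s.2.1 (by linarith [s.2.2])
      nlinarith [mul_le_mul_of_nonneg_right hcd this]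
    · have hxy : (η x : ℝ) < η y := hxy
      have := hζ x y (by exact_mod_cast hxy)
      simpa using this

/-- The flat parallel contributes no shifts and the inverse full twist contributes `-p`. -/
theorem cableSum_cabledBand {b : Band} (h1 : 1 ≤ b.1) (h2 : b.1 < b.2) (h3 : b.2 ≤ n) :
    CableSum p n (bands (cabledBand p b)) (band b) (-p) := by
  obtain ⟨i, j⟩ := b
  dsimp only at h1 h2 h3
  obtain ⟨a, rfl⟩ : ∃ a, i = a + 1 := ⟨i - 1, by omega⟩
  obtain ⟨c, rfl⟩ : ∃ c, j = c + 1 := ⟨j - 1, by omega⟩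
  rw [bands_cabledBand h1 h2, Nat.add_sub_cancel, Nat.add_sub_cancel]
  have k1 := cableSum_partialCable (p := p) (a := (⟨a, by omega⟩ : Fin n)) (b := ⟨c, by omega⟩)
    (by simpa using h2)
  have k2 := ((cableSum_twist (p := p) (⟨a, by omega⟩ : Fin n)).pow p).inv
  have := k1.mul k2
  simpa using this

/-- The braid of the cabled staircase word is a cable. -/
theorem cableSum_cabledStaircase {q : ℕ} (hn : 1 ≤ n) (hq : n ≤ q) {P : List Band}
    (hP : IsBKLPositive n P) : CableSum p n (bands (cabledStaircase p q n P))
      (bands (dualGarside n ++ P)) (q - p * (dualGarside n ++ P).length) := by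
  have hδ : IsBKLPositive n (dualGarside n) := by
    intro b hb
    obtain ⟨i, hi, rfl⟩ := List.mem_map.1 hb
    rw [List.mem_range'_1] at hi
    dsimp only
    omega
  rw [bands_cabledStaircase NeZero.one_le hn, bands_append]
  have k1 : CableSum p n ((List.range n).map (twist p)).prod 1 (n * 1) := by
    have := CableSum.list_prod (p := p) (n := n) (twist p) (fun _ => 1) 1 (List.range n)
      fun a ha => cableSum_twist (⟨a, List.mem_range.1 ha⟩ : Fin n)
    simpa using this
  have k2 := CableSum.list_prod (p := p) (n := n) (fun b => bands (cabledBand p b)) band (-p)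
    (dualGarside n) fun b hb => cableSum_cabledBand (hδ b hb).1 (hδ b hb).2.1 (hδ b hb).2.2
  have k3 := (cableSum_twist (p := p) (⟨0, hn⟩ : Fin n)).pow (q - n)
  have k4 := CableSum.list_prod (p := p) (n := n) (fun b => bands (cabledBand p b)) band (-p)
    P fun b hb => cableSum_cabledBand (hP b hb).1 (hP b hb).2.1 (hP b hb).2.2
  -- The shifts add up to `n` from the twists of the blocks, `q - n` from the extra twists, and `-p`
  -- for each letter of `δ` and of `P`.
  have := ((k1.mul k2).mul k3).mul k4
  rw [one_mul, one_pow, mul_one] at this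
  convert this using 1
  · rfl
  rw [List.length_append]
  push_cast [Nat.cast_sub hq]
  ring

/-! ### Closures of motions -/

section CloseUp

variable {Λ : Type} {x₀ : Conf Λ}

/-- The strand of the closure of a motion through the point with label `l`. -/
def closeUp (μ : Motion x₀) (l : Λ) (u : ℝ) : ℂ :=
  (μ.path.extend (Int.fract u)).1 ((μ.perm ^ ⌊u⌋) l)

theorem closeUp_eq (μ : Motion x₀) (l : Λ) (u : ℝ) : closeUp μ l u =
    (μ.path ⟨Int.fract u, Int.fract_nonneg u, (Int.fract_lt_one u).le⟩).1 ((μ.perm ^ ⌊u⌋) l) := by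
  rw [closeUp, Path.extend_apply _ ⟨Int.fract_nonneg u, (Int.fract_lt_one u).le⟩]

theorem continuous_closeUp (μ : Motion x₀) (l : Λ) : Continuous (closeUp μ l) := by
  refine continuous_glue (F := fun k s => (μ.path.extend s).1 ((μ.perm ^ k) l)) (fun k => ?_)
    fun k => ?_
  · exact ((continuous_apply _).comp (continuous_subtype_val.comp
      μ.path.extend.continuous)).continuousOn
  · rw [Path.extend_one, Path.extend_zero, act_apply, ← Equiv.Perm.mul_apply, ← zpow_one_add,
      add_comm]

theorem closeUp_add_int (μ : Motion x₀) (l : Λ) (u : ℝ) (k : ℤ) : closeUp μ l (u + k) =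
    (μ.path.extend (Int.fract u)).1 ((μ.perm ^ ⌊u⌋) ((μ.perm ^ k) l)) := by
  rw [closeUp, Int.fract_add_intCast, Int.floor_add_intCast, zpow_add, Equiv.Perm.mul_apply]

theorem isClosedBraid_closeUp (μ : Motion x₀) {l : Λ} {N : ℕ}
    (hN : ∀ k : ℤ, (μ.perm ^ k) l = l ↔ (N : ℤ) ∣ k) : IsClosedBraid N (closeUp μ l) where
  continuous := continuous_closeUp μ l
  periodic u := by
    have := closeUp_add_int μ l u N
    rw [(hN N).2 dvd_rfl] at this
    exact_mod_cast this
  injective u k h := by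
    rw [closeUp_add_int] at h
    exact (hN k).1 ((μ.perm ^ ⌊u⌋).injective ((μ.path.extend (Int.fract u)).2 h))

/-- A homotopy of motions fixes the initial and final configurations, so every intermediate motion
can be closed up, with the same permutation. -/
theorem closedHomotopic_closeUp {μ ν : Motion x₀} (h : Braid.mk μ = Braid.mk ν) {l : Λ} {N : ℕ}
    (hN : ∀ k : ℤ, (μ.perm ^ k) l = l ↔ (N : ℤ) ∣ k) :
    ClosedHomotopic N (closeUp μ l) (closeUp ν l) := by
  obtain ⟨π, P, Q, rfl, rfl, ⟨F⟩⟩ := (Braid.mk_eq.1 h).elim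
  dsimp only at hN
  refine ⟨fun x => closeUp ⟨π, F.eval (Set.projIcc 0 1 zero_le_one x.1)⟩ l x.2, ?_, ?_, ?_, ?_⟩
  · let f : ℤ → ℝ → C(ℝ, ℂ) := fun k => ContinuousMap.curry
      ⟨fun x : ℝ × ℝ => (F (Set.projIcc 0 1 zero_le_one x.2, Set.projIcc 0 1 zero_le_one x.1)).1
        ((π ^ k) l), by
          refine (continuous_apply _).comp (continuous_subtype_val.comp (F.continuous.comp ?_))
          exact (continuous_projIcc.comp continuous_snd).prodMk
            (continuous_projIcc.comp continuous_fst)⟩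
    have hf : Continuous fun u : ℝ => f ⌊u⌋ (Int.fract u) := by
      refine continuous_glue (F := f) (fun k => (ContinuousMap.continuous _).continuousOn)
        fun k => ?_
      ext t
      change (F (Set.projIcc 0 1 zero_le_one t, Set.projIcc 0 1 zero_le_one 1)).1 ((π ^ k) l) =
        (F (Set.projIcc 0 1 zero_le_one t, Set.projIcc 0 1 zero_le_one 0)).1 ((π ^ (k + 1)) l)
      have e1 : Set.projIcc (0 : ℝ) 1 zero_le_one 1 = 1 := Set.projIcc_right _
      have e0 : Set.projIcc (0 : ℝ) 1 zero_le_one 0 = 0 := Set.projIcc_left _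
      rw [e1, e0, F.target, F.source, act_apply, ← Equiv.Perm.mul_apply, ← zpow_one_add, add_comm]
    have h2 := (ContinuousMap.continuous_uncurry_of_continuous
      (⟨fun u : ℝ => f ⌊u⌋ (Int.fract u), hf⟩ : C(ℝ, C(ℝ, ℂ)))).comp continuous_swap
    exact h2
  · exact fun t _ =>
      isClosedBraid_closeUp ⟨π, F.eval (Set.projIcc 0 1 zero_le_one t)⟩ hN
  · intro u
    have e0 : Set.projIcc (0 : ℝ) 1 zero_le_one 0 = 0 := Set.projIcc_left _
    simp only [e0, Path.Homotopy.eval_zero]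
  · intro u
    have e1 : Set.projIcc (0 : ℝ) 1 zero_le_one 1 = 1 := Set.projIcc_right _
    simp only [e1, Path.Homotopy.eval_one]

end CloseUp

/-! ### Closures of Artin words -/

theorem closeUp_wordMotion (w : List ArtinLetter) (l : ℕ) (u : ℝ) : closeUp (wordMotion w) l u =
    braidPath w ((braidPerm w ^ ⌊u⌋) l) (w.length * Int.fract u) := by
  rw [closeUp_eq]
  rfl

theorem braidClosure_eq (n : ℕ) (w : List ArtinLetter) :
    braidClosure n w = knotOf n (closeUp (wordMotion w) 1) := by
  ext1 t
  rw [knotOf, closeUp_wordMotion]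
  rfl

/-- Around an integer the closure is the sum of the two adjacent pieces minus their common value,
because each piece is constant beyond its own interval. -/
theorem contDiff_closeUp_wordMotion (w : List ArtinLetter) (l : ℕ) :
    ContDiff ℝ ∞ (closeUp (wordMotion w) l) := by
  refine contDiff_iff_contDiffAt.2 fun u₀ => ?_
  set j := ⌊u₀⌋ with hj
  let x : ℕ := (braidPerm w ^ (j - 1)) l
  have hx : braidPerm w x = (braidPerm w ^ j) l := by
    rw [← Equiv.Perm.mul_apply, ← zpow_one_add, add_sub_cancel]
  let f : ℝ → ℂ := fun u => braidPath w x (w.length * (u - (j - 1))) +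
    braidPath w (braidPerm w x) (w.length * (u - j)) - (braidPerm w x : ℕ)
  have hf : ContDiff ℝ ∞ f := by
    have h1 : ContDiff ℝ ∞ fun u : ℝ => (w.length : ℝ) * (u - (j - 1)) := by fun_prop
    have h2 : ContDiff ℝ ∞ fun u : ℝ => (w.length : ℝ) * (u - j) := by fun_prop
    exact (((contDiff_braidPath w _).comp h1).add ((contDiff_braidPath w _).comp h2)).sub
      contDiff_const
  refine hf.contDiffAt.congr_of_eventuallyEq ?_
  have hl : (0 : ℝ) ≤ w.length := Nat.cast_nonneg _
  have hn : Set.Ioo ((j : ℝ) - 1) (j + 1) ∈ nhds u₀ :=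
    Ioo_mem_nhds (by linarith [Int.floor_le u₀]) (Int.lt_floor_add_one u₀)
  filter_upwards [hn] with u hu
  rw [closeUp_wordMotion]
  rcases lt_or_ge u j with h | h
  · have h1 : ⌊u⌋ = j - 1 := Int.floor_eq_iff.2 ⟨by push_cast; exact hu.1.le, by push_cast; linarith⟩
    have h2 : Int.fract u = u - (j - 1) := by rw [Int.fract, h1]; push_cast; ring
    simp only [f]
    rw [h1, h2, braidPath_of_nonpos w (braidPerm w x) (by nlinarith), add_sub_cancel_right]
  · have h1 : ⌊u⌋ = j := Int.floor_eq_iff.2 ⟨h, hu.2⟩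
    have h2 : Int.fract u = u - j := by rw [Int.fract, h1]
    simp only [f]
    rw [h1, h2, braidPath_of_length_le w x (by nlinarith), hx]
    ring

theorem closeUp_wordMotion_int (w : List ArtinLetter) (l : ℕ) (k : ℤ) :
    closeUp (wordMotion w) l k = ((braidPerm w ^ k) l : ℕ) := by
  rw [closeUp_wordMotion]
  simp only [Int.floor_intCast, Int.fract_intCast, mul_zero]
  exact braidPath_of_nonpos _ _ le_rfl

/-- If the closure of a braid word is a knot, then its permutation is a cycle of all strands. -/
theorem perm_of_isKnot {n : ℕ} {w : List ArtinLetter} (h : IsKnot (braidClosure n w)) :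
    0 < n ∧ ∀ k : ℤ, (braidPerm w ^ k) 1 = 1 ↔ (n : ℤ) ∣ k := by
  rw [braidClosure_eq] at h
  -- For `n = 0` the closure is a constant curve, which is not injective modulo one.
  have hn : 0 < n := by
    refine Nat.pos_of_ne_zero fun h0 => ?_
    subst h0
    obtain ⟨k, hk⟩ := h.injective (1 / 2) 0 (by simp [knotOf])
    have h2 : (1 : ℝ) = ((2 * k : ℤ) : ℝ) := by push_cast; linarith
    have : (1 : ℤ) = 2 * k := by exact_mod_cast h2
    omega
  have hn' : (n : ℝ) ≠ 0 := by positivity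
  have key : ∀ k : ℤ, (braidPerm w ^ k) 1 = 1 → (n : ℤ) ∣ k := by
    intro k hk
    obtain ⟨m, hm⟩ := h.injective (k / n) 0 (by
      rw [knotOf, knotOf, aroundAxis_eq_iff, mul_div_cancel₀ _ hn', mul_zero]
      refine ⟨?_, k, by simp⟩
      have e0 := closeUp_wordMotion_int w 1 0
      rw [Int.cast_zero] at e0
      rw [closeUp_wordMotion_int, hk, e0]
      simp)
    refine ⟨m, ?_⟩
    rw [div_eq_iff hn', zero_add] at hm
    have : k = m * n := by exact_mod_cast hm
    rw [this, mul_comm]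
  refine ⟨hn, fun k => ⟨key k, ?_⟩⟩
  rintro ⟨m, rfl⟩
  have h1 := h.periodic 0
  rw [knotOf, knotOf, aroundAxis_eq_iff, zero_add, mul_one, mul_zero] at h1
  have e0 := closeUp_wordMotion_int w 1 0
  have e1 := closeUp_wordMotion_int w 1 n
  rw [Int.cast_zero] at e0
  rw [Int.cast_natCast] at e1
  rw [e0, e1] at h1
  have h2 : (braidPerm w ^ (n : ℤ)) 1 = 1 := by
    have := h1.1
    simp only [zpow_zero, Equiv.Perm.one_apply] at this
    exact_mod_cast this
  rw [zpow_mul]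
  exact Function.IsFixedPt.perm_zpow h2 m

/-! ### Closures of cables -/

section CableClosure

variable {p : ℕ} [NeZero p] {n : ℕ}

/-- The cable of configurations as a continuous map. -/
def cableMap (p n : ℕ) [NeZero p] : C(Conf ℕ × (Fin n → ℝ), Conf (Fin n × ZMod p)) where
  toFun x := ⟨cable p (strands n x.1) x.2, cable_injective p (strands_injective _) _⟩
  continuous_toFun := Continuous.subtype_mk (continuous_pi fun x =>
    (continuous_cable p x).comp ((continuous_strands.comp continuous_fst).prodMk continuous_snd)) _

/-- The homotopy of `m` is paired with the constant homotopy of the phases and pushed through the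
continuous cabling map. -/
theorem Motion.cable_congr {m m' : Motion base} (hm : Braid.mk m = Braid.mk m')
    {σ : Perm (Fin n)} (h : ∀ a : Fin n, m.perm (a + 1) = (σ a : ℕ) + 1)
    (h' : ∀ a : Fin n, m'.perm (a + 1) = (σ a : ℕ) + 1) {e : Fin n → ℤ}
    (ψ : Path (0 : Fin n → ℝ) fun a => (e a : ℝ)) :
    Braid.mk (m.cable p σ h e ψ) = Braid.mk (m'.cable p σ h' e ψ) := by
  obtain ⟨π, P, Q, rfl, rfl, ⟨F⟩⟩ := (Braid.mk_eq.1 hm).elim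
  have k : ((P.prod ψ).map (cableMap p n).continuous).Homotopic
      ((Q.prod ψ).map (cableMap p n).continuous) :=
    ⟨(Path.Homotopic.prodHomotopy F (Path.Homotopy.refl ψ)).map (cableMap p n)⟩
  have s := ((⟨π, P⟩ : Motion base).cable p σ h e ψ).path.source
  have t := ((⟨π, P⟩ : Motion base).cable p σ h e ψ).path.target
  have k' := k.pathCast (x₂ := slotBase p n) (x₃ := act (cablePerm p σ e) (slotBase p n))
    (s.symm.trans (by
      change cableMap p n (P 0, ψ 0) = _
      rw [P.source, ψ.source]))
    (t.symm.trans (by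
      change cableMap p n (P 1, ψ 1) = _
      rw [P.target, ψ.target]))
  exact Braid.mk_eq.2 (Motion.Equivalent.of_path k')

/-- The sum of the values of `e` along the orbit of `0`, as a cocycle on the integers. -/
theorem cablePerm_zpow (σ : Perm (Fin n)) (e : Fin n → ℤ) {S : ℤ → ℤ} {a₀ : Fin n} (h0 : S 0 = 0)
    (hS : ∀ k, S (k + 1) = S k + e ((σ ^ k) a₀)) (k : ℤ) :
    (cablePerm p σ e ^ k) (a₀, 0) = ((σ ^ k) a₀, -(S k : ZMod p)) := by
  have step : ∀ k, cablePerm p σ e ((σ ^ k) a₀, -(S k : ZMod p)) =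
      ((σ ^ (k + 1)) a₀, -(S (k + 1) : ZMod p)) := by
    intro k
    rw [hS, add_comm k 1, zpow_one_add]
    simp [cablePerm]
    ring
  induction k with
  | zero => simp [h0]
  | succ k ih => rw [add_comm, zpow_one_add, Equiv.Perm.mul_apply, ih, step, add_comm]
  | pred k ih =>
    have h1 := step (-(k : ℤ) - 1)
    rw [sub_add_cancel, ← ih] at h1
    rw [sub_eq_neg_add, zpow_add, Equiv.Perm.mul_apply, zpow_neg_one, Equiv.Perm.inv_eq_iff_eq,
      ← sub_eq_neg_add, h1]

end CableClosure

/-! ### Satellites of closed braids -/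

theorem IsClosedBraid.add_mul {n : ℕ} {B : ℝ → ℂ} (h : IsClosedBraid n B) (u : ℝ) (m : ℤ) :
    B (u + n * m) = B u := by
  have h1 : Function.Periodic B n := h.periodic
  rw [mul_comm]
  exact h1.int_mul m u

theorem add_mul_of_quasiperiodic {φ : ℝ → ℝ} {T : ℝ} {κ : ℤ} (h : ∀ u, φ (u + T) = φ u + κ)
    (u : ℝ) (m : ℤ) : φ (u + T * m) = φ u + m * κ := by
  induction m with
  | zero => simp
  | succ m ih =>
    push_cast at ih ⊢
    rw [mul_add, mul_one, ← add_assoc, h, ih]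
    ring
  | pred m ih =>
    have h1 := h (u + T * ((-(m : ℤ) - 1 : ℤ) : ℝ))
    have : u + T * ((-(m : ℤ) - 1 : ℤ) : ℝ) + T = u + T * ((-(m : ℤ) : ℤ) : ℝ) := by
      push_cast; ring
    rw [this, ih] at h1
    push_cast at h1 ⊢
    linarith

/-- If `k` is not a multiple of `n`, the central strands are too far apart for their satellites to
meet. If `k = nm`, the centre and radius agree and the phase has advanced by `mκ`, so a coincidence
forces `p ∣ mκ` and, by coprimality, `p ∣ m`. -/
theorem isClosedBraid_satellite {n p : ℕ} {B : ℝ → ℂ} (hB : IsClosedBraid n B) {γ : ℝ → ℝ}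
    (hγ : Continuous γ) (hγ1 : ∀ u (k : ℤ), γ (u + k) = γ u) (hγ0 : ∀ u, γ u ≠ 0) {φ : ℝ → ℝ}
    {κ : ℤ} (hφ : Continuous φ) (hφn : ∀ u, φ (u + n) = φ u + κ) (hκ : IsCoprime (p : ℤ) κ)
    {O : ℝ → ℂ} (hO : Continuous O) (hOp : ∀ y (m : ℤ), O (y + m) = O y ↔ (p : ℤ) ∣ m) {α : ℂ}
    (hα : ∀ u (k : ℤ), ¬(n : ℤ) ∣ k →
      |γ u| * ‖O (φ (u + k)) - O (φ u)‖ < ‖α‖ * ‖B (u + k) - B u‖) (β : ℂ) :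
    IsClosedBraid (p * n) fun u => α * B u + β + γ u * O (φ u) where
  continuous := by
    have := hB.continuous
    fun_prop
  periodic u := by
    have h1 := hB.add_mul u p
    have h2 := hγ1 u ((p * n : ℕ) : ℤ)
    have h3 := add_mul_of_quasiperiodic hφn u p
    have e : u + ((p * n : ℕ) : ℝ) = u + n * ((p : ℤ) : ℝ) := by push_cast; ring
    rw [Int.cast_natCast] at h2
    rw [h2, e, h1, h3]
    have := (hOp (φ u) (p * κ)).2 (dvd_mul_right _ _)
    push_cast at this ⊢
    rw [this]
  injective u k h := by
    have hk : (n : ℤ) ∣ k := by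
      by_contra hk
      have h1 := hα u k hk
      have h2 : α * (B (u + k) - B u) = -(γ u * (O (φ (u + k)) - O (φ u))) := by
        rw [hγ1] at h
        linear_combination h
      rw [← norm_mul, h2, norm_neg, norm_mul, Complex.norm_real, Real.norm_eq_abs] at h1
      exact lt_irrefl _ h1
    obtain ⟨m, rfl⟩ := hk
    rw [hγ1] at h
    push_cast at h ⊢
    rw [hB.add_mul, add_mul_of_quasiperiodic hφn] at h
    have h0 : ((γ u : ℝ) : ℂ) ≠ 0 := by exact_mod_cast hγ0 u
    have h1 := mul_left_cancel₀ h0 (add_left_cancel h)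
    have h2 := (hOp (φ u) (m * κ)).1 (by push_cast; exact h1)
    have h3 := hκ.dvd_of_dvd_mul_right h2
    rw [mul_comm (p : ℤ)]
    exact mul_dvd_mul_left _ h3

/-! ### From cyclic shifts to rotations -/

section Round

variable (p : ℕ)

/-- Uniform motion on the unit circle, once around in time `p`. -/
def roundLine (y : ℝ) : ℂ :=
  ⟨Real.sin (2 * Real.pi * ((y - 1 / 2) / p)), -Real.cos (2 * Real.pi * ((y - 1 / 2) / p))⟩

theorem roundLine_eq (y : ℝ) : roundLine p y =
    -Complex.I * Complex.exp ((2 * Real.pi * ((y - 1 / 2) / p) : ℝ) * Complex.I) := by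
  apply Complex.ext
  · simp [roundLine, Complex.exp_re, Complex.exp_im, -Complex.ofReal_mul, -Complex.ofReal_div]
  · simp [roundLine, Complex.exp_re, Complex.exp_im, -Complex.ofReal_mul, -Complex.ofReal_div]

theorem continuous_roundLine : Continuous (roundLine p) := by
  have : roundLine p = fun y => -Complex.I *
      Complex.exp ((2 * Real.pi * ((y - 1 / 2) / p) : ℝ) * Complex.I) := funext (roundLine_eq p)
  rw [this]
  fun_prop

theorem norm_roundLine (y : ℝ) : ‖roundLine p y‖ = 1 := by
  rw [roundLine_eq, norm_mul, Complex.norm_exp_ofReal_mul_I]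
  simp

theorem roundLine_add_mul [NeZero p] (y : ℝ) (m : ℤ) : roundLine p (y + p * m) = roundLine p y := by
  have hp : (p : ℝ) ≠ 0 := Nat.cast_ne_zero.2 (NeZero.ne p)
  have : 2 * Real.pi * ((y + p * m - 1 / 2) / p) =
      2 * Real.pi * ((y - 1 / 2) / p) + m * (2 * Real.pi) := by
    field_simp
    ring
  rw [roundLine, roundLine, this, Real.sin_add_int_mul_two_pi, Real.cos_add_int_mul_two_pi]

/-- A chord of the circle in polar form, with the direction controlled by the mean of the two
parameters; the signs of both factors are used below. -/
theorem roundLine_sub (y y' : ℝ) : roundLine p y - roundLine p y' =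
    ((2 * Real.sin (Real.pi * ((y - y') / p)) : ℝ) : ℂ) *
      ⟨Real.cos (Real.pi * ((y + y' - 1) / p)), Real.sin (Real.pi * ((y + y' - 1) / p))⟩ := by
  have e1 : (2 * Real.pi * ((y - 1 / 2) / p) - 2 * Real.pi * ((y' - 1 / 2) / p)) / 2 =
    Real.pi * ((y - y') / p) := by ring
  have e2 : (2 * Real.pi * ((y - 1 / 2) / p) + 2 * Real.pi * ((y' - 1 / 2) / p)) / 2 =
    Real.pi * ((y + y' - 1) / p) := by ring
  have h1 := Real.sin_sub_sin (2 * Real.pi * ((y - 1 / 2) / p)) (2 * Real.pi * ((y' - 1 / 2) / p))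
  have h2 := Real.cos_sub_cos (2 * Real.pi * ((y - 1 / 2) / p)) (2 * Real.pi * ((y' - 1 / 2) / p))
  rw [e1, e2] at h1 h2
  apply Complex.ext
  · simp only [roundLine, Complex.sub_re, Complex.re_ofReal_mul]
    linarith
  · simp only [roundLine, Complex.sub_im, Complex.im_ofReal_mul]
    linarith

variable {p} [NeZero p]

/-- Interpolation between cyclic shifts and rotations. -/
def mixLine (p : ℕ) [NeZero p] (t y : ℝ) : ℂ := (1 - t) * shiftLine p y + t * roundLine p y

/-- The pieces of `mixLine`. -/
theorem mixLine_sub_val {s : ℝ} (h0 : 0 ≤ s) (h1 : s ≤ 1) (t : ℝ) (j : ZMod p) :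
    mixLine p t (s - j.val) = (1 - t) * shiftPiece p j s + t * roundLine p (s - j.val) := by
  rw [mixLine, shiftLine_sub_val h0 h1]

/-- Two points that lie on the real line in the cyclic shift differ by a positive real number. The
chord between the corresponding points of the circle is never a negative real number: it could be
real only for `M = -π`, and it is then positive. -/
theorem mixLine_ne_of_lt {s t : ℝ} (h0 : 0 ≤ s) (h1 : s < 1) (ht0 : 0 ≤ t) (ht1 : t ≤ 1)
    {j j' : ZMod p} (hj : j'.val < j.val) (hs : s = 0 ∨ j' ≠ 0) :
    mixLine p t (s - j.val) ≠ mixLine p t (s - j'.val) := by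
  intro h
  have hp : (0 : ℝ) < p := Nat.cast_pos.2 (Nat.pos_of_ne_zero (NeZero.ne p))
  have hjp : (j.val : ℝ) + 1 ≤ p := by exact_mod_cast ZMod.val_lt j
  have hjj : (j'.val : ℝ) + 1 ≤ j.val := by exact_mod_cast hj
  have hj'0 : (0 : ℝ) ≤ j'.val := Nat.cast_nonneg _
  have hj0 : j ≠ 0 := fun h => by rw [h, ZMod.val_zero] at hj; omega
  have piece : ∀ i : ZMod p, s = 0 ∨ i ≠ 0 → shiftPiece p i s = ((i.val - s : ℝ) : ℂ) := by
    rintro i (rfl | hi)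
    · rw [shiftPiece_zero]; simp [-ZMod.natCast_val]
    · rw [shiftPiece, if_neg hi]; apply Complex.ext <;> simp
  rw [mixLine_sub_val h0 h1.le, mixLine_sub_val h0 h1.le, piece j (Or.inr hj0), piece j' hs] at h
  have h2 : (((1 - t) * (j.val - j'.val) : ℝ) : ℂ) +
      t * (roundLine p (s - j.val) - roundLine p (s - j'.val)) = 0 := by
    push_cast at h ⊢
    linear_combination h
  rw [roundLine_sub] at h2
  set A := Real.pi * ((s - j.val - (s - j'.val)) / p) with hA
  set M := Real.pi * ((s - j.val + (s - j'.val) - 1) / p) with hM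
  have hA1 : -Real.pi < A := by
    have : -1 < (s - j.val - (s - j'.val)) / p := by rw [lt_div_iff₀ hp]; linarith
    nlinarith [Real.pi_pos]
  have hA2 : A < 0 := by
    have : (s - j.val - (s - j'.val)) / p < 0 := div_neg_of_neg_of_pos (by linarith) hp
    nlinarith [Real.pi_pos]
  have hsin : Real.sin A < 0 := Real.sin_neg_of_neg_of_neg_pi_lt hA2 hA1
  have hM1 : -(2 * Real.pi) < M := by
    have : -2 < (s - j.val + (s - j'.val) - 1) / p := by rw [lt_div_iff₀ hp]; linarith
    nlinarith [Real.pi_pos]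
  have hM2 : M < 0 := by
    have hlt : s - j.val + (s - j'.val) - 1 < 0 := by
      rcases hs with hs | hs
      · linarith
      · have : (1 : ℝ) ≤ j'.val := by
          exact_mod_cast Nat.pos_of_ne_zero fun h => hs ((ZMod.val_eq_zero j').1 h)
        linarith
    have : (s - j.val + (s - j'.val) - 1) / p < 0 := div_neg_of_neg_of_pos hlt hp
    nlinarith [Real.pi_pos]
  have hre := congrArg Complex.re h2
  have him := congrArg Complex.im h2
  simp only [Complex.add_re, Complex.add_im, Complex.ofReal_re, Complex.ofReal_im,
    Complex.re_ofReal_mul, Complex.im_ofReal_mul, Complex.zero_re, Complex.zero_im, zero_add] at hre him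
  rcases eq_or_lt_of_le ht0 with rfl | ht0
  · simp only [sub_zero, one_mul, zero_mul, add_zero] at hre
    linarith
  have hsM : Real.sin M = 0 := by
    rcases mul_eq_zero.1 him with h3 | h3
    · exact absurd h3 ht0.ne'
    · rcases mul_eq_zero.1 h3 with h4 | h4
      · linarith
      · exact h4
  have hMpi : M = -Real.pi := by
    have h3 := Real.sin_eq_zero_iff_of_lt_of_lt (x := M + Real.pi) (by linarith) (by linarith)
    rw [Real.sin_add_pi, hsM, neg_zero] at h3
    have := h3.1 rfl
    linarith
  rw [hMpi, Real.cos_neg, Real.cos_pi] at hre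
  nlinarith [mul_pos ht0 (neg_pos.2 hsin), mul_nonneg (sub_nonneg.2 ht1) (by linarith : 0 ≤ (j.val : ℝ) - j'.val)]

/-- The point that dips is below the others in the cyclic shift, and by the choice of the phase `1 /
2` in `roundLine` also strictly lower on the circle, so it remains lower during the interpolation.
-/
theorem mixLine_zero_ne {s t : ℝ} (h0 : 0 < s) (h1 : s < 1) (ht0 : 0 ≤ t) (ht1 : t ≤ 1)
    {j : ZMod p} (hj : j ≠ 0) : mixLine p t s ≠ mixLine p t (s - j.val) := by
  intro h
  have hp : (0 : ℝ) < p := Nat.cast_pos.2 (Nat.pos_of_ne_zero (NeZero.ne p))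
  have hjp : (j.val : ℝ) + 1 ≤ p := by exact_mod_cast ZMod.val_lt j
  have hj1 : (1 : ℝ) ≤ j.val := by
    exact_mod_cast Nat.pos_of_ne_zero fun h => hj ((ZMod.val_eq_zero j).1 h)
  have h3 := mixLine_sub_val h0.le h1.le t (0 : ZMod p)
  rw [ZMod.val_zero, Nat.cast_zero, sub_zero] at h3
  rw [h3, mixLine_sub_val h0.le h1.le, shiftPiece, shiftPiece, if_pos rfl, if_neg hj] at h
  have h2 : (1 - t : ℝ) * (⟨((p : ℝ) - 1) * s, -(s * (1 - s))⟩ - ⟨(j.val : ℝ) - s, 0⟩ : ℂ) +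
      t * (roundLine p s - roundLine p (s - j.val)) = 0 := by
    push_cast
    linear_combination h
  rw [roundLine_sub] at h2
  set A := Real.pi * ((s - (s - j.val)) / p) with hA
  set M := Real.pi * ((s + (s - j.val) - 1) / p) with hM
  have hA1 : 0 < A := by
    have : 0 < (s - (s - j.val)) / p := div_pos (by linarith) hp
    nlinarith [Real.pi_pos]
  have hA2 : A < Real.pi := by
    have : (s - (s - j.val)) / p < 1 := by rw [div_lt_iff₀ hp]; linarith
    nlinarith [Real.pi_pos]
  have hsin : 0 < Real.sin A := Real.sin_pos_of_pos_of_lt_pi hA1 hA2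
  have hM1 : -Real.pi < M := by
    have : -1 < (s + (s - j.val) - 1) / p := by rw [lt_div_iff₀ hp]; linarith
    nlinarith [Real.pi_pos]
  have hM2 : M < 0 := by
    have : (s + (s - j.val) - 1) / p < 0 := div_neg_of_neg_of_pos (by linarith) hp
    nlinarith [Real.pi_pos]
  have hsM : Real.sin M < 0 := Real.sin_neg_of_neg_of_neg_pi_lt hM2 hM1
  have him := congrArg Complex.im h2
  simp only [Complex.add_im, Complex.sub_im, Complex.im_ofReal_mul, Complex.zero_im] at him
  have h4 : 0 < s * (1 - s) := mul_pos h0 (by linarith)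
  rcases eq_or_lt_of_le ht0 with rfl | ht0
  · nlinarith
  · nlinarith [mul_pos ht0 (mul_pos hsin (neg_pos.2 hsM)), mul_nonneg (sub_nonneg.2 ht1) h4.le]

theorem mixLine_add_mul (t y : ℝ) (m : ℤ) : mixLine p t (y + p * m) = mixLine p t y := by
  have h1 := shiftLine_congr p y (k := p * m) (k' := 0) (by simp)
  push_cast at h1
  rw [add_zero] at h1
  rw [mixLine, mixLine, roundLine_add_mul, h1]

/-- Translation by integers reduces to the `p` points `s - j` with `0 ≤ s < 1`, which the two
preceding lemmas separate. So the interpolation from cyclic shifts to rotation has no collisions. -/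
theorem mixLine_add_int_eq_iff {t : ℝ} (ht0 : 0 ≤ t) (ht1 : t ≤ 1) (y : ℝ) (m : ℤ) :
    mixLine p t (y + m) = mixLine p t y ↔ (p : ℤ) ∣ m := by
  refine ⟨fun h => ?_, ?_⟩
  · set s := Int.fract y with hs
    have hs0 : 0 ≤ s := Int.fract_nonneg y
    have hs1 : s < 1 := Int.fract_lt_one y
    have red : ∀ k : ℤ, mixLine p t (y + k) = mixLine p t (s - ((-(⌊y⌋ + k : ℤ) : ZMod p).val : ℝ)) := by
      intro k
      have : ((-(⌊y⌋ + k : ℤ) : ZMod p).val : ZMod p) = -(⌊y⌋ + k : ℤ) := ZMod.natCast_zmod_val _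
      have h2 : ((((-(⌊y⌋ + k : ℤ) : ZMod p).val : ℤ) + (⌊y⌋ + k) : ℤ) : ZMod p) = 0 := by
        push_cast at this ⊢
        rw [this]
        ring
      obtain ⟨c, hc⟩ := (ZMod.intCast_zmod_eq_zero_iff_dvd _ p).1 h2
      have h3 : y + k = s - ((-(⌊y⌋ + k : ℤ) : ZMod p).val : ℝ) + p * (c : ℤ) := by
        have hc' : ((((-(⌊y⌋ + k : ℤ) : ZMod p).val : ℤ) + (⌊y⌋ + k) : ℤ) : ℝ) = ((p * c : ℤ) : ℝ) := by
          rw [hc]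
        push_cast at hc'
        push_cast
        rw [← hc', hs, Int.fract]
        ring
      rw [h3, mixLine_add_mul]
    have h1 := red m
    have h2 := red 0
    rw [Int.cast_zero, add_zero] at h2
    rw [h, h2] at h1
    rw [← ZMod.intCast_zmod_eq_zero_iff_dvd]
    set j : ZMod p := -((⌊y⌋ + 0 : ℤ) : ZMod p) with hj
    set j' : ZMod p := -((⌊y⌋ + m : ℤ) : ZMod p) with hj'
    have key : j = j' := by
      by_contra hne
      rcases eq_or_lt_of_le hs0 with h0 | h0
      · rcases lt_trichotomy j.val j'.val with h5 | h5 | h5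
        · exact mixLine_ne_of_lt hs0 hs1 ht0 ht1 h5 (Or.inl h0.symm) h1.symm
        · exact hne (ZMod.val_injective p h5)
        · exact mixLine_ne_of_lt hs0 hs1 ht0 ht1 h5 (Or.inl h0.symm) h1
      · by_cases hj0 : j = 0
        · rw [hj0, ZMod.val_zero, Nat.cast_zero, sub_zero] at h1
          exact mixLine_zero_ne h0 hs1 ht0 ht1 (fun h6 => hne (hj0.trans h6.symm)) h1
        by_cases hj0' : j' = 0
        · rw [hj0', ZMod.val_zero, Nat.cast_zero, sub_zero] at h1
          exact mixLine_zero_ne h0 hs1 ht0 ht1 hj0 h1.symm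
        rcases lt_trichotomy j.val j'.val with h5 | h5 | h5
        · exact mixLine_ne_of_lt hs0 hs1 ht0 ht1 h5 (Or.inr hj0) h1.symm
        · exact hne (ZMod.val_injective p h5)
        · exact mixLine_ne_of_lt hs0 hs1 ht0 ht1 h5 (Or.inr hj0') h1
    rw [hj, hj'] at key
    push_cast at key
    have := neg_injective key
    simpa using this.symm
  · rintro ⟨c, rfl⟩
    push_cast
    exact mixLine_add_mul t y c

/-- The circle has diameter two, so for `2 ≤ p` the mixture keeps the bound `p`. It is strict only
while the cyclic shift contributes, whence `t < 1`. -/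
theorem norm_mixLine_sub_lt (hp : 2 ≤ p) {t : ℝ} (ht0 : 0 ≤ t) (ht1 : t < 1) (y y' : ℝ) :
    ‖mixLine p t y - mixLine p t y'‖ < p := by
  have hp' : (2 : ℝ) ≤ p := by exact_mod_cast hp
  have e : mixLine p t y - mixLine p t y' = ((1 - t : ℝ) : ℂ) * (shiftLine p y - shiftLine p y') +
      (t : ℂ) * (roundLine p y - roundLine p y') := by
    simp only [mixLine]; push_cast; ring
  have h1 := norm_shiftLine_sub_lt p y y'
  have h2 : ‖roundLine p y - roundLine p y'‖ ≤ 2 :=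
    (norm_sub_le _ _).trans (by rw [norm_roundLine, norm_roundLine]; norm_num)
  rw [e]
  refine (norm_add_le _ _).trans_lt ?_
  rw [norm_mul, norm_mul, Complex.norm_real, Complex.norm_real, Real.norm_eq_abs, Real.norm_eq_abs,
    abs_of_nonneg ht0, abs_of_pos (by linarith)]
  nlinarith [mul_lt_mul_of_pos_left h1 (by linarith : 0 < 1 - t), mul_le_mul_of_nonneg_left h2 ht0]

theorem continuous_mixLine : Continuous fun x : ℝ × ℝ => mixLine p x.1 x.2 := by
  have h1 : Continuous fun x : ℝ × ℝ => shiftLine p x.2 :=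
    (continuous_shiftLine p).comp continuous_snd
  have h2 : Continuous fun x : ℝ × ℝ => roundLine p x.2 :=
    (continuous_roundLine p).comp continuous_snd
  unfold mixLine
  fun_prop

end Round

/-! ### The closure of a cable is a satellite -/

theorem exists_cocycle (f : ℤ → ℤ) : ∃ S : ℤ → ℤ, S 0 = 0 ∧ ∀ k, S (k + 1) = S k + f k := by
  refine ⟨fun k => ∑ i ∈ Finset.Ico 0 k, f i - ∑ i ∈ Finset.Ico k 0, f i, by simp, fun k => ?_⟩
  dsimp only
  rcases le_or_gt 0 k with h | h
  · have e : Finset.Ico 0 (k + 1) = insert k (Finset.Ico 0 k) := by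
      ext; simp; omega
    rw [e, Finset.sum_insert (by simp), Finset.Ico_eq_empty_of_le h,
      Finset.Ico_eq_empty_of_le (by omega : 0 ≤ k + 1)]
    simp
    ring
  · have e : Finset.Ico k 0 = insert k (Finset.Ico (k + 1) 0) := by
      ext; simp; omega
    rw [e, Finset.sum_insert (by simp), Finset.Ico_eq_empty_of_le h.le,
      Finset.Ico_eq_empty_of_le (by omega : k + 1 ≤ 0)]
    simp

section CableClosure

variable {p : ℕ} [NeZero p] {n : ℕ}

theorem zpow_succ_eq {π : Perm ℕ} {σ : Perm (Fin n)} (h : ∀ a : Fin n, π (a + 1) = (σ a : ℕ) + 1)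
    (k : ℤ) (a : Fin n) : (π ^ k) (a + 1) = ((σ ^ k) a : ℕ) + 1 := by
  induction k with
  | zero => simp
  | succ k ih => rw [add_comm, zpow_one_add, zpow_one_add, Equiv.Perm.mul_apply, ih, h]; rfl
  | pred k ih =>
    rw [sub_eq_neg_add, zpow_add, zpow_add, Equiv.Perm.mul_apply, ih, zpow_neg_one, zpow_neg_one,
      Equiv.Perm.inv_eq_iff_eq, h]
    simp

/-- During `n` turns the orbit of `a₀` visits every strand once, so the phase gains the total number
of shifts no matter how they are distributed over the strands. -/
theorem sum_cocycle {σ : Perm (Fin n)} {a₀ : Fin n}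
    (hσ : ∀ k : ℤ, (σ ^ k) a₀ = a₀ ↔ (n : ℤ) ∣ k) {e : Fin n → ℤ} {S : ℤ → ℤ} (h0 : S 0 = 0)
    (hS : ∀ k, S (k + 1) = S k + e ((σ ^ k) a₀)) (k : ℤ) : S (k + n) = S k + ∑ a, e a := by
  have hper : ∀ k : ℤ, (σ ^ (k + n)) a₀ = (σ ^ k) a₀ := by
    intro k
    rw [zpow_add, Equiv.Perm.mul_apply, (hσ n).2 dvd_rfl]
  have hsum : ∀ m : ℕ, S m = ∑ i ∈ Finset.range m, e ((σ ^ (i : ℤ)) a₀) := by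
    intro m
    induction m with
    | zero => simpa using h0
    | succ m ih =>
      push_cast
      rw [hS, ih, Finset.sum_range_succ]
  have hinj : Function.Injective fun i : Fin n => (σ ^ ((i : ℕ) : ℤ)) a₀ := by
    intro i j hij
    have h1 : (σ ^ (((i : ℕ) : ℤ) - (j : ℕ))) a₀ = a₀ := by
      rw [sub_eq_neg_add, zpow_add, Equiv.Perm.mul_apply, zpow_neg, Equiv.Perm.inv_eq_iff_eq]
      exact hij
    obtain ⟨c, hc⟩ := (hσ _).1 h1
    have h2 := i.2
    have h3 := j.2
    have : ((i : ℕ) : ℤ) - (j : ℕ) = 0 := by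
      refine Int.eq_zero_of_abs_lt_dvd ⟨c, hc⟩ ?_
      rw [abs_lt]; constructor <;> omega
    exact Fin.ext (by omega)
  have hn : S n = ∑ a, e a := by
    rw [hsum, Finset.sum_range fun i => e ((σ ^ (i : ℤ)) a₀)]
    exact (Equiv.ofBijective _ (Finite.injective_iff_bijective.1 hinj)).sum_comp e
  induction k with
  | zero => rw [zero_add, hn, h0, zero_add]
  | succ k ih =>
    have : ((k : ℤ) + 1 + n) = (k + n) + 1 := by ring
    rw [this, hS, ih, hS, hper]
    ring
  | pred k ih =>
    have h1 := hS (-(k : ℤ) - 1)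
    have h2 := hS (-(k : ℤ) - 1 + n)
    rw [hper, show -(k : ℤ) - 1 + n + 1 = -k + n by ring, ih] at h2
    rw [sub_add_cancel] at h1
    linarith

/-- The size of the rows of points in the closure of the cable of a motion. -/
def closeGap (n : ℕ) (m : Motion base) (u : ℝ) : ℝ := gap (strands n (m.path.extend (Int.fract u)))

theorem closeGap_add_int (m : Motion base) (u : ℝ) (k : ℤ) :
    closeGap n m (u + k) = closeGap n m u := by
  rw [closeGap, closeGap, Int.fract_add_intCast]

theorem closeGap_pos (m : Motion base) (u : ℝ) : 0 < closeGap n m u :=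
  gap_pos (strands_injective _)

theorem continuous_closeGap {m : Motion base} {σ : Perm (Fin n)}
    (h : ∀ a : Fin n, m.perm (a + 1) = (σ a : ℕ) + 1) : Continuous (closeGap n m) := by
  refine continuous_glue (F := fun _ s => gap (strands n (m.path.extend s))) (fun k => ?_)
    fun k => ?_
  · exact (continuous_gap.comp (continuous_strands.comp m.path.extend.continuous)).continuousOn
  · rw [Path.extend_one, Path.extend_zero, strands_act h, gap_comp]

theorem exists_le_closeGap (m : Motion base) : ∃ δ > 0, ∀ u, δ ≤ closeGap n m u := by
  have hc : Continuous fun s => gap (strands n (m.path s)) :=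
    continuous_gap.comp (continuous_strands.comp m.path.continuous)
  obtain ⟨s₀, -, hs₀⟩ := isCompact_univ.exists_isMinOn Set.univ_nonempty hc.continuousOn
  refine ⟨_, gap_pos (strands_injective (n := n) (m.path s₀)), fun u => ?_⟩
  rw [closeGap, Path.extend_apply _ ⟨Int.fract_nonneg u, (Int.fract_lt_one u).le⟩]
  exact hs₀ (Set.mem_univ _)

theorem closeGap_le {m : Motion base} {σ : Perm (Fin n)}
    (h : ∀ a : Fin n, m.perm (a + 1) = (σ a : ℕ) + 1) {a₀ : Fin n}
    (hσ : ∀ k : ℤ, (σ ^ k) a₀ = a₀ ↔ (n : ℤ) ∣ k) (u : ℝ) {k : ℤ} (hk : ¬(n : ℤ) ∣ k) :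
    closeGap n m u ≤ ‖closeUp m ((a₀ : ℕ) + 1) (u + k) - closeUp m ((a₀ : ℕ) + 1) u‖ := by
  rw [closeUp_add_int, closeUp, zpow_succ_eq h, zpow_succ_eq h, zpow_succ_eq h]
  refine gap_le _ fun h' => hk ((hσ k).1 ((σ ^ ⌊u⌋).injective h'))

/-- The closure of a cable. -/
theorem closeUp_cable {m : Motion base} {σ : Perm (Fin n)}
    (h : ∀ a : Fin n, m.perm (a + 1) = (σ a : ℕ) + 1) {e : Fin n → ℤ}
    (ψ : Path (0 : Fin n → ℝ) fun a => (e a : ℝ)) {a₀ : Fin n} {S : ℤ → ℤ} (h0 : S 0 = 0)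
    (hS : ∀ k, S (k + 1) = S k + e ((σ ^ k) a₀)) (u : ℝ) :
    closeUp (m.cable p σ h e ψ) (a₀, 0) u = p * closeUp m ((a₀ : ℕ) + 1) u + (1 - p) +
      closeGap n m u *
        shiftLine p (ψ.extend (Int.fract u) ((σ ^ ⌊u⌋) a₀) + S ⌊u⌋) := by
  have hu : Int.fract u ∈ Set.Icc (0 : ℝ) 1 := ⟨Int.fract_nonneg u, (Int.fract_lt_one u).le⟩
  rw [closeUp, closeUp, closeGap, zpow_succ_eq h, Path.extend_apply _ hu, Path.extend_apply _ hu,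
    Path.extend_apply _ hu]
  change cable p (strands n (m.path _)) (ψ _) ((cablePerm p σ e ^ ⌊u⌋) (a₀, 0)) = _
  rw [cablePerm_zpow σ e h0 hS, cable]
  dsimp only
  have h1 := shiftLine_congr p (ψ ⟨_, hu⟩ ((σ ^ ⌊u⌋) a₀)) (k := -((-(S ⌊u⌋ : ZMod p)).val : ℤ))
    (k' := S ⌊u⌋) (by push_cast; rw [ZMod.natCast_zmod_val, neg_neg])
  push_cast at h1
  rw [sub_eq_add_neg (ψ ⟨_, hu⟩ ((σ ^ ⌊u⌋) a₀)), h1]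
  rfl

theorem continuous_phase {σ : Perm (Fin n)} {e : Fin n → ℤ}
    (ψ : Path (0 : Fin n → ℝ) fun a => (e a : ℝ)) {a₀ : Fin n} {S : ℤ → ℤ}
    (hS : ∀ k, S (k + 1) = S k + e ((σ ^ k) a₀)) :
    Continuous fun u : ℝ => ψ.extend (Int.fract u) ((σ ^ ⌊u⌋) a₀) + S ⌊u⌋ := by
  refine continuous_glue (F := fun k s => ψ.extend s ((σ ^ k) a₀) + (S k : ℝ)) (fun k => ?_)
    fun k => ?_
  · exact (((continuous_apply _).comp ψ.extend.continuous).add continuous_const).continuousOn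
  · rw [Path.extend_one, Path.extend_zero, hS]
    simp
    ring

theorem exp_mul_int_div_eq_iff (c y : ℝ) (m : ℤ) :
    Complex.exp (c * Complex.I) * Complex.exp ((2 * Real.pi * ((y + m) / p) : ℝ) * Complex.I) =
      Complex.exp (c * Complex.I) * Complex.exp ((2 * Real.pi * (y / p) : ℝ) * Complex.I) ↔
      (p : ℤ) ∣ m := by
  have hp : (p : ℂ) ≠ 0 := Nat.cast_ne_zero.2 (NeZero.ne p)
  have hpi : (2 * Real.pi * Complex.I : ℂ) ≠ 0 := Complex.two_pi_I_ne_zero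
  rw [mul_right_inj' (Complex.exp_ne_zero _), Complex.exp_eq_exp_iff_exists_int]
  constructor
  · rintro ⟨k, hk⟩
    refine ⟨k, ?_⟩
    have h1 : (2 * Real.pi * Complex.I : ℂ) * (m / p) = (2 * Real.pi * Complex.I) * k := by
      push_cast at hk
      linear_combination hk
    have h2 := mul_left_cancel₀ hpi h1
    rw [div_eq_iff hp] at h2
    have : m = k * p := by exact_mod_cast h2
    rw [this, mul_comm]
  · rintro ⟨k, rfl⟩
    refine ⟨k, ?_⟩
    push_cast
    field_simp

/-- The closure of a cable of a braid word is homotopic to a curve which winds uniformly around the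
closure of the braid word. -/
theorem CableSum.closedHomotopic (hp : 2 ≤ p) (hn : 0 < n) {w : List ArtinLetter}
    (hw : ∀ k : ℤ, (braidPerm w ^ k) 1 = 1 ↔ (n : ℤ) ∣ k) {κ : ℤ} (hκ : IsCoprime (p : ℤ) κ)
    {W : List ArtinLetter} (h : CableSum p n (ofWord W) (ofWord w) κ) :
    ∃ ρ₀ > 0, ∀ ρ : ℝ, 0 < ρ → ρ < ρ₀ →
      (∀ (u : ℝ) (k : ℤ), ¬(n : ℤ) ∣ k →
        2 * ρ < ‖closeUp (wordMotion w) 1 (u + k) - closeUp (wordMotion w) 1 u‖) ∧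
      ClosedHomotopic (p * n) (closeUp (wordMotion W) 1) fun u =>
        closeUp (wordMotion w) 1 u +
          ρ * (Complex.I * Complex.exp ((2 * Real.pi * (κ * (u / n) / p) : ℝ) * Complex.I)) := by
  obtain ⟨e, ⟨m, m', μ, ν, σ, ψ, hm, hm', hμν, hσ', hμp, hμ, hν⟩, he⟩ := h
  let a₀ : Fin n := ⟨0, hn⟩
  have hmw : m'.perm = braidPerm w := by
    have := congrArg Braid.perm (hm'.trans (mk_wordMotion w).symm)
    exact this
  have hσw : ∀ a : Fin n, (wordMotion w).perm (a + 1) = (σ a : ℕ) + 1 := by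
    intro a
    rw [← hσ', hmw]
    rfl
  have hσ : ∀ k : ℤ, (σ ^ k) a₀ = a₀ ↔ (n : ℤ) ∣ k := by
    intro k
    rw [← hw k]
    have := zpow_succ_eq hσw k a₀
    have h1 : ((a₀ : ℕ)) = 0 := rfl
    rw [h1, zero_add] at this
    change (braidPerm w ^ k) 1 = _ at this
    rw [this, Fin.ext_iff, h1]
    omega
  have hn' : (n : ℝ) ≠ 0 := Nat.cast_ne_zero.2 hn.ne'
  have hp0 : (0 : ℝ) < p := by positivity
  obtain ⟨S, hS0, hS⟩ := exists_cocycle fun k => e ((σ ^ k) a₀)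
  have hSn : ∀ k, S (k + n) = S k + κ := he ▸ sum_cocycle hσ hS0 hS
  have hSmul : ∀ j : ℤ, S (n * j) = j * κ := by
    have h1 := add_mul_of_quasiperiodic (φ := fun u => (S ⌊u⌋ : ℝ)) (T := n) (κ := κ) (fun u => by
      have : ⌊u + n⌋ = ⌊u⌋ + n := Int.floor_add_natCast u n
      rw [this, hSn]; push_cast; ring) 0
    intro j
    have h2 := h1 j
    have h3 : ⌊(0 : ℝ) + n * j⌋ = n * j := by
      rw [zero_add, show (n : ℝ) * j = ((n * j : ℤ) : ℝ) by push_cast; ring, Int.floor_intCast]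
    simp only [h3, Int.floor_zero, hS0] at h2
    push_cast at h2
    rw [zero_add] at h2
    exact_mod_cast h2
  let ν' : Motion (slotBase p n) := (wordMotion w).cable p σ hσw e ψ
  have hν' : Braid.mk μ = Braid.mk ν' := by
    have h1 : Braid.mk ν = Braid.mk (m'.cable p σ hσ' e ψ) := by
      refine Braid.mk_eq.2 (Motion.Equivalent.of_eq ?_ fun s => Subtype.ext (funext (hν s)))
      have : ν.perm = μ.perm := congrArg Braid.perm hμν.symm
      rw [this]
      ext1 x
      rw [hμp]
      rfl
    rw [hμν, h1]
    exact Motion.cable_congr (hm'.trans (mk_wordMotion w).symm) hσ' hσw ψ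
  have hμperm : μ.perm = cablePerm p σ e := congrArg Braid.perm hν'
  -- The strand returns to its row after multiples of `n` turns; after `nj` turns its place has
  -- moved by `jκ`, and coprimality makes the closure connected.
  have hcyc : ∀ k : ℤ, (μ.perm ^ k) (a₀, 0) = (a₀, 0) ↔ ((p * n : ℕ) : ℤ) ∣ k := by
    intro k
    rw [hμperm, cablePerm_zpow σ e hS0 hS, Prod.mk.injEq, hσ, neg_eq_zero,
      ZMod.intCast_zmod_eq_zero_iff_dvd]
    push_cast
    constructor
    · rintro ⟨⟨j, rfl⟩, h2⟩
      rw [hSmul] at h2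
      rw [mul_comm (p : ℤ)]
      exact mul_dvd_mul_left _ (hκ.dvd_of_dvd_mul_right h2)
    · rintro ⟨j, rfl⟩
      rw [show (p : ℤ) * n * j = n * (p * j) by ring, hSmul]
      exact ⟨dvd_mul_right _ _, by rw [mul_assoc]; exact dvd_mul_right _ _⟩
  have hslot : ∀ k : ℤ, (m.perm ^ k) 1 = slot p n ((μ.perm ^ k) (a₀, 0)) := by
    intro k
    have h1 : slot p n (a₀, 0) = 1 := by rw [slot_apply, ZMod.val_zero]; simp [a₀]
    induction k with
    | zero => simp [h1]
    | succ k ih =>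
      rw [add_comm, zpow_one_add, zpow_one_add, Equiv.Perm.mul_apply, ih, CableRel.perm_slot hμ]
      rfl
    | pred k ih =>
      rw [sub_eq_neg_add, zpow_add, zpow_add, Equiv.Perm.mul_apply, ih, zpow_neg_one, zpow_neg_one,
        Equiv.Perm.inv_eq_iff_eq, CableRel.perm_slot hμ]
      simp
  have hW : ClosedHomotopic (p * n) (closeUp (wordMotion W) 1) (closeUp ν' (a₀, 0)) := by
    have e1 : closeUp m 1 = closeUp μ (a₀, 0) := by
      ext1 u
      rw [closeUp_eq, closeUp_eq, hμ, hslot]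
    have h1 : ClosedHomotopic (p * n) (closeUp m 1) (closeUp (wordMotion W) 1) := by
      refine closedHomotopic_closeUp (hm.trans (mk_wordMotion W).symm) fun k => ?_
      rw [← hcyc, hslot]
      have h1 : slot p n (a₀, 0) = 1 := by rw [slot_apply, ZMod.val_zero]; simp [a₀]
      have h2 := (slot p n).injective.eq_iff (a := (μ.perm ^ k) (a₀, 0)) (b := (a₀, 0))
      rwa [h1] at h2
    refine h1.symm.trans ?_
    rw [e1]
    exact closedHomotopic_closeUp hν' hcyc
  obtain ⟨δ, hδ, hδle⟩ := exists_le_closeGap (n := n) (wordMotion w)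
  set B := closeUp (wordMotion w) 1 with hB
  have hBb : IsClosedBraid n B := isClosedBraid_closeUp _ hw
  have hgapB : ∀ (u : ℝ) (k : ℤ), ¬(n : ℤ) ∣ k → closeGap n (wordMotion w) u ≤ ‖B (u + k) - B u‖ :=
    fun u k hk => closeGap_le hσw hσ u hk
  let g := closeGap n (wordMotion w)
  have hg : Continuous g := continuous_closeGap hσw
  let φ : ℝ → ℝ := fun u => ψ.extend (Int.fract u) ((σ ^ ⌊u⌋) a₀) + S ⌊u⌋
  have hφ : Continuous φ := continuous_phase ψ hS
  have hφn : ∀ u, φ (u + n) = φ u + κ := by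
    intro u
    simp only [φ, Int.fract_add_natCast, Int.floor_add_natCast, hSn, zpow_add,
      Equiv.Perm.mul_apply, (hσ n).2 dvd_rfl]
    push_cast
    ring
  -- The bound `ρ p < δ` makes the separation of the rows survive the change of scale from `p` to
  -- one below; with `2 ≤ p` it also gives `2ρ < δ`.
  refine ⟨δ / p, by positivity, fun ρ hρ hρ' => ?_⟩
  rw [lt_div_iff₀ hp0] at hρ'
  have hp2 : (2 : ℝ) ≤ p := by exact_mod_cast hp
  have h2ρ : ∀ (u : ℝ) (k : ℤ), ¬(n : ℤ) ∣ k → 2 * ρ < ‖B (u + k) - B u‖ := by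
    intro u k hk
    refine lt_of_lt_of_le ?_ ((hδle u).trans (hgapB u k hk))
    nlinarith
  refine ⟨h2ρ, hW.trans ?_⟩
  have hφ1 : ∀ u : ℝ, κ * ((u + n) / n) = κ * (u / n) + κ := by
    intro u
    field_simp
  -- the homotopy from the closure of the cable to a curve that winds uniformly
  have hline : ClosedHomotopic (p * n) (closeUp ν' (a₀, 0)) fun u =>
      B u + ρ * roundLine p (κ * (u / n)) := by
    -- Everything is interpolated at once: the scale from `p` to `1`, the offset from `1 - p` to
    -- `0`, the size of the row from `g` to `ρ`, cyclic shifts to rotation, and the phase to one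
    -- that grows linearly. Both phases gain `κ` in `n` turns, and so does their mixture.
    refine ⟨fun x => (((1 - x.1) * p + x.1 : ℝ) : ℂ) * B x.2 + ((1 - x.1) * (1 - p) : ℝ) +
      ((1 - x.1) * g x.2 + x.1 * ρ : ℝ) *
        mixLine p x.1 ((1 - x.1) * φ x.2 + x.1 * (κ * (x.2 / n))), ?_, ?_, ?_, ?_⟩
    · have h1 := hBb.continuous
      have h2 : Continuous fun x : ℝ × ℝ =>
          mixLine p x.1 ((1 - x.1) * φ x.2 + x.1 * (κ * (x.2 / n))) :=
        continuous_mixLine.comp (f := fun x : ℝ × ℝ =>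
          (x.1, (1 - x.1) * φ x.2 + x.1 * (κ * (x.2 / n)))) (by fun_prop)
      fun_prop
    · rintro t ⟨ht0, ht1⟩
      have hγ : ∀ u, 0 < (1 - t) * g u + t * ρ := by
        intro u
        have := closeGap_pos (n := n) (wordMotion w) u
        rcases eq_or_lt_of_le ht0 with rfl | ht
        · simpa using this
        · have : 0 ≤ (1 - t) * g u := mul_nonneg (by linarith) this.le
          have := mul_pos ht hρ
          linarith
      refine isClosedBraid_satellite (α := (((1 - t) * p + t : ℝ) : ℂ)) hBb (γ := fun u => (1 - t) * g u + t * ρ)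
        (φ := fun u => (1 - t) * φ u + t * (κ * (u / n))) (κ := κ) (O := mixLine p t)
        (by fun_prop) (fun u k => ?_) (fun u => (hγ u).ne') (by fun_prop) (fun u => ?_) hκ
        (continuous_mixLine.comp (by fun_prop : Continuous fun y : ℝ => (t, y)))
        (mixLine_add_int_eq_iff ht0 ht1) (fun u k hk => ?_) (((1 - t) * (1 - p) : ℝ) : ℂ)
      · change (1 - t) * closeGap n (wordMotion w) (u + k) + _ = _
        rw [closeGap_add_int]
      · rw [hφn, hφ1]
        ring
      · have hα : 0 < (1 - t) * p + t := by nlinarith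
        rw [abs_of_pos (hγ u), Complex.norm_real, Real.norm_eq_abs, abs_of_pos hα]
        have hg1 : g u ≤ ‖B (u + k) - B u‖ := hgapB u k hk
        have hg0 : δ ≤ g u := hδle u
        have h1 : ((1 - t) * g u + t * ρ) * p ≤ ((1 - t) * p + t) * g u := by
          nlinarith [mul_le_mul_of_nonneg_left (hρ'.le.trans hg0) ht0]
        have h2 := mul_le_mul_of_nonneg_left hg1 hα.le
        -- At `t = 1` the strict bound by `p` is not available; there the row is a circle of radius
        -- `ρ`, and `2ρ` is less than the distance of the strands.
        rcases eq_or_lt_of_le ht1 with rfl | ht1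
        · have h3 : ‖mixLine p 1 ((1 - 1) * φ (u + k) + 1 * (κ * ((u + k) / n))) -
              mixLine p 1 ((1 - 1) * φ u + 1 * (κ * (u / n)))‖ ≤ 2 := by
            refine (norm_sub_le _ _).trans ?_
            simp only [mixLine, Complex.ofReal_one, sub_self, zero_mul, zero_add, one_mul,
              norm_roundLine]
            norm_num
          have := h2ρ u k hk
          nlinarith [mul_le_mul_of_nonneg_left h3 hρ.le]
        · have h3 := norm_mixLine_sub_lt hp ht0 ht1 ((1 - t) * φ (u + k) + t * (κ * ((u + k) / n)))
            ((1 - t) * φ u + t * (κ * (u / n)))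
          nlinarith [mul_lt_mul_of_pos_left h3 (hγ u)]
    · intro u
      rw [closeUp_cable hσw ψ hS0 hS]
      simp [mixLine, g, φ, a₀, hB]
    · intro u
      simp [mixLine]
  refine hline.trans ?_
  -- the rotation of this curve
  let θ₀ : ℝ := -(Real.pi / 2) - 2 * Real.pi * (1 / 2 / p)
  refine ⟨fun x => B x.2 + ρ * (Complex.exp (((1 - x.1) * θ₀ + x.1 * (Real.pi / 2) : ℝ) * Complex.I) *
    Complex.exp ((2 * Real.pi * (κ * (x.2 / n) / p) : ℝ) * Complex.I)), ?_, ?_, ?_, ?_⟩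
  · have h1 := hBb.continuous
    fun_prop
  · rintro t ⟨ht0, ht1⟩
    have := isClosedBraid_satellite hBb (γ := fun _ => ρ) (φ := fun u => κ * (u / n)) (κ := κ)
      (O := fun y => Complex.exp (((1 - t) * θ₀ + t * (Real.pi / 2) : ℝ) * Complex.I) *
        Complex.exp ((2 * Real.pi * (y / p) : ℝ) * Complex.I))
      continuous_const (fun _ _ => rfl) (fun _ => hρ.ne') (by fun_prop) hφ1 hκ (by fun_prop)
      (fun y m => exp_mul_int_div_eq_iff _ y m) (α := 1) (fun u k hk => ?_) 0
    · simpa using this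
    · rw [abs_of_pos hρ, norm_one, one_mul]
      refine lt_of_le_of_lt ?_ (h2ρ u k hk)
      rw [mul_comm]
      refine mul_le_mul_of_nonneg_right ((norm_sub_le _ _).trans ?_) hρ.le
      rw [norm_mul, norm_mul]
      simp only [Complex.norm_exp_ofReal_mul_I]
      norm_num
  · intro u
    -- The angle `θ₀` is the phase built into `roundLine`: `-π/2` from its factor `-i` and `-π/p`
    -- from its shift by `1 / 2`. The final angle `π/2` is the direction away from the axis in which
    -- the framing of the tube starts.
    have h1 : Complex.exp ((θ₀ : ℝ) * Complex.I) *
        Complex.exp ((2 * Real.pi * (κ * (u / n) / p) : ℝ) * Complex.I) =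
        roundLine p (κ * (u / n)) := by
      rw [roundLine_eq, ← Complex.exp_add]
      have e1 : (θ₀ : ℂ) * Complex.I + ((2 * Real.pi * (κ * (u / n) / p) : ℝ) : ℂ) * Complex.I =
          -((Real.pi / 2 : ℂ) * Complex.I) +
            ((2 * Real.pi * ((κ * (u / n) - 1 / 2) / p) : ℝ) : ℂ) * Complex.I := by
        simp only [θ₀]
        push_cast
        ring
      rw [e1, Complex.exp_add, Complex.exp_neg, Complex.exp_pi_div_two_mul_I, Complex.inv_I]
    change _ = B u + ρ * roundLine p (κ * (u / n))
    rw [← h1]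
    simp
  · intro u
    simp only [sub_self, zero_mul, zero_add, one_mul]
    rw [show ((Real.pi / 2 : ℝ) : ℂ) = (Real.pi / 2 : ℂ) by push_cast; rfl,
      Complex.exp_pi_div_two_mul_I]

end CableClosure

/-! ### Additive classes of paths -/

section PathClass

variable {X : Type*} [TopologicalSpace X]

/-- The class of a loop in the abelianized fundamental group. -/
def loopClass {x : X} (p : Path.Homotopic.Quotient x x) : Abelianization (FundamentalGroup X x) :=
  Abelianization.of (FundamentalGroup.fromPath p)

theorem loopClass_trans {x : X} (p q : Path.Homotopic.Quotient x x) :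
    loopClass (p.trans q) = loopClass p * loopClass q := by
  rw [mul_comm]
  exact Abelianization.of.map_mul (FundamentalGroup.fromPath q) (FundamentalGroup.fromPath p)

/-- The class of a path in the component of `x₀`, as an additive function of paths: the paths are
closed up by chosen paths from `x₀`. -/
def pathClass (x₀ : X) {x y : X} (p : Path x y) : Abelianization (FundamentalGroup X x₀) :=
  open Classical in
  if h : Joined x₀ x then loopClass
    (((Path.Homotopic.Quotient.mk h.somePath).trans (Path.Homotopic.Quotient.mk p)).trans
      (Path.Homotopic.Quotient.mk (h.trans ⟨p⟩).somePath).symm)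
  else 1

theorem pathClass_congr (x₀ : X) {x y : X} {p q : Path x y} (h : p.Homotopic q) :
    pathClass x₀ p = pathClass x₀ q := by
  have : Path.Homotopic.Quotient.mk p = Path.Homotopic.Quotient.mk q := Path.Homotopic.Quotient.eq.2 h
  simp only [pathClass, this]

/-- The connecting path chosen at the intermediate point is traversed once in each direction and
cancels. Outside the component of `x₀` all classes are trivial by convention, so no connectedness
has to be assumed. -/
theorem pathClass_trans (x₀ : X) {x y z : X} (p : Path x y) (q : Path y z) :
    pathClass x₀ (p.trans q) = pathClass x₀ p * pathClass x₀ q := by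
  by_cases h : Joined x₀ x
  · have h' : Joined x₀ y := h.trans ⟨p⟩
    rw [pathClass, pathClass, pathClass, dif_pos h, dif_pos h, dif_pos h', ← loopClass_trans]
    congr 1
    rw [Path.Homotopic.Quotient.mk_trans]
    simp only [Path.Homotopic.Quotient.trans_assoc]
    congr 2
    rw [← Path.Homotopic.Quotient.trans_assoc (Path.Homotopic.Quotient.symm _), Path.Homotopic.Quotient.symm_trans, Path.Homotopic.Quotient.refl_trans]
  · have h' : ¬Joined x₀ y := fun h' => h (h'.trans ⟨p.symm⟩)
    rw [pathClass, pathClass, pathClass, dif_neg h, dif_neg h, dif_neg h', mul_one]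

/-- The chosen path from `x₀` to itself need not be constant, but conjugation by it is invisible in
the abelianization. -/
theorem pathClass_loop {x₀ : X} (p : Path x₀ x₀) : pathClass x₀ p = loopClass (Path.Homotopic.Quotient.mk p) := by
  have h : Joined x₀ x₀ := Joined.refl x₀
  rw [pathClass, dif_pos h, loopClass_trans, loopClass_trans, mul_comm (loopClass _), mul_assoc,
    ← loopClass_trans, Path.Homotopic.Quotient.trans_symm]
  have h1 : loopClass (Path.Homotopic.Quotient.refl x₀) = 1 := Abelianization.of.map_one
  rw [h1, mul_one]

theorem pathClass_eq_of_eq (x₀ : X) {x y x' y' : X} {p : Path x y} {q : Path x' y'}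
    (h : ∀ t, p t = q t) : pathClass x₀ p = pathClass x₀ q := by
  obtain rfl : x = x' := by simpa using h 0
  obtain rfl : y = y' := by simpa using h 1
  rw [Path.ext (funext h)]

end PathClass

/-! ### Classes of curves in a subset -/

section CurveClass

variable {Y : Type*} [TopologicalSpace Y] {X : Set Y}

/-- A curve, defined on `[0, 1]`, as a path in a subset. -/
def curvePath (c : ℝ → Y) (h : ContinuousOn c (Set.Icc 0 1)) (hX : Set.MapsTo c (Set.Icc 0 1) X) :
    Path (⟨c 0, hX ⟨le_rfl, zero_le_one⟩⟩ : X) ⟨c 1, hX ⟨zero_le_one, le_rfl⟩⟩ where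
  toFun t := ⟨c t, hX t.2⟩
  continuous_toFun := (continuousOn_iff_continuous_domRestrict.1 h).subtype_mk _
  source' := rfl
  target' := rfl

/-- The class of a curve which is defined on `[0, 1]`, in the abelianized fundamental group of a
subset. -/
def curveClass (x₀ : X) (c : ℝ → Y) : Abelianization (FundamentalGroup X x₀) :=
  open Classical in
  if h : ContinuousOn c (Set.Icc 0 1) ∧ Set.MapsTo c (Set.Icc 0 1) X then
    pathClass x₀ (curvePath c h.1 h.2)
  else 1

theorem curveClass_eq (x₀ : X) {c : ℝ → Y} (h : ContinuousOn c (Set.Icc 0 1))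
    (hX : Set.MapsTo c (Set.Icc 0 1) X) : curveClass x₀ c = pathClass x₀ (curvePath c h hX) :=
  dif_pos ⟨h, hX⟩

theorem curveClass_congr (x₀ : X) {c c' : ℝ → Y} (h : Set.EqOn c c' (Set.Icc 0 1)) :
    curveClass x₀ c = curveClass x₀ c' := by
  by_cases hc : ContinuousOn c (Set.Icc 0 1) ∧ Set.MapsTo c (Set.Icc 0 1) X
  · have hc' : ContinuousOn c' (Set.Icc 0 1) ∧ Set.MapsTo c' (Set.Icc 0 1) X :=
      ⟨hc.1.congr h.symm, hc.2.congr h⟩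
    rw [curveClass_eq x₀ hc.1 hc.2, curveClass_eq x₀ hc'.1 hc'.2]
    exact pathClass_eq_of_eq x₀ fun t => Subtype.ext (h t.2)
  · have hc' : ¬(ContinuousOn c' (Set.Icc 0 1) ∧ Set.MapsTo c' (Set.Icc 0 1) X) :=
      fun hc' => hc ⟨hc'.1.congr h, hc'.2.congr h.symm⟩
    rw [curveClass, curveClass, dif_neg hc, dif_neg hc']

variable {E : Type*} [AddCommGroup E] [Module ℝ E] [TopologicalSpace E]
  [IsTopologicalAddGroup E] [ContinuousSMul ℝ E]

/-- The class, under a map `F` to a subset, of the segment between two points of a convex set. -/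
def segClass (x₀ : X) (F : E → Y) (P Q : E) : Abelianization (FundamentalGroup X x₀) :=
  curveClass x₀ fun t => F ((1 - t) • P + t • Q)

variable {T : Set E} {F : E → Y}

/-- A convex set is contractible, so inside it the class depends only on the endpoints. This covers
reparametrization and the replacement of a curve by a segment. -/
theorem curveClass_comp (x₀ : X) (hT : Convex ℝ T) (hF : ContinuousOn F T) (hX : Set.MapsTo F T X)
    {γ : ℝ → E} (hγ : ContinuousOn γ (Set.Icc 0 1)) (hγT : Set.MapsTo γ (Set.Icc 0 1) T) {P Q : E}
    (h0 : γ 0 = P) (h1 : γ 1 = Q) : curveClass x₀ (F ∘ γ) = segClass x₀ F P Q := by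
  have hP : P ∈ T := h0 ▸ hγT ⟨le_rfl, zero_le_one⟩
  have hQ : Q ∈ T := h1 ▸ hγT ⟨zero_le_one, le_rfl⟩
  have hδT : Set.MapsTo (fun t : ℝ => (1 - t) • P + t • Q) (Set.Icc 0 1) T :=
    fun t ht => hT hP hQ (by linarith [ht.2]) ht.1 (by ring)
  have hδ : ContinuousOn (fun t : ℝ => (1 - t) • P + t • Q) (Set.Icc 0 1) := by fun_prop
  refine (curveClass_eq x₀ (hF.comp hγ hγT) (hX.comp hγT)).trans
    (Eq.trans ?_ (curveClass_eq x₀ (hF.comp hδ hδT) (hX.comp hδT)).symm)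
  have : ContractibleSpace T := hT.contractibleSpace ⟨P, hP⟩
  let f : C(T, X) := ⟨fun x => ⟨F x, hX x.2⟩,
    (continuousOn_iff_continuous_domRestrict.1 hF).subtype_mk _⟩
  have k := (SimplyConnectedSpace.paths_homotopic (curvePath γ hγ hγT)
    ((curvePath _ hδ hδT).cast (Subtype.ext (by simp [h0])) (Subtype.ext (by simp [h1])))).map f
  refine (pathClass_eq_of_eq x₀ fun t => ?_).trans ((pathClass_congr x₀ k).trans
    (pathClass_eq_of_eq x₀ fun t => ?_)) <;> rfl

theorem segClass_mul (x₀ : X) (hT : Convex ℝ T) (hF : ContinuousOn F T) (hX : Set.MapsTo F T X)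
    {P Q R : E} (hP : P ∈ T) (hQ : Q ∈ T) (hR : R ∈ T) :
    segClass x₀ F P Q * segClass x₀ F Q R = segClass x₀ F P R := by
  have hT' : ∀ {P Q : E}, P ∈ T → Q ∈ T →
      Set.MapsTo (fun t : ℝ => (1 - t) • P + t • Q) (Set.Icc 0 1) T :=
    fun hP hQ t ht => hT hP hQ (by linarith [ht.2]) ht.1 (by ring)
  have hc : ∀ P Q : E, ContinuousOn (fun t : ℝ => (1 - t) • P + t • Q) (Set.Icc 0 1) := by
    intro P Q; fun_prop
  have : ContractibleSpace T := hT.contractibleSpace ⟨P, hP⟩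
  let f : C(T, X) := ⟨fun x => ⟨F x, hX x.2⟩,
    (continuousOn_iff_continuous_domRestrict.1 hF).subtype_mk _⟩
  let p : ∀ {P Q : E} (hP : P ∈ T) (hQ : Q ∈ T), Path (⟨P, hP⟩ : T) ⟨Q, hQ⟩ :=
    fun {P Q} hP hQ => (curvePath _ (hc P Q) (hT' hP hQ)).cast (Subtype.ext (by simp))
      (Subtype.ext (by simp))
  have e : ∀ {P Q : E} (hP : P ∈ T) (hQ : Q ∈ T), segClass x₀ F P Q =
      pathClass x₀ ((p hP hQ).map f.continuous) := by
    intro P Q hP hQ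
    rw [segClass]
    exact (curveClass_eq x₀ (hF.comp (hc P Q) (hT' hP hQ)) (hX.comp (hT' hP hQ))).trans
      (pathClass_eq_of_eq x₀ fun t => rfl)
  rw [e hP hQ, e hQ hR, e hP hR, ← pathClass_trans, ← Path.map_trans]
  exact pathClass_congr x₀ ((SimplyConnectedSpace.paths_homotopic _ _).map f)

theorem segClass_self (x₀ : X) (hT : Convex ℝ T) (hF : ContinuousOn F T) (hX : Set.MapsTo F T X)
    {P : E} (hP : P ∈ T) : segClass x₀ F P P = 1 := by
  have := segClass_mul x₀ hT hF hX hP hP hP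
  exact mul_eq_left.1 this

theorem segClass_symm (x₀ : X) (hT : Convex ℝ T) (hF : ContinuousOn F T) (hX : Set.MapsTo F T X)
    {P Q : E} (hP : P ∈ T) (hQ : Q ∈ T) : segClass x₀ F Q P = (segClass x₀ F P Q)⁻¹ := by
  rw [eq_inv_iff_mul_eq_one, segClass_mul x₀ hT hF hX hQ hP hQ, segClass_self x₀ hT hF hX hQ]

/-- The four sides of a rectangle. -/
theorem segClass_square (x₀ : X) {F : ℝ × ℝ → Y} {a b c d : ℝ} (hab : a ≤ b) (hcd : c ≤ d)
    (hF : ContinuousOn F (Set.Icc a b ×ˢ Set.Icc c d))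
    (hX : Set.MapsTo F (Set.Icc a b ×ˢ Set.Icc c d) X) :
    segClass x₀ (fun s => F (a, s)) c d * segClass x₀ (fun t => F (t, d)) a b =
      segClass x₀ (fun t => F (t, c)) a b * segClass x₀ (fun s => F (b, s)) c d := by
  have hT : Convex ℝ (Set.Icc a b ×ˢ Set.Icc c d) := (convex_Icc a b).prod (convex_Icc c d)
  have e1 : ∀ (x y y' : ℝ), segClass x₀ (fun s => F (x, s)) y y' = segClass x₀ F (x, y) (x, y') := by
    intro x y y'
    refine curveClass_congr x₀ fun t _ => ?_
    refine congrArg F (Prod.ext ?_ ?_) <;> simp <;> ring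
  have e2 : ∀ (x x' y : ℝ), segClass x₀ (fun t => F (t, y)) x x' = segClass x₀ F (x, y) (x', y) := by
    intro x x' y
    refine curveClass_congr x₀ fun t _ => ?_
    refine congrArg F (Prod.ext ?_ ?_) <;> simp <;> ring
  have m : ∀ {x y : ℝ}, x ∈ Set.Icc a b → y ∈ Set.Icc c d → (x, y) ∈ Set.Icc a b ×ˢ Set.Icc c d :=
    fun h h' => ⟨h, h'⟩
  have ha : a ∈ Set.Icc a b := ⟨le_rfl, hab⟩
  have hb : b ∈ Set.Icc a b := ⟨hab, le_rfl⟩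
  have hc : c ∈ Set.Icc c d := ⟨le_rfl, hcd⟩
  have hd : d ∈ Set.Icc c d := ⟨hcd, le_rfl⟩
  rw [e1, e1, e2, e2, segClass_mul x₀ hT hF hX (m ha hc) (m ha hd) (m hb hd),
    segClass_mul x₀ hT hF hX (m ha hc) (m hb hc) (m hb hd)]

end CurveClass

/-! ### The longitude at a crossing -/

section Crossing

theorem smoothTransition_half : Real.smoothTransition (1 / 2) = 1 / 2 := by
  have h : 0 < expNegInvGlue (1 / 2) := expNegInvGlue.pos_of_pos (by norm_num)
  rw [Real.smoothTransition, show (1 : ℝ) - 1 / 2 = 1 / 2 by norm_num]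
  field_simp
  norm_num

theorem cos_smoothTransition_nonneg {s : ℝ} (h : s ≤ 1 / 2) :
    0 ≤ Real.cos (Real.pi * Real.smoothTransition s) := by
  have h1 := Real.smoothTransition.monotone h
  rw [smoothTransition_half] at h1
  refine Real.cos_nonneg_of_neg_pi_div_two_le_of_le ?_ ?_ <;>
    nlinarith [Real.pi_pos, Real.smoothTransition.nonneg s]

theorem cos_smoothTransition_nonpos {s : ℝ} (h : 1 / 2 ≤ s) :
    Real.cos (Real.pi * Real.smoothTransition s) ≤ 0 := by
  have h1 := Real.smoothTransition.monotone h
  rw [smoothTransition_half] at h1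
  refine Real.cos_nonpos_of_pi_div_two_le_of_le ?_ ?_ <;>
    nlinarith [Real.pi_pos, Real.smoothTransition.le_one s]

variable {Y : Type*} [TopologicalSpace Y] {X : Set Y}

/-- The square swept out when the moving point `γ s` is pushed straight to the fixed point `x`
compares the two sides. The only condition is that the cone avoids the strands. -/
theorem segClass_cone (x₀ : X) {G : ℂ × ℝ → Y} (hG : Continuous G) {γ : ℝ → ℂ}
    (hγ : Continuous γ) {a b : ℝ} (hab : a ≤ b) (x : ℂ)
    (hX : ∀ t ∈ Set.Icc (0 : ℝ) 1, ∀ s ∈ Set.Icc a b, G ((1 - t : ℝ) * γ s + (t : ℝ) * x, s) ∈ X) :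
    segClass x₀ (fun s => G (γ s, s)) a b * segClass x₀ (fun z => G (z, b)) (γ b) x =
      segClass x₀ (fun z => G (z, a)) (γ a) x * segClass x₀ (fun s => G (x, s)) a b := by
  have h := segClass_square x₀ (F := fun y : ℝ × ℝ =>
    G ((1 - y.1 : ℝ) * γ y.2 + (y.1 : ℝ) * x, y.2)) zero_le_one hab
    (by fun_prop) (fun y hy => hX y.1 hy.1 y.2 hy.2)
  have e : ∀ s, segClass x₀ (fun t : ℝ => G ((1 - t : ℝ) * γ s + (t : ℝ) * x, s)) 0 1 =
      segClass x₀ (fun z => G (z, s)) (γ s) x := by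
    intro s
    refine curveClass_congr x₀ fun t _ => ?_
    simp
  simpa only [e, sub_zero, Complex.ofReal_one, Complex.ofReal_zero, one_mul, zero_mul, add_zero,
    sub_self, zero_add] using h

theorem segClass_const (x₀ : X) {G : ℂ × ℝ → Y} (hG : Continuous G) {x : ℂ} {s : ℝ}
    (h : G (x, s) ∈ X) : segClass x₀ (fun z => G (z, s)) x x = 1 :=
  segClass_self x₀ (convex_singleton x) (by fun_prop)
    (fun y hy => by rw [Set.mem_singleton_iff.1 hy]; exact h) rfl

/-- The position of the upper point in a half turn. -/
def upperPoint (s : ℝ) : ℂ := ⟨Real.cos (Real.pi * Real.smoothTransition s) / 2,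
  Real.sin (Real.pi * Real.smoothTransition s) / 2⟩

/-- A curve which follows the upper point while it turns around it in the opposite sense. -/
def upperCurve (ρ s : ℝ) : ℂ := upperPoint s + ρ * ⟨Real.sin (2 * (Real.pi * Real.smoothTransition s)),
  Real.cos (2 * (Real.pi * Real.smoothTransition s))⟩

/-- A curve which follows the lower point. -/
def lowerCurve (ρ s : ℝ) : ℂ := -upperPoint s + ρ * Complex.I

theorem continuous_upperPoint : Continuous upperPoint := by
  have hS : Continuous Real.smoothTransition := Real.smoothTransition.continuous
  have : Continuous fun s => ((Real.cos (Real.pi * Real.smoothTransition s) / 2 : ℝ) : ℂ) +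
      ((Real.sin (Real.pi * Real.smoothTransition s) / 2 : ℝ) : ℂ) * Complex.I := by fun_prop
  exact this.congr fun s => (Complex.mk_eq_add_mul_I _ _).symm

theorem continuous_lowerCurve (ρ : ℝ) : Continuous (lowerCurve ρ) := by
  have := continuous_upperPoint
  unfold lowerCurve
  fun_prop

theorem continuous_upperCurve (ρ : ℝ) : Continuous (upperCurve ρ) := by
  have hS : Continuous Real.smoothTransition := Real.smoothTransition.continuous
  have h1 := continuous_upperPoint
  have : Continuous fun s => upperPoint s +
    ρ * (((Real.sin (2 * (Real.pi * Real.smoothTransition s)) : ℝ) : ℂ) +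
      ((Real.cos (2 * (Real.pi * Real.smoothTransition s)) : ℝ) : ℂ) * Complex.I) := by fun_prop
  exact this.congr fun s => by rw [upperCurve, Complex.mk_eq_add_mul_I]

/-- Here `C` and `σ` are the cosine and sine of the half-turn and `η` is the sign of `C`. The cone
meets neither strand: a meeting with the upper one forces two nonnegative terms of the first
coordinate to vanish, and the lower one is excluded by the second coordinate. -/
theorem upper_cone {ρ C σ η t : ℝ} (hρ : 0 < ρ) (hρ' : ρ ≤ 1 / 4) (hη : η = 1 ∨ η = -1)
    (hC : 0 ≤ η * C) (hσ : 0 ≤ σ) (h1 : σ ^ 2 + C ^ 2 = 1) (ht0 : 0 ≤ t) (ht1 : t ≤ 1) :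
    ¬((1 - t) * (C / 2 + ρ * (2 * σ * C)) + t * (η / 2) = C / 2 ∧
      (1 - t) * (σ / 2 + ρ * (1 - 2 * σ ^ 2)) + t * ρ = σ / 2) ∧
    ¬(1 - t) * (σ / 2 + ρ * (1 - 2 * σ ^ 2)) + t * ρ = -(σ / 2) := by
  have hσ1 : σ ≤ 1 := by nlinarith [sq_nonneg C]
  have hC1 : η * C ≤ 1 := by rcases hη with rfl | rfl <;> nlinarith [sq_nonneg σ]
  constructor
  · rintro ⟨hx, hy⟩
    have hx' : (1 - t) * (ρ * (2 * (σ * (η * C)))) + t * ((1 - η * C) / 2) = 0 := by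
      rcases hη with rfl | rfl <;> linarith
    have ha : 0 ≤ (1 - t) * (ρ * (2 * (σ * (η * C)))) := by
      have := mul_nonneg hσ hC
      exact mul_nonneg (by linarith) (by positivity)
    have hb : 0 ≤ t * ((1 - η * C) / 2) := mul_nonneg ht0 (by linarith)
    have ha0 : (1 - t) * (ρ * (2 * (σ * (η * C)))) = 0 := by linarith
    have hb0 : t * ((1 - η * C) / 2) = 0 := by linarith
    rcases mul_eq_zero.1 hb0 with h0 | h0
    · subst h0
      have h2 : σ * (η * C) = 0 := by
        have : ρ * (2 * (σ * (η * C))) = 0 := by linarith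
        rcases mul_eq_zero.1 this with h | h
        · linarith
        · linarith
      have h3 : 1 - 2 * σ ^ 2 = 0 := by
        have : ρ * (1 - 2 * σ ^ 2) = 0 := by linarith
        rcases mul_eq_zero.1 this with h | h
        · linarith
        · exact h
      rcases mul_eq_zero.1 h2 with h | h
      · rw [h] at h3; norm_num at h3
      · have : C = 0 := by rcases hη with rfl | rfl <;> linarith
        rw [this] at h1
        nlinarith
    · have h2 : η * C = 1 := by linarith
      have h3 : C ^ 2 = 1 := by
        have : (η * C) ^ 2 = C ^ 2 := by rcases hη with rfl | rfl <;> ring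
        rw [← this, h2]; norm_num
      have h4 : σ = 0 := by
        have : σ ^ 2 = 0 := by linarith
        exact pow_eq_zero_iff (two_ne_zero) |>.1 this
      rw [h4] at hy
      nlinarith
  · intro hy
    have h2 : 2 * ρ * σ ^ 2 ≤ σ := by nlinarith [mul_nonneg hσ (sub_nonneg.2 hσ1)]
    have h3 : 0 < σ + ρ * (1 - 2 * σ ^ 2) := by nlinarith
    have h4 : (1 - t) * (σ + ρ * (1 - 2 * σ ^ 2)) + t * (ρ + σ / 2) = -(t * (σ / 2)) + t * (σ / 2) := by
      linarith
    have h5 : 0 ≤ (1 - t) * (σ + ρ * (1 - 2 * σ ^ 2)) := mul_nonneg (by linarith) h3.le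
    have h6 : 0 ≤ t * (ρ + σ / 2) := by positivity
    rcases eq_or_lt_of_le ht0 with rfl | ht
    · linarith
    · have : 0 < t * (ρ + σ / 2) := by positivity
      linarith

/-- The curve stays strictly higher than the lower point, and it could share the first coordinate of
the upper point only for `t = 0` and `C = 0`, when its height is different. -/
theorem lower_cone {ρ C σ η t : ℝ} (hρ : 0 < ρ) (hρ' : ρ ≤ 1 / 4) (hη : η = 1 ∨ η = -1)
    (hC : 0 ≤ η * C) (hσ : 0 ≤ σ) (h1 : σ ^ 2 + C ^ 2 = 1) (ht0 : 0 ≤ t) (ht1 : t ≤ 1) :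
    ¬((1 - t) * (-(C / 2)) + t * (-(η / 2)) = C / 2 ∧
      (1 - t) * (-(σ / 2) + ρ) + t * ρ = σ / 2) ∧
    ¬(1 - t) * (-(σ / 2) + ρ) + t * ρ = -(σ / 2) := by
  constructor
  · rintro ⟨hx, hy⟩
    have hx' : (2 - t) * (η * C) + t = 0 := by rcases hη with rfl | rfl <;> linarith
    have h2 : 0 ≤ (2 - t) * (η * C) := mul_nonneg (by linarith) hC
    have h3 : t = 0 := by linarith
    subst h3
    have h4 : C = 0 := by rcases hη with rfl | rfl <;> linarith
    rw [h4] at h1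
    have : σ = ρ := by linarith
    rw [this] at h1
    nlinarith
  · intro hy
    nlinarith [mul_nonneg ht0 hσ]

theorem mul_rearrange {A : Type*} [CommGroup A] {P P' Q Q' : A} (U L b b' : A)
    (h : P * Q⁻¹ = P' * Q'⁻¹) : L * (Q * b) * (U * (P' * b')) = L * Q' * b' * (U * P * b) := by
  have h1 : P * Q' = P' * Q := div_eq_div_iff_mul_eq_mul.1 (by simpa only [div_eq_mul_inv] using h)
  calc L * (Q * b) * (U * (P' * b')) = L * U * b * b' * (P' * Q) := by ac_rfl
    _ = L * U * b * b' * (P * Q') := by rw [h1]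
    _ = _ := by ac_rfl

/-- In each half of the crossing both follower curves are pushed to the resting points at `±1/2`,
which they exchange at half time. At that moment the opposite turn has brought the follower of the
upper strand below it, so both followers lie in the convex strip between the strands; there the
connecting segments cancel. -/
theorem segClass_crossing (x₀ : X) {G : ℂ × ℝ → Y} (hG : Continuous G)
    (hX : ∀ s ∈ Set.Icc (0 : ℝ) 1, ∀ w : ℂ, |w.re| ≤ 1 → w ≠ upperPoint s → w ≠ -upperPoint s →
      G (w, s) ∈ X) {ρ : ℝ} (hρ : 0 < ρ) (hρ' : ρ ≤ 1 / 4) :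
    segClass x₀ (fun s => G (lowerCurve ρ s, s)) 0 1 *
        segClass x₀ (fun s => G (upperCurve ρ s, s)) 0 1 =
      segClass x₀ (fun s => G (⟨-(1 / 2), ρ⟩, s)) 0 1 *
        segClass x₀ (fun s => G (⟨1 / 2, ρ⟩, s)) 0 1 := by
  have hC : ∀ s, |Real.cos (Real.pi * Real.smoothTransition s)| ≤ 1 := fun s => Real.abs_cos_le_one _
  have upre : ∀ ρ s, (upperCurve ρ s).re = Real.cos (Real.pi * Real.smoothTransition s) / 2 +
      ρ * (2 * Real.sin (Real.pi * Real.smoothTransition s) *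
        Real.cos (Real.pi * Real.smoothTransition s)) := by
    intro ρ s
    rw [← Real.sin_two_mul]
    simp [upperCurve, upperPoint]
  have upim : ∀ ρ s, (upperCurve ρ s).im = Real.sin (Real.pi * Real.smoothTransition s) / 2 +
      ρ * (1 - 2 * Real.sin (Real.pi * Real.smoothTransition s) ^ 2) := by
    intro ρ s
    rw [Real.sin_sq, show (1 : ℝ) - 2 * (1 - Real.cos (Real.pi * Real.smoothTransition s) ^ 2) =
      2 * Real.cos (Real.pi * Real.smoothTransition s) ^ 2 - 1 by ring, ← Real.cos_two_mul]
    simp [upperCurve, upperPoint]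
  have lore : ∀ ρ s, (lowerCurve ρ s).re = -(Real.cos (Real.pi * Real.smoothTransition s) / 2) := by
    intro ρ s; simp [lowerCurve, upperPoint]
  have loim : ∀ ρ s, (lowerCurve ρ s).im =
      -(Real.sin (Real.pi * Real.smoothTransition s) / 2) + ρ := by
    intro ρ s; simp [lowerCurve, upperPoint]
  have hη' : ∀ η : ℝ, η = 1 ∨ η = -1 → |η / 2| ≤ 1 := by
    rintro η (rfl | rfl) <;> norm_num [abs_le]
  have A : ∀ η : ℝ, η = 1 ∨ η = -1 → ∀ s ∈ Set.Icc (0 : ℝ) 1,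
      0 ≤ η * Real.cos (Real.pi * Real.smoothTransition s) → ∀ t ∈ Set.Icc (0 : ℝ) 1,
      G ((1 - t : ℝ) * upperCurve ρ s + (t : ℝ) * (⟨η / 2, ρ⟩ : ℂ), s) ∈ X := by
    intro η hη s hs hCs t ht
    have key := upper_cone hρ hρ' hη hCs (sin_smoothTransition_nonneg s) (Real.sin_sq_add_cos_sq _)
      ht.1 ht.2
    have hre : ((1 - t : ℝ) * upperCurve ρ s + (t : ℝ) * (⟨η / 2, ρ⟩ : ℂ)).re =
        (1 - t) * (upperCurve ρ s).re + t * (η / 2) := by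
      simp only [Complex.add_re, Complex.re_ofReal_mul]
    have him : ((1 - t : ℝ) * upperCurve ρ s + (t : ℝ) * (⟨η / 2, ρ⟩ : ℂ)).im =
        (1 - t) * (upperCurve ρ s).im + t * ρ := by
      simp only [Complex.add_im, Complex.im_ofReal_mul]
    refine hX s hs _ ?_ (fun h => key.1 ⟨?_, ?_⟩) (fun h => key.2 ?_)
    · have h1 : |(upperCurve ρ s).re| ≤ 1 := by
        rw [upre]
        have h2 := sin_smoothTransition_nonneg s
        have h3 := Real.sin_le_one (Real.pi * Real.smoothTransition s)
        have h4 := abs_le.1 (hC s)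
        have h5 : |Real.sin (Real.pi * Real.smoothTransition s) *
            Real.cos (Real.pi * Real.smoothTransition s)| ≤ 1 := by
          rw [abs_mul, abs_of_nonneg h2]
          exact mul_le_one₀ h3 (abs_nonneg _) (hC s)
        have h5 := abs_le.1 h5
        rw [abs_le]
        constructor <;> nlinarith
      have h2 := hη' η hη
      rw [hre]
      rw [abs_le] at h1 h2 ⊢
      constructor <;> nlinarith [ht.1, ht.2]
    · rw [← upre ρ s, ← hre, h]; rfl
    · rw [← upim ρ s, ← him, h]; rfl
    · rw [← upim ρ s, ← him, h]; rfl
  have B : ∀ η : ℝ, η = 1 ∨ η = -1 → ∀ s ∈ Set.Icc (0 : ℝ) 1,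
      0 ≤ η * Real.cos (Real.pi * Real.smoothTransition s) → ∀ t ∈ Set.Icc (0 : ℝ) 1,
      G ((1 - t : ℝ) * lowerCurve ρ s + (t : ℝ) * (⟨-(η / 2), ρ⟩ : ℂ), s) ∈ X := by
    intro η hη s hs hCs t ht
    have key := lower_cone hρ hρ' hη hCs (sin_smoothTransition_nonneg s) (Real.sin_sq_add_cos_sq _)
      ht.1 ht.2
    have hre : ((1 - t : ℝ) * lowerCurve ρ s + (t : ℝ) * (⟨-(η / 2), ρ⟩ : ℂ)).re =
        (1 - t) * (lowerCurve ρ s).re + t * (-(η / 2)) := by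
      simp only [Complex.add_re, Complex.re_ofReal_mul]
    have him : ((1 - t : ℝ) * lowerCurve ρ s + (t : ℝ) * (⟨-(η / 2), ρ⟩ : ℂ)).im =
        (1 - t) * (lowerCurve ρ s).im + t * ρ := by
      simp only [Complex.add_im, Complex.im_ofReal_mul]
    refine hX s hs _ ?_ (fun h => key.1 ⟨?_, ?_⟩) (fun h => key.2 ?_)
    · have h1 : |(lowerCurve ρ s).re| ≤ 1 := by
        rw [lore, abs_neg, abs_div, abs_two]
        linarith [hC s]
      have h2 := hη' η hη
      rw [hre]
      rw [abs_le] at h1 h2 ⊢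
      constructor <;> nlinarith [ht.1, ht.2]
    · rw [← lore ρ s, ← hre, h]; rfl
    · rw [← loim ρ s, ← him, h]; rfl
    · rw [← loim ρ s, ← him, h]; rfl
  have h01 : (0 : ℝ) ≤ 1 / 2 := by norm_num
  have h12 : (1 / 2 : ℝ) ≤ 1 := by norm_num
  have m1 : ∀ s ∈ Set.Icc (0 : ℝ) (1 / 2), s ∈ Set.Icc (0 : ℝ) 1 :=
    fun s hs => ⟨hs.1, hs.2.trans h12⟩
  have m2 : ∀ s ∈ Set.Icc (1 / 2 : ℝ) 1, s ∈ Set.Icc (0 : ℝ) 1 :=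
    fun s hs => ⟨h01.trans hs.1, hs.2⟩
  have c1 : ∀ s ∈ Set.Icc (0 : ℝ) (1 / 2),
      0 ≤ 1 * Real.cos (Real.pi * Real.smoothTransition s) := fun s hs => by
    rw [one_mul]; exact cos_smoothTransition_nonneg hs.2
  have c2 : ∀ s ∈ Set.Icc (1 / 2 : ℝ) 1,
      0 ≤ -1 * Real.cos (Real.pi * Real.smoothTransition s) := fun s hs => by
    have := cos_smoothTransition_nonpos hs.1
    linarith
  have A1 := segClass_cone x₀ hG (continuous_upperCurve ρ) h01 ⟨1 / 2, ρ⟩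
    fun t ht s hs => A 1 (Or.inl rfl) s (m1 s hs) (c1 s hs) t ht
  have A2 := segClass_cone x₀ hG (continuous_upperCurve ρ) h12 ⟨-1 / 2, ρ⟩
    fun t ht s hs => A (-1) (Or.inr rfl) s (m2 s hs) (c2 s hs) t ht
  have B1 := segClass_cone x₀ hG (continuous_lowerCurve ρ) h01 ⟨-(1 / 2), ρ⟩
    fun t ht s hs => B 1 (Or.inl rfl) s (m1 s hs) (c1 s hs) t ht
  have B2 := segClass_cone x₀ hG (continuous_lowerCurve ρ) h12 ⟨-(-1 / 2), ρ⟩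
    fun t ht s hs => B (-1) (Or.inr rfl) s (m2 s hs) (c2 s hs) t ht
  have s0 : Real.smoothTransition 0 = 0 := Real.smoothTransition.zero
  have s1 : Real.smoothTransition 1 = 1 := Real.smoothTransition.one
  have i0 : (0 : ℝ) ∈ Set.Icc (0 : ℝ) 1 := ⟨le_rfl, zero_le_one⟩
  have i1 : (1 : ℝ) ∈ Set.Icc (0 : ℝ) 1 := ⟨zero_le_one, le_rfl⟩
  have ih : (1 / 2 : ℝ) ∈ Set.Icc (0 : ℝ) 1 := ⟨h01, h12⟩
  have u0 : upperCurve ρ 0 = ⟨1 / 2, ρ⟩ := by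
    apply Complex.ext
    · rw [upre, s0]; simp
    · rw [upim, s0]; simp
  have u1 : upperCurve ρ 1 = ⟨-1 / 2, ρ⟩ := by
    apply Complex.ext
    · rw [upre, s1]; simp
    · rw [upim, s1]; simp
  have l0 : lowerCurve ρ 0 = ⟨-(1 / 2), ρ⟩ := by
    apply Complex.ext
    · rw [lore, s0]; simp
    · rw [loim, s0]; simp
  have l1 : lowerCurve ρ 1 = ⟨-(-1 / 2), ρ⟩ := by
    apply Complex.ext
    · rw [lore, s1]; simp
    · rw [loim, s1]; simp
  have uh : upperCurve ρ (1 / 2) = ⟨0, 1 / 2 - ρ⟩ := by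
    apply Complex.ext
    · rw [upre, smoothTransition_half, mul_one_div, Real.cos_pi_div_two]; simp
    · rw [upim, smoothTransition_half, mul_one_div, Real.sin_pi_div_two]; simp; ring
  have lh : lowerCurve ρ (1 / 2) = ⟨0, -(1 / 2) + ρ⟩ := by
    apply Complex.ext
    · rw [lore, smoothTransition_half, mul_one_div, Real.cos_pi_div_two]; simp
    · rw [loim, smoothTransition_half, mul_one_div, Real.sin_pi_div_two]
  -- points on the curves lie in `X`
  have memU : ∀ s ∈ Set.Icc (0 : ℝ) 1, G (upperCurve ρ s, s) ∈ X := by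
    intro s hs
    rcases le_total s (1 / 2) with h | h
    · simpa using A 1 (Or.inl rfl) s hs (c1 s ⟨hs.1, h⟩) 0 i0
    · simpa using A (-1) (Or.inr rfl) s hs (c2 s ⟨h, hs.2⟩) 0 i0
  have memL : ∀ s ∈ Set.Icc (0 : ℝ) 1, G (lowerCurve ρ s, s) ∈ X := by
    intro s hs
    rcases le_total s (1 / 2) with h | h
    · simpa using B 1 (Or.inl rfl) s hs (c1 s ⟨hs.1, h⟩) 0 i0
    · simpa using B (-1) (Or.inr rfl) s hs (c2 s ⟨h, hs.2⟩) 0 i0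
  have memW : ∀ η : ℝ, η = 1 ∨ η = -1 → ∀ s ∈ Set.Icc (0 : ℝ) 1, G (⟨η / 2, ρ⟩, s) ∈ X := by
    intro η hη s hs
    rcases le_total 0 (η * Real.cos (Real.pi * Real.smoothTransition s)) with h | h
    · simpa using A η hη s hs h 1 i1
    · have := B (-η) (by rcases hη with rfl | rfl <;> simp) s hs (by linarith) 1 i1
      simpa [neg_div] using this
  rw [u0, segClass_const x₀ hG (by simpa using memW 1 (Or.inl rfl) 0 i0), one_mul] at A1
  rw [u1, segClass_const x₀ hG (by simpa using memW (-1) (Or.inr rfl) 1 i1), mul_one] at A2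
  rw [l0, segClass_const x₀ hG (by simpa [neg_div] using memW (-1) (Or.inr rfl) 0 i0), one_mul] at B1
  rw [l1, segClass_const x₀ hG (by simpa [neg_div] using memW 1 (Or.inl rfl) 1 i1), mul_one] at B2
  have en : (-(-1 / 2) : ℝ) = 1 / 2 := by norm_num
  have en' : (-1 / 2 : ℝ) = -(1 / 2) := by norm_num
  rw [uh] at A1 A2
  rw [lh] at B1 B2
  rw [en] at B2
  rw [en'] at A2
  -- the fibre in the middle
  let K : Set ℂ := Complex.re ⁻¹' (Set.Icc (-1) 1) ∩ Complex.im ⁻¹' (Set.Ioo (-(1 / 2)) (1 / 2))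
  have hK : Convex ℝ K := ((convex_Icc (-1 : ℝ) 1).linear_preimage Complex.reLm).inter
    ((convex_Ioo (-(1 / 2) : ℝ) (1 / 2)).linear_preimage Complex.imLm)
  have hup : (upperPoint (1 / 2)).im = 1 / 2 := by
    simp only [upperPoint, smoothTransition_half, mul_one_div, Real.sin_pi_div_two]
  have hKX : Set.MapsTo (fun z => G (z, 1 / 2)) K X := by
    rintro w ⟨hw1, hw2⟩
    refine hX _ ih w (abs_le.2 hw1) (fun h => ?_) (fun h => ?_)
    · have h2 : w.im < 1 / 2 := hw2.2
      rw [h, hup] at h2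
      exact lt_irrefl _ h2
    · have h2 : -(1 / 2) < w.im := hw2.1
      rw [h, Complex.neg_im, hup] at h2
      exact lt_irrefl _ h2
  have hKc : ContinuousOn (fun z => G (z, 1 / 2)) K := by fun_prop
  have kP : (⟨0, 1 / 2 - ρ⟩ : ℂ) ∈ K := ⟨by simp, by constructor <;> simp <;> linarith⟩
  have kQ : (⟨0, -(1 / 2) + ρ⟩ : ℂ) ∈ K := ⟨by simp, by constructor <;> simp <;> linarith⟩
  have k0 : (⟨-(1 / 2), ρ⟩ : ℂ) ∈ K := ⟨by norm_num, by constructor <;> simp <;> linarith⟩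
  have k1 : (⟨1 / 2, ρ⟩ : ℂ) ∈ K := ⟨by norm_num, by constructor <;> simp <;> linarith⟩
  have q1 := segClass_mul x₀ hK hKc hKX kP k1 kQ
  have q2 := segClass_mul x₀ hK hKc hKX kP k0 kQ
  rw [segClass_symm x₀ hK hKc hKX kQ k1] at q1
  rw [segClass_symm x₀ hK hKc hKX kQ k0] at q2
  have split : ∀ {γ : ℝ → ℂ}, Continuous γ → (∀ s ∈ Set.Icc (0 : ℝ) 1, G (γ s, s) ∈ X) →
      segClass x₀ (fun s => G (γ s, s)) 0 1 =
        segClass x₀ (fun s => G (γ s, s)) 0 (1 / 2) * segClass x₀ (fun s => G (γ s, s)) (1 / 2) 1 :=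
    fun hγ h => (segClass_mul x₀ (convex_Icc (0 : ℝ) 1) (by fun_prop) h i0 ih i1).symm
  rw [split (continuous_upperCurve ρ) memU, split (continuous_lowerCurve ρ) memL,
    split (γ := fun _ => ⟨-(1 / 2), ρ⟩) continuous_const
      (fun s hs => by simpa [neg_div] using memW (-1) (Or.inr rfl) s hs),
    split (γ := fun _ => ⟨1 / 2, ρ⟩) continuous_const
      (fun s hs => by simpa using memW 1 (Or.inl rfl) s hs)]
  rw [A2, B2, ← A1, ← B1]
  exact mul_rearrange _ _ _ _ (q1.trans q2.symm)

end Crossing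

/-! ### The longitude along a letter -/

/-- The number of turns that a curve around a strand makes during a letter, to compensate for the
crossing: the upper strand gets one turn, in the sense opposite to that of the crossing. -/
def letterTwist (a : ArtinLetter) (k : ℕ) : ℤ :=
  if a.2 then (if k = a.1 + 1 then -1 else 0) else (if k = a.1 then 1 else 0)

/-- A curve that follows a strand at distance `ρ` during a letter, with `d` turns. -/
def followCurve (a : ArtinLetter) (ρ : ℝ) (d : ℤ) (k : ℕ) (s : ℝ) : ℂ := letterPath a k s +
  ρ * (Complex.I * Complex.exp ((2 * Real.pi * (d * Real.smoothTransition s) : ℝ) * Complex.I))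

theorem followCurve_re (a : ArtinLetter) (ρ : ℝ) (d : ℤ) (k : ℕ) (s : ℝ) :
    (followCurve a ρ d k s).re = (letterPath a k s).re -
      ρ * Real.sin (2 * Real.pi * (d * Real.smoothTransition s)) := by
  rw [followCurve, Complex.exp_mul_I, ← Complex.ofReal_cos, ← Complex.ofReal_sin]
  simp only [Complex.add_re, Complex.mul_re, Complex.I_re, Complex.I_im,
    Complex.add_im, Complex.ofReal_re, Complex.ofReal_im, Complex.mul_im]
  ring

theorem followCurve_im (a : ArtinLetter) (ρ : ℝ) (d : ℤ) (k : ℕ) (s : ℝ) :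
    (followCurve a ρ d k s).im = (letterPath a k s).im +
      ρ * Real.cos (2 * Real.pi * (d * Real.smoothTransition s)) := by
  rw [followCurve, Complex.exp_mul_I, ← Complex.ofReal_cos, ← Complex.ofReal_sin]
  simp only [Complex.add_re, Complex.mul_re, Complex.I_re, Complex.I_im,
    Complex.add_im, Complex.ofReal_re, Complex.ofReal_im, Complex.mul_im]
  ring

theorem sin_two_pi_mul_neg (S : ℝ) : Real.sin (2 * Real.pi * (((-1 : ℤ) : ℝ) * S)) =
    -Real.sin (2 * (Real.pi * S)) := by
  rw [← Real.sin_neg]; congr 1; push_cast; ring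

theorem cos_two_pi_mul_neg (S : ℝ) : Real.cos (2 * Real.pi * (((-1 : ℤ) : ℝ) * S)) =
    Real.cos (2 * (Real.pi * S)) := by
  rw [← Real.cos_neg]; congr 1; push_cast; ring

/-- Up to a translation, and a reflection of the real line for an inverse letter, this is
`segClass_crossing`. The reflection also reverses the sense of the compensating turn. -/
theorem segClass_letter {X : Set Space} (x₀ : X) (a : ArtinLetter) {U : ℝ → ℝ} (hU : Continuous U)
    (hX : ∀ s ∈ Set.Icc (0 : ℝ) 1, ∀ z : ℂ, (∀ k : ℕ, z ≠ letterPath a k s) →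
      aroundAxis z (U s) ∈ X) {ρ : ℝ} (hρ : 0 < ρ) (hρ' : ρ ≤ 1 / 4) :
    segClass x₀ (fun s => aroundAxis (followCurve a ρ (letterTwist a a.1) a.1 s) (U s)) 0 1 *
        segClass x₀ (fun s => aroundAxis (followCurve a ρ (letterTwist a (a.1 + 1)) (a.1 + 1) s)
          (U s)) 0 1 =
      segClass x₀ (fun s => aroundAxis ⟨(a.1 : ℕ), ρ⟩ (U s)) 0 1 *
        segClass x₀ (fun s => aroundAxis ⟨(a.1 + 1 : ℕ), ρ⟩ (U s)) 0 1 := by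
  obtain ⟨i, b⟩ := a
  let ε : ℝ := letterSign (i, b)
  have hε : ε = 1 ∨ ε = -1 := by cases b <;> simp [ε, letterSign]
  let pt : ℂ → ℂ := fun w => ((i + 1 / 2 + ε * w.re : ℝ) : ℂ) + (w.im : ℂ) * Complex.I
  have pre : ∀ w, (pt w).re = i + 1 / 2 + ε * w.re := by intro w; simp [pt]
  have pim : ∀ w, (pt w).im = w.im := by intro w; simp [pt]
  have hpt : Continuous pt := by
    have h1 := Complex.continuous_re
    have h2 := Complex.continuous_im
    fun_prop
  have hG : Continuous fun y : ℂ × ℝ => aroundAxis (pt y.1) (U y.2) :=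
    continuous_aroundAxis.comp ((hpt.comp continuous_fst).prodMk (hU.comp continuous_snd))
  have key := segClass_crossing x₀ hG (fun s hs w hw h1 h2 => hX s hs _ fun k hk => ?_) hρ hρ'
  swap
  · have hre := congrArg Complex.re hk
    have him := congrArg Complex.im hk
    rw [pre, letterPath_re] at hre
    rw [pim, letterPath_im] at him
    dsimp only at hre him
    change _ = if k = i then -(ε * _ / 2) else if k = i + 1 then ε * _ / 2 else 0 at him
    by_cases hk1 : k = i
    · rw [if_pos hk1] at hre him
      rcases hε with h | h <;> rw [h] at hre him
      · refine h2 (Complex.ext ?_ ?_)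
        · simp only [upperPoint, Complex.neg_re]; linarith
        · simp only [upperPoint, Complex.neg_im]; linarith
      · refine h1 (Complex.ext ?_ ?_)
        · simp only [upperPoint]; linarith
        · simp only [upperPoint]; linarith
    by_cases hk2 : k = i + 1
    · rw [if_neg hk1, if_pos hk2] at hre him
      rcases hε with h | h <;> rw [h] at hre him
      · refine h1 (Complex.ext ?_ ?_)
        · simp only [upperPoint]; linarith
        · simp only [upperPoint]; linarith
      · refine h2 (Complex.ext ?_ ?_)
        · simp only [upperPoint, Complex.neg_re]; linarith
        · simp only [upperPoint, Complex.neg_im]; linarith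
    rw [if_neg hk1, if_neg hk2] at hre
    have hw := abs_le.1 hw
    have hk3 : (i : ℝ) ≤ k ∧ (k : ℝ) ≤ i + 1 := by
      have h3 : (i : ℝ) < k + 1 ∧ (k : ℝ) < i + 2 := by
        rcases hε with h | h <;> rw [h] at hre <;> constructor <;> linarith
      have h4 : i < k + 1 := by exact_mod_cast h3.1
      have h5 : k < i + 2 := by exact_mod_cast h3.2
      have h6 : i ≤ k := by omega
      have h7 : k ≤ i + 1 := by omega
      exact ⟨by exact_mod_cast h6, by exact_mod_cast h7⟩
    have h4 : i ≤ k := by exact_mod_cast hk3.1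
    have h5 : k ≤ i + 1 := by exact_mod_cast hk3.2
    omega
  have eu : ∀ s, pt (upperCurve ρ s) = followCurve (i, b) ρ (if b then -1 else 1)
      (if b then i + 1 else i) s := by
    intro s
    have h0 : (upperCurve ρ s).re = Real.cos (Real.pi * Real.smoothTransition s) / 2 +
        ρ * Real.sin (2 * (Real.pi * Real.smoothTransition s)) := by simp [upperCurve, upperPoint]
    have h1 : (upperCurve ρ s).im = Real.sin (Real.pi * Real.smoothTransition s) / 2 +
        ρ * Real.cos (2 * (Real.pi * Real.smoothTransition s)) := by simp [upperCurve, upperPoint]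
    cases b
    · apply Complex.ext
      · rw [pre, followCurve_re, h0, letterPath_re]
        simp [ε, letterSign, mul_assoc]
        ring
      · rw [pim, followCurve_im, h1, letterPath_im]
        simp [letterSign, mul_assoc]
        ring
    · apply Complex.ext
      · rw [pre, followCurve_re, h0, letterPath_re]
        have e := sin_two_pi_mul_neg (Real.smoothTransition s)
        simp only [if_true]
        rw [e]
        simp [ε, letterSign]
        ring
      · rw [pim, followCurve_im, h1, letterPath_im]
        have e := cos_two_pi_mul_neg (Real.smoothTransition s)
        simp only [if_true]
        rw [e]
        simp [letterSign]
  have el : ∀ s, pt (lowerCurve ρ s) = followCurve (i, b) ρ 0 (if b then i else i + 1) s := by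
    intro s
    have h0 : (lowerCurve ρ s).re = -(Real.cos (Real.pi * Real.smoothTransition s) / 2) := by
      simp [lowerCurve, upperPoint]
    have h1 : (lowerCurve ρ s).im = -(Real.sin (Real.pi * Real.smoothTransition s) / 2) + ρ := by
      simp [lowerCurve, upperPoint]
    cases b
    · apply Complex.ext
      · rw [pre, followCurve_re, h0, letterPath_re]
        simp [ε, letterSign]
      · rw [pim, followCurve_im, h1, letterPath_im]
        simp [letterSign]
        ring
    · apply Complex.ext
      · rw [pre, followCurve_re, h0, letterPath_re]
        simp [ε, letterSign]
        ring
      · rw [pim, followCurve_im, h1, letterPath_im]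
        simp [letterSign]
  simp only [eu, el] at key
  cases b
  · have e0 : pt ⟨-(1 / 2), ρ⟩ = ⟨(i + 1 : ℕ), ρ⟩ := by
      apply Complex.ext
      · rw [pre]; simp [ε, letterSign]; ring
      · rw [pim]
    have e1 : pt ⟨1 / 2, ρ⟩ = ⟨(i : ℕ), ρ⟩ := by
      apply Complex.ext
      · rw [pre]; simp [ε, letterSign]
      · rw [pim]
    rw [e0, e1] at key
    simpa [letterTwist, mul_comm] using key
  · have e0 : pt ⟨-(1 / 2), ρ⟩ = ⟨(i : ℕ), ρ⟩ := by
      apply Complex.ext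
      · rw [pre]; simp [ε, letterSign]
      · rw [pim]
    have e1 : pt ⟨1 / 2, ρ⟩ = ⟨(i + 1 : ℕ), ρ⟩ := by
      apply Complex.ext
      · rw [pre]; simp [ε, letterSign]; ring
      · rw [pim]
    rw [e0, e1] at key
    simpa [letterTwist] using key

/-! ### Waiting loops -/

/-- A free homotopy moves the base point along a path that appears on both sides of the square and
cancels, since the group is abelian. -/
theorem segClass_eq_of_loops {Y : Type*} [TopologicalSpace Y] {X : Set Y} (x₀ : X)
    {F : ℝ × ℝ → Y} (hF : Continuous F)
    (hX : ∀ t ∈ Set.Icc (0 : ℝ) 1, ∀ u ∈ Set.Icc (0 : ℝ) 1, F (t, u) ∈ X)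
    (h : ∀ t, F (t, 0) = F (t, 1)) :
    segClass x₀ (fun u => F (0, u)) 0 1 = segClass x₀ (fun u => F (1, u)) 0 1 := by
  have := segClass_square x₀ (F := F) zero_le_one zero_le_one hF.continuousOn
    fun y hy => hX y.1 hy.1 y.2 hy.2
  simp only [h] at this
  rw [mul_comm] at this
  exact mul_left_cancel this

theorem aroundAxis_add_int (z : ℂ) (u : ℝ) (k : ℤ) : aroundAxis z (u + k) = aroundAxis z u :=
  aroundAxis_eq_iff.2 ⟨rfl, k, rfl⟩

/-- The circle is widened until it is clear of the braid, moved to the height `R` beyond it, and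
contracted there across the axis. -/
theorem segClass_wait {X : Set Space} (x₀ : X) {x ρ R : ℝ} (hρ : 0 < ρ)
    (h1 : ∀ τ, 0 < τ → ∀ u, aroundAxis ⟨x, τ⟩ u ∈ X)
    (h2 : ∀ y τ, 1 ≤ τ → ∀ u, aroundAxis ⟨y, τ⟩ u ∈ X) (h3 : ∀ v : ℂ, (v, R) ∈ X) :
    segClass x₀ (fun u => aroundAxis ⟨x, ρ⟩ u) 0 1 = 1 := by
  have hc : ∀ {f g h : ℝ × ℝ → ℝ}, Continuous f → Continuous g → Continuous h →
      Continuous fun y => aroundAxis ⟨f y, g y⟩ (h y) := by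
    intro f g h hf hg hh
    have : Continuous fun y => (⟨f y, g y⟩ : ℂ) := by
      have : Continuous fun y => ((f y : ℝ) : ℂ) + ((g y : ℝ) : ℂ) * Complex.I := by fun_prop
      exact this.congr fun y => (Complex.mk_eq_add_mul_I _ _).symm
    exact continuous_aroundAxis.comp (this.prodMk hh)
  have hper : ∀ z, aroundAxis z 0 = aroundAxis z 1 := by
    intro z
    have := aroundAxis_add_int z 0 1
    rw [Int.cast_one, zero_add] at this
    exact this.symm
  have s1 := segClass_eq_of_loops x₀ (F := fun y => aroundAxis ⟨x, ρ + y.1⟩ y.2)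
    (hc (by fun_prop) (by fun_prop) (by fun_prop))
    (fun t ht u _ => h1 _ (by linarith [ht.1]) u) (fun t => hper _)
  have s2 := segClass_eq_of_loops x₀ (F := fun y => aroundAxis ⟨(1 - y.1) * x + y.1 * R, ρ + 1⟩ y.2)
    (hc (by fun_prop) (by fun_prop) (by fun_prop))
    (fun t ht u _ => h2 _ _ (by linarith) u) (fun t => hper _)
  have s3 := segClass_eq_of_loops x₀ (F := fun y => (((1 - y.1 : ℝ) : ℂ) *
      Complex.exp ((ρ + 1 : ℝ) + 2 * Real.pi * y.2 * Complex.I), R))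
    (by fun_prop) (fun t ht u _ => h3 _) (fun t => by
      have := congrArg Prod.fst (hper ⟨R, ρ + 1⟩)
      simp only [aroundAxis] at this
      dsimp only
      rw [this])
  simp only [add_zero, sub_zero, sub_self, one_mul, zero_mul, zero_add, Complex.ofReal_one,
    Complex.ofReal_zero] at s1 s2 s3
  rw [s1, s2]
  refine Eq.trans ?_ (s3.trans ?_)
  · rfl
  · have h := segClass_self x₀ (F := fun _ : ℝ => ((0 : ℂ), R)) (convex_singleton (0 : ℝ))
      continuousOn_const (fun _ _ => h3 0) rfl
    exact h

/-! ### Telescoping classes -/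

section Telescope

variable {Y : Type*} [TopologicalSpace Y] {X : Set Y}

theorem segClass_prod_range {E : Type*} [AddCommGroup E] [Module ℝ E] [TopologicalSpace E]
    [IsTopologicalAddGroup E] [ContinuousSMul ℝ E] (x₀ : X) {F : E → Y} (hF : Continuous F)
    (hX : ∀ x, F x ∈ X) (P : ℕ → E) (L : ℕ) :
    ∏ m ∈ Finset.range L, segClass x₀ F (P m) (P (m + 1)) = segClass x₀ F (P 0) (P L) := by
  induction L with
  | zero =>
    rw [Finset.prod_range_zero]
    exact (segClass_self x₀ convex_univ hF.continuousOn (fun x _ => hX x) (Set.mem_univ _)).symm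
  | succ L ih =>
    rw [Finset.prod_range_succ, ih]
    exact segClass_mul x₀ convex_univ hF.continuousOn (fun x _ => hX x) (Set.mem_univ _)
      (Set.mem_univ _) (Set.mem_univ _)

/-- Each piece may be started with phase zero because the phases reached are integers. So the turns
spent on the letters can be counted separately and add up. -/
theorem segClass_prod_range_of_periodic (x₀ : X) {F : ℝ × ℝ → Y} (hF : Continuous F)
    (hX : ∀ x, F x ∈ X) (hper : ∀ (φ u : ℝ) (k : ℤ), F (φ + k, u) = F (φ, u)) (u : ℕ → ℝ)
    (d : ℕ → ℤ) (L : ℕ) :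
    ∏ m ∈ Finset.range L, segClass x₀ F (0, u m) (d m, u (m + 1)) =
      segClass x₀ F (0, u 0) ((∑ m ∈ Finset.range L, d m : ℤ), u L) := by
  have := segClass_prod_range x₀ hF hX (fun m => (((∑ i ∈ Finset.range m, d i : ℤ) : ℝ), u m)) L
  simp only [Finset.range_zero, Finset.sum_empty, Int.cast_zero] at this
  rw [← this]
  refine Finset.prod_congr rfl fun m _ => curveClass_congr x₀ fun t _ => ?_
  rw [Finset.sum_range_succ]
  have e := hper (t * d m) ((1 - t) * u m + t * u (m + 1)) (∑ i ∈ Finset.range m, d i)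
  simp only [Prod.smul_mk, smul_eq_mul, Prod.mk_add_mk, mul_zero, zero_add]
  rw [← e]
  refine congrArg F (Prod.ext ?_ rfl)
  push_cast
  ring

end Telescope

/-! ### Letters of a word -/

theorem sum_range_getD {M : Type*} [AddCommMonoid M] {α : Type*} (f : α → M) (d : α) (w : List α) :
    ∑ m ∈ Finset.range w.length, f (w.getD m d) = (w.map f).sum := by
  induction w with
  | nil => rfl
  | cons a w ih =>
    rw [List.length_cons, Finset.sum_range_succ', List.map_cons, List.sum_cons, ← ih, add_comm]
    simp

theorem getD_mem {α : Type*} {w : List α} {m : ℕ} (h : m < w.length) (d : α) : w.getD m d ∈ w := by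
  rw [List.getD_eq_getElem w d h]
  exact List.getElem_mem h

theorem braidPath_letter (w : List ArtinLetter) {m : ℕ} (hm : m < w.length) (k : ℕ) {s : ℝ}
    (h0 : 0 ≤ s) (h1 : s ≤ 1) : braidPath w k (m + s) =
      letterPath (w.getD m (0, true)) (braidPerm (w.take m) k) s := by
  induction w generalizing m k with
  | nil => simp at hm
  | cons a w ih =>
    cases m with
    | zero =>
      rw [Nat.cast_zero, zero_add, braidPath_cons_of_le h1]
      rfl
    | succ m =>
      rw [braidPath_cons_of_ge (by push_cast; linarith [(Nat.cast_nonneg m : (0 : ℝ) ≤ m)])]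
      have : ((m + 1 : ℕ) : ℝ) + s - 1 = m + s := by push_cast; ring
      rw [this, ih (by simpa using hm)]
      rfl

theorem closeUp_wordMotion_add (w : List ArtinLetter) (l : ℕ) (k : ℤ) {s : ℝ} (h0 : 0 ≤ s)
    (h1 : s ≤ 1) : closeUp (wordMotion w) l (k + s) =
      braidPath w ((braidPerm w ^ k) l) (w.length * s) := by
  rcases eq_or_lt_of_le h1 with rfl | h1
  · have := closeUp_wordMotion_int w l (k + 1)
    push_cast at this
    rw [this, braidPath_of_length_le _ _ (by simp), add_comm, zpow_one_add]
    rfl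
  · have h2 : ⌊(k : ℝ) + s⌋ = k := by
      rw [Int.floor_intCast_add, Int.floor_eq_zero_iff.2 ⟨h0, h1⟩, add_zero]
    rw [closeUp_wordMotion, Int.fract, h2, add_sub_cancel_left]

/-- The closure of a braid word during a letter. -/
theorem closeUp_wordMotion_letter (w : List ArtinLetter) (l : ℕ) (k : ℤ) {m : ℕ}
    (hm : m < w.length) {s : ℝ} (h0 : 0 ≤ s) (h1 : s ≤ 1) :
    closeUp (wordMotion w) l (k + (m + s) / w.length) =
      letterPath (w.getD m (0, true)) (braidPerm (w.take m) ((braidPerm w ^ k) l)) s := by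
  have hl : (0 : ℝ) < w.length := by exact_mod_cast (Nat.zero_le m).trans_lt hm
  have hm' : ((m + 1 : ℕ) : ℝ) ≤ w.length := by exact_mod_cast hm
  push_cast at hm'
  rw [closeUp_wordMotion_add _ _ _ (by positivity) ((div_le_one hl).2 (by linarith)),
    mul_div_cancel₀ _ hl.ne', braidPath_letter w hm _ h0 h1]

/-- The letters of a word on `n` strands. -/
def IsWordOn (n : ℕ) (w : List ArtinLetter) : Prop := ∀ a ∈ w, 1 ≤ a.1 ∧ a.1 + 1 ≤ n

theorem IsWordOn.take {n : ℕ} {w : List ArtinLetter} (h : IsWordOn n w) (m : ℕ) :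
    IsWordOn n (w.take m) := fun a ha => h a (List.mem_of_mem_take ha)

theorem IsWordOn.braidPerm_mem {n : ℕ} {w : List ArtinLetter} (h : IsWordOn n w) {k : ℕ} :
    braidPerm w k ∈ Finset.Icc 1 n ↔ k ∈ Finset.Icc 1 n := by
  induction w generalizing k with
  | nil => rfl
  | cons a w ih =>
    rw [braidPerm, Equiv.Perm.mul_apply, ih fun b hb => h b (List.mem_cons_of_mem a hb)]
    have := h a List.mem_cons_self
    rw [Finset.mem_Icc, Finset.mem_Icc, Equiv.swap_apply_def]
    split_ifs <;> omega

theorem IsWordOn.braidPerm_zpow_mem {n : ℕ} {w : List ArtinLetter} (h : IsWordOn n w) (hn : 0 < n)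
    (k : ℤ) : (braidPerm w ^ k) 1 ∈ Finset.Icc 1 n := by
  induction k with
  | zero => simp; omega
  | succ k ih =>
    rw [add_comm, zpow_one_add, Equiv.Perm.mul_apply]
    exact h.braidPerm_mem.2 ih
  | pred k ih =>
    rw [← h.braidPerm_mem, ← Equiv.Perm.mul_apply, ← zpow_one_add, add_sub_cancel]
    exact ih

/-- Strands are found only at integers and on the circles of radius `1 / 2` between neighbouring
integers. This crude description suffices to see where a waiting loop is safe. -/
theorem braidPath_location {n : ℕ} {w : List ArtinLetter} (h : IsWordOn n w) {k : ℕ} (hk : k ≤ n)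
    (s : ℝ) : (∃ c : ℕ, c ≤ n ∧ braidPath w k s = c) ∨ ∃ c : ℕ, c + 1 ≤ n ∧
      ((braidPath w k s).re - (c + 1 / 2)) ^ 2 + (braidPath w k s).im ^ 2 = 1 / 4 := by
  induction w generalizing k s with
  | nil => exact Or.inl ⟨k, hk, rfl⟩
  | cons a w ih =>
    have ha := h a List.mem_cons_self
    rcases le_or_gt s 1 with hs | hs
    · rw [braidPath_cons_of_le hs]
      have t := Real.sin_sq_add_cos_sq (Real.pi * Real.smoothTransition s)
      have u := letterSign_sq a
      by_cases h1 : k = a.1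
      · refine Or.inr ⟨a.1, ha.2, ?_⟩
        rw [letterPath_re, letterPath_im, if_pos h1, if_pos h1]
        linear_combination t / 4 + (Real.sin (Real.pi * Real.smoothTransition s)) ^ 2 / 4 * u
      by_cases h2 : k = a.1 + 1
      · refine Or.inr ⟨a.1, ha.2, ?_⟩
        rw [letterPath_re, letterPath_im, if_neg h1, if_pos h2, if_neg h1, if_pos h2]
        linear_combination t / 4 + (Real.sin (Real.pi * Real.smoothTransition s)) ^ 2 / 4 * u
      · refine Or.inl ⟨k, hk, ?_⟩
        simp [letterPath, h1, h2]
    · rw [braidPath_cons_of_ge hs.le]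
      refine ih (fun b hb => h b (List.mem_cons_of_mem a hb)) ?_ _
      rw [Equiv.swap_apply_def]
      split_ifs <;> omega

/-! ### The longitude -/

theorem sum_letterTwist {n : ℕ} {a : ArtinLetter} (h : 1 ≤ a.1 ∧ a.1 + 1 ≤ n) :
    ∑ x ∈ Finset.Icc 1 n, letterTwist a x = if a.2 then -1 else 1 := by
  obtain ⟨i, b⟩ := a
  dsimp only at h
  cases b
  · simp [letterTwist, Finset.sum_ite_eq']
    omega
  · simp [letterTwist, Finset.sum_ite_eq']
    omega

section Longitude

variable {n : ℕ} {w : List ArtinLetter}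

/-- As the closure is connected, the `n` turns of the single strand pass through each position
exactly once during the `m`-th letter. Products over turns thus become products over positions. -/
theorem image_braidPerm_take (hw : IsWordOn n w) (hn : 0 < n)
    (hcyc : ∀ k : ℤ, (braidPerm w ^ k) 1 = 1 ↔ (n : ℤ) ∣ k) (m : ℕ) :
    Set.InjOn (fun j : ℕ => braidPerm (w.take m) ((braidPerm w ^ (j : ℤ)) 1)) (Finset.range n) ∧
      (Finset.range n).image (fun j : ℕ => braidPerm (w.take m) ((braidPerm w ^ (j : ℤ)) 1)) =
        Finset.Icc 1 n := by
  have hinj : Set.InjOn (fun j : ℕ => braidPerm (w.take m) ((braidPerm w ^ (j : ℤ)) 1))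
      (Finset.range n) := by
    intro i hi j hj hij
    have h1 : (braidPerm w ^ (i : ℤ)) 1 = (braidPerm w ^ (j : ℤ)) 1 := (braidPerm _).injective hij
    have h2 : (braidPerm w ^ ((i : ℤ) - j)) 1 = 1 := by
      rw [sub_eq_neg_add, zpow_add, Equiv.Perm.mul_apply, h1, zpow_neg, Equiv.Perm.inv_eq_iff_eq]
    have h3 := (hcyc _).1 h2
    have hi := Finset.mem_range.1 (Finset.mem_coe.1 hi)
    have hj := Finset.mem_range.1 (Finset.mem_coe.1 hj)
    have h4 := Int.eq_zero_of_abs_lt_dvd h3 (by rw [abs_lt]; omega)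
    omega
  refine ⟨hinj, Finset.eq_of_subset_of_card_le (fun x hx => ?_) ?_⟩
  · obtain ⟨j, -, rfl⟩ := Finset.mem_image.1 hx
    exact (hw.take m).braidPerm_mem.2 (hw.braidPerm_zpow_mem hn _)
  · rw [Finset.card_image_of_injOn hinj]
    simp

theorem prod_range_braidPerm {M : Type*} [CommMonoid M] (hw : IsWordOn n w) (hn : 0 < n)
    (hcyc : ∀ k : ℤ, (braidPerm w ^ k) 1 = 1 ↔ (n : ℤ) ∣ k) (m : ℕ) (f : ℕ → M) :
    ∏ j ∈ Finset.range n, f (braidPerm (w.take m) ((braidPerm w ^ (j : ℤ)) 1)) =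
      ∏ x ∈ Finset.Icc 1 n, f x := by
  obtain ⟨h1, h2⟩ := image_braidPerm_take hw hn hcyc m
  rw [← h2, Finset.prod_image h1]

theorem sum_range_braidPerm {M : Type*} [AddCommMonoid M] (hw : IsWordOn n w) (hn : 0 < n)
    (hcyc : ∀ k : ℤ, (braidPerm w ^ k) 1 = 1 ↔ (n : ℤ) ∣ k) (m : ℕ) (f : ℕ → M) :
    ∑ j ∈ Finset.range n, f (braidPerm (w.take m) ((braidPerm w ^ (j : ℤ)) 1)) =
      ∑ x ∈ Finset.Icc 1 n, f x :=
  prod_range_braidPerm (M := Multiplicative M) hw hn hcyc m f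

theorem aroundAxis_mem_compl {B : ℝ → ℂ} {z : ℂ} {u : ℝ} (h : ∀ k : ℤ, z ≠ B (u + k)) :
    aroundAxis z u ∈ (Set.range (knotOf n B))ᶜ := by
  rintro ⟨t, ht⟩
  obtain ⟨h1, k, h2⟩ := aroundAxis_eq_iff.1 ht
  exact h k (by rw [← h2, h1])

/-- Within one letter the uniform turning of the phase is reparametrized by the smooth step of the
letter, which does not change the class; the whole number `j` of turns around the axis is dropped.
-/
theorem segClass_follow (x₀ : ((Set.range (knotOf n (closeUp (wordMotion w) 1)))ᶜ : Set Space))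
    {ρ : ℝ} {F : ℝ × ℝ → Space} (hF : Continuous F)
    (hX : ∀ x, F x ∈ (Set.range (knotOf n (closeUp (wordMotion w) 1)))ᶜ)
    (hFe : F = fun y => aroundAxis (closeUp (wordMotion w) 1 y.2 +
      ρ * (Complex.I * Complex.exp ((2 * Real.pi * y.1 : ℝ) * Complex.I))) y.2)
    (j : ℕ) {m : ℕ} (hm : m < w.length) (d : ℤ) :
    segClass x₀ F (0, j + m / w.length) (d, j + (m + 1 : ℕ) / w.length) =
      segClass x₀ (fun s => aroundAxis (followCurve (w.getD m (0, true)) ρ d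
        (braidPerm (w.take m) ((braidPerm w ^ (j : ℤ)) 1)) s) ((m + s) / w.length)) 0 1 := by
  rw [← curveClass_comp x₀ convex_univ hF.continuousOn (fun x _ => hX x)
    (γ := fun s => (d * Real.smoothTransition s, j + (m + s) / w.length)) ?_
    (fun _ _ => Set.mem_univ _) (by simp) (by simp)]
  · refine curveClass_congr x₀ fun s hs => ?_
    have h1 := closeUp_wordMotion_letter w 1 j hm hs.1 hs.2
    have h2 : (1 - s) • (0 : ℝ) + s • 1 = s := by simp
    rw [Int.cast_natCast] at h1
    dsimp only [Function.comp]
    rw [h2, followCurve, ← h1, hFe]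
    dsimp only
    rw [add_comm (j : ℝ)]
    exact aroundAxis_add_int _ _ j
  · have : Continuous Real.smoothTransition := Real.smoothTransition.continuous
    fun_prop

/-- The two strands that cross are treated together by `segClass_letter`; the others rest, get no
turns, and their factors agree on both sides. -/
theorem segClass_letters {X : Set Space} (x₀ : X) (a : ArtinLetter) (ha : 1 ≤ a.1 ∧ a.1 + 1 ≤ n)
    {U : ℝ → ℝ} (hU : Continuous U)
    (hX : ∀ s ∈ Set.Icc (0 : ℝ) 1, ∀ z : ℂ, (∀ k : ℕ, z ≠ letterPath a k s) →
      aroundAxis z (U s) ∈ X) {ρ : ℝ} (hρ : 0 < ρ) (hρ' : ρ ≤ 1 / 4) :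
    ∏ x ∈ Finset.Icc 1 n,
        segClass x₀ (fun s => aroundAxis (followCurve a ρ (letterTwist a x) x s) (U s)) 0 1 =
      ∏ x ∈ Finset.Icc 1 n, segClass x₀ (fun s => aroundAxis ⟨x, ρ⟩ (U s)) 0 1 := by
  have h1 : a.1 ∈ Finset.Icc 1 n := Finset.mem_Icc.2 ⟨ha.1, by omega⟩
  have h2 : a.1 + 1 ∈ (Finset.Icc 1 n).erase a.1 :=
    Finset.mem_erase.2 ⟨by omega, Finset.mem_Icc.2 ⟨by omega, ha.2⟩⟩
  rw [← Finset.mul_prod_erase _ _ h1, ← Finset.mul_prod_erase _ _ h2, ← mul_assoc,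
    segClass_letter x₀ a hU hX hρ hρ', ← Finset.mul_prod_erase (Finset.Icc 1 n) _ h1,
    ← Finset.mul_prod_erase _ _ h2, ← mul_assoc]
  congr 1
  refine Finset.prod_congr rfl fun x hx => ?_
  have hx1 := Finset.mem_erase.1 hx
  have hx2 := Finset.mem_erase.1 hx1.2
  congr 1
  ext1 s
  congr 1
  have : letterTwist a x = 0 := by simp [letterTwist, hx1.1, hx2.1]
  rw [this]
  apply Complex.ext
  · rw [followCurve_re, letterPath_re, if_neg hx2.1, if_neg hx1.1]
    simp
  · rw [followCurve_im, letterPath_im, if_neg hx2.1, if_neg hx1.1]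
    simp

theorem closeUp_wordMotion_location (hw : IsWordOn n w) (hn : 0 < n) (u : ℝ) :
    (∃ c : ℕ, c ≤ n ∧ closeUp (wordMotion w) 1 u = c) ∨ ∃ c : ℕ, c + 1 ≤ n ∧
      ((closeUp (wordMotion w) 1 u).re - (c + 1 / 2)) ^ 2 +
        (closeUp (wordMotion w) 1 u).im ^ 2 = 1 / 4 := by
  rw [closeUp_wordMotion]
  exact braidPath_location hw (Finset.mem_Icc.1 (hw.braidPerm_zpow_mem hn _)).2 _

/-- An integer has distance at least `1 / 2` from every centre, so a point strictly above it lies on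
none of the circles of `braidPath_location`. -/
theorem aroundAxis_above_mem_compl (hw : IsWordOn n w) (hn : 0 < n) (x : ℕ) {τ : ℝ} (hτ : 0 < τ)
    (u : ℝ) : aroundAxis ⟨x, τ⟩ u ∈ (Set.range (knotOf n (closeUp (wordMotion w) 1)))ᶜ := by
  refine aroundAxis_mem_compl fun k hk => ?_
  rcases closeUp_wordMotion_location hw hn (u + k) with ⟨c, -, hc⟩ | ⟨c, -, hc⟩ <;> rw [← hk] at hc
  · have := congrArg Complex.im hc
    simp at this
    linarith
  · dsimp only at hc
    have h1 : (1 : ℝ) / 4 ≤ ((x : ℝ) - (c + 1 / 2)) ^ 2 := by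
      rcases le_or_gt x c with h | h
      · have h' : (x : ℝ) ≤ c := by exact_mod_cast h
        nlinarith
      · have h' : ((c + 1 : ℕ) : ℝ) ≤ x := by exact_mod_cast h
        push_cast at h'
        nlinarith
    have := pow_pos hτ 2
    linarith

theorem segClass_wait_closeUp (hw : IsWordOn n w) (hn : 0 < n)
    (x₀ : ((Set.range (knotOf n (closeUp (wordMotion w) 1)))ᶜ : Set Space)) {ρ : ℝ} (hρ : 0 < ρ)
    (x : ℕ) : segClass x₀ (fun u => aroundAxis ⟨x, ρ⟩ u) 0 1 = 1 := by
  refine segClass_wait x₀ (R := n + 1) hρ (fun τ hτ u => aroundAxis_above_mem_compl hw hn x hτ u)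
    (fun y τ hτ u => aroundAxis_mem_compl fun k hk => ?_) ?_
  · rcases closeUp_wordMotion_location hw hn (u + k) with ⟨c, -, hc⟩ | ⟨c, -, hc⟩ <;>
      rw [← hk] at hc
    · have := congrArg Complex.im hc
      simp at this
      linarith
    · dsimp only at hc
      nlinarith [sq_nonneg (y - (c + 1 / 2))]
  · rintro v ⟨t, ht⟩
    have h1 := congrArg Prod.snd ht
    change (closeUp (wordMotion w) 1 (n * t)).re = (n : ℝ) + 1 at h1
    rcases closeUp_wordMotion_location hw hn (n * t) with ⟨c, h, hc⟩ | ⟨c, h, hc⟩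
    · have := congrArg Complex.re hc
      rw [h1, Complex.natCast_re] at this
      have h' : (c : ℝ) ≤ n := by exact_mod_cast h
      linarith
    · rw [h1] at hc
      have h' : ((c + 1 : ℕ) : ℝ) ≤ n := by exact_mod_cast h
      push_cast at h'
      nlinarith [sq_nonneg (closeUp (wordMotion w) 1 (n * t)).im]

/-- The sum of the exponents of a word. -/
def writhe (w : List ArtinLetter) : ℤ := (w.map fun a => if a.2 then (1 : ℤ) else -1).sum

/-- The curve that follows the closure of a braid while it makes as many turns against the crossings
as there are crossings is null-homologous in the complement. -/
theorem nullHomologousIn_longitude (hw : IsWordOn n w) (hn : 0 < n)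
    (hcyc : ∀ k : ℤ, (braidPerm w ^ k) 1 = 1 ↔ (n : ℤ) ∣ k) {ρ : ℝ} (hρ : 0 < ρ) (hρ' : ρ ≤ 1 / 4)
    (hsep : ∀ (u : ℝ) (k : ℤ), ¬(n : ℤ) ∣ k →
      2 * ρ < ‖closeUp (wordMotion w) 1 (u + k) - closeUp (wordMotion w) 1 u‖) :
    NullHomologousIn (Set.range (knotOf n (closeUp (wordMotion w) 1)))ᶜ fun s =>
      aroundAxis (closeUp (wordMotion w) 1 (n * s) + ρ * (Complex.I *
        Complex.exp ((2 * Real.pi * (-(writhe w) * s) : ℝ) * Complex.I))) (n * s) := by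
  set B := closeUp (wordMotion w) 1 with hB
  have hBc : IsClosedBraid n B := isClosedBraid_closeUp _ hcyc
  let F : ℝ × ℝ → Space := fun y => aroundAxis (B y.2 +
    ρ * (Complex.I * Complex.exp ((2 * Real.pi * y.1 : ℝ) * Complex.I))) y.2
  have hF : Continuous F := by
    have h1 := hBc.continuous
    exact continuous_aroundAxis.comp (f := fun y : ℝ × ℝ => (B y.2 +
      ρ * (Complex.I * Complex.exp ((2 * Real.pi * y.1 : ℝ) * Complex.I)), y.2)) (by fun_prop)
  have hnorm : ∀ φ : ℝ, ‖(ρ : ℂ) * (Complex.I * Complex.exp ((2 * Real.pi * φ : ℝ) * Complex.I))‖ =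
      ρ := by
    intro φ
    rw [norm_mul, norm_mul, Complex.norm_I, Complex.norm_exp_ofReal_mul_I, Complex.norm_real,
      Real.norm_eq_abs, abs_of_pos hρ, mul_one, mul_one]
  have hX : ∀ y, F y ∈ (Set.range (knotOf n B))ᶜ := by
    intro y
    refine aroundAxis_mem_compl fun k hk => ?_
    have h1 := hnorm y.1
    rw [← sub_eq_iff_eq_add'.2 hk.symm] at h1
    by_cases hd : (n : ℤ) ∣ k
    · obtain ⟨i, rfl⟩ := hd
      have := hBc.add_mul y.2 i
      push_cast at h1
      rw [this, sub_self, norm_zero] at h1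
      exact hρ.ne h1
    · have := hsep y.2 k hd
      linarith
  have hper : ∀ (φ u : ℝ) (k : ℤ), F (φ + k, u) = F (φ, u) := by
    intro φ u k
    have : ((2 * Real.pi * (φ + k) : ℝ) : ℂ) * Complex.I =
        ((2 * Real.pi * φ : ℝ) : ℂ) * Complex.I + k * (2 * Real.pi * Complex.I) := by
      push_cast; ring
    simp only [F]
    rw [this, Complex.exp_add, Complex.exp_int_mul_two_pi_mul_I, mul_one]
  let Λ : ℝ → Space := fun s => F (-(writhe w) * s, n * s)
  have hΛc : ContinuousOn Λ (Set.Icc 0 1) := by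
    refine (hF.comp (f := fun s : ℝ => ((-(writhe w) * s : ℝ), (n * s : ℝ))) ?_).continuousOn
    fun_prop
  have hΛX : Set.MapsTo Λ (Set.Icc 0 1) (Set.range (knotOf n B))ᶜ := fun s _ => hX _
  have h01 : Λ 0 = Λ 1 := by
    have e := hper 0 n (-(writhe w))
    have e2 := hBc.periodic 0
    rw [zero_add] at e2
    push_cast at e
    rw [zero_add] at e
    simp only [Λ, mul_zero, mul_one]
    rw [e]
    simp only [F]
    rw [e2]
    have := aroundAxis_add_int (B 0 + ρ * (Complex.I * Complex.exp ((2 * Real.pi * 0 : ℝ) *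
      Complex.I))) 0 n
    rw [zero_add, Int.cast_natCast] at this
    exact this.symm
  let x₀ : ((Set.range (knotOf n B))ᶜ : Set Space) := ⟨Λ 0, hX _⟩
  let l : Path x₀ x₀ := (curvePath Λ hΛc hΛX).cast rfl (Subtype.ext h01)
  refine ⟨x₀, l, fun s => rfl, ?_⟩
  have hl : pathClass x₀ l = curveClass x₀ Λ := by
    rw [curveClass_eq x₀ hΛc hΛX]
    exact pathClass_eq_of_eq x₀ fun t => rfl
  change loopClass (Path.Homotopic.Quotient.mk l) = 1
  rw [← pathClass_loop, hl]
  have hseg : curveClass x₀ Λ = segClass x₀ F (0, 0) (((-(writhe w) : ℤ) : ℝ), n) := by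
    refine curveClass_congr x₀ fun s _ => ?_
    refine congrArg F (Prod.ext ?_ ?_) <;> simp [mul_comm]
  rw [hseg]
  -- Cutting at the letters divides by the length. For the empty word connectedness forces `n = 1`,
  -- and the curve is itself a waiting loop.
  rcases Nat.eq_zero_or_pos w.length with hl0 | hl0
  · obtain rfl := List.length_eq_zero_iff.1 hl0
    have hn1 : n = 1 := by
      have := (hcyc 1).1 rfl
      have h2 := Int.le_of_dvd one_pos this
      omega
    have hB1 : ∀ u, B u = 1 := by
      intro u
      rw [hB, closeUp_wordMotion]
      simp [braidPath, braidPerm]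
    refine Eq.trans (curveClass_congr x₀ fun s _ => ?_) (segClass_wait_closeUp hw hn x₀ hρ 1)
    simp only [F, hB1, hn1]
    simp [writhe]
    congr 1
    apply Complex.ext <;> simp
  have hl' : (0 : ℝ) < w.length := by exact_mod_cast hl0
  let a : ℕ → ArtinLetter := fun m => w.getD m (0, true)
  let x : ℕ → ℕ → ℕ := fun j m => braidPerm (w.take m) ((braidPerm w ^ (j : ℤ)) 1)
  let d : ℕ → ℕ → ℤ := fun j m => letterTwist (a m) (x j m)
  have ha : ∀ m < w.length, 1 ≤ (a m).1 ∧ (a m).1 + 1 ≤ n := fun m hm => hw _ (getD_mem hm _)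
  -- Each letter hands out one compensating turn among all strands, opposite to its sign, which adds
  -- up to minus the writhe.
  have hsum : ∑ j ∈ Finset.range n, ∑ m ∈ Finset.range w.length, d j m = -writhe w := by
    rw [Finset.sum_comm, writhe, ← sum_range_getD _ (0, true), ← Finset.sum_neg_distrib]
    refine Finset.sum_congr rfl fun m hm => ?_
    rw [sum_range_braidPerm hw hn hcyc m (letterTwist (a m)),
      sum_letterTwist (ha m (Finset.mem_range.1 hm))]
    simp only [a]
    split_ifs <;> rfl
  have htel : segClass x₀ F (0, 0) (((-(writhe w) : ℤ) : ℝ), n) = ∏ j ∈ Finset.range n,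
      ∏ m ∈ Finset.range w.length,
        segClass x₀ F (0, j + m / w.length) (d j m, j + (m + 1 : ℕ) / w.length) := by
    have h1 := segClass_prod_range_of_periodic x₀ hF hX hper (fun j => j)
      (fun j => ∑ m ∈ Finset.range w.length, d j m) n
    rw [hsum, Nat.cast_zero] at h1
    rw [← h1]
    refine Finset.prod_congr rfl fun j _ => ?_
    have h2 := segClass_prod_range_of_periodic x₀ hF hX hper
      (fun m => j + (m : ℝ) / w.length) (d j) w.length
    rw [h2, div_self hl'.ne']
    simp
  -- The curve was cut turn by turn; a crossing involves two turns at the same letter, so the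
  -- product is regrouped by letters.
  rw [htel, Finset.prod_comm]
  have hwait : ∀ m ∈ Finset.range w.length, ∏ j ∈ Finset.range n,
      segClass x₀ F (0, j + m / w.length) (d j m, j + (m + 1 : ℕ) / w.length) =
      ∏ y ∈ Finset.Icc 1 n,
        segClass x₀ (fun s => aroundAxis ⟨y, ρ⟩ ((m + s) / w.length)) 0 1 := by
    intro m hm
    have hm := Finset.mem_range.1 hm
    rw [Finset.prod_congr rfl fun j _ => segClass_follow x₀ hF hX rfl j hm (d j m),
      prod_range_braidPerm hw hn hcyc m fun y => segClass x₀ (fun s => aroundAxis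
        (followCurve (a m) ρ (letterTwist (a m) y) y s) ((m + s) / w.length)) 0 1]
    refine segClass_letters x₀ (a m) (ha m hm) (by fun_prop) (fun s hs z hz => ?_) hρ hρ'
    refine aroundAxis_mem_compl fun k hk => hz
      (braidPerm (w.take m) ((braidPerm w ^ k) 1)) (hk.trans ?_)
    rw [add_comm]
    exact closeUp_wordMotion_letter w 1 k hm hs.1 hs.2
  -- After regrouping by positions, the resting arcs over all letters join to a full circle above
  -- each integer, and this circle is trivial.
  rw [Finset.prod_congr rfl hwait, Finset.prod_comm]
  refine Finset.prod_eq_one fun y hy => ?_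
  have hc : Continuous fun u => aroundAxis ⟨y, ρ⟩ u :=
    continuous_aroundAxis.comp (Continuous.prodMk continuous_const continuous_id)
  have hyX : ∀ u, aroundAxis ⟨y, ρ⟩ u ∈ (Set.range (knotOf n B))ᶜ :=
    fun u => aroundAxis_above_mem_compl hw hn y hρ u
  have h3 := segClass_prod_range x₀ hc hyX (fun m => (m : ℝ) / w.length) w.length
  rw [div_self hl'.ne', Nat.cast_zero, zero_div] at h3
  rw [← segClass_wait_closeUp hw hn x₀ hρ y, ← h3]
  refine Finset.prod_congr rfl fun m _ => curveClass_congr x₀ fun t _ => ?_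
  refine congrArg (aroundAxis ⟨y, ρ⟩) ?_
  simp only [smul_eq_mul]
  push_cast
  field_simp
  ring

end Longitude

/-! ### The staircase word of the cable -/

theorem isBKLPositive_append {n : ℕ} {V W : List Band} (hV : IsBKLPositive n V)
    (hW : IsBKLPositive n W) : IsBKLPositive n (V ++ W) :=
  fun b hb => (List.mem_append.1 hb).elim (hV b) (hW b)

theorem isBKLPositive_dualGarside {m n : ℕ} (h : m ≤ n) : IsBKLPositive n (dualGarside m) := by
  intro b hb
  obtain ⟨i, hi, rfl⟩ := List.mem_map.1 hb
  rw [List.mem_range'_1] at hi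
  dsimp only
  omega

theorem isStaircase_cabledStaircase {p n : ℕ} (q : ℕ) (hn : 0 < n) {P : List Band}
    (hP : IsBKLPositive n P) : IsStaircase (p * n) (cabledStaircase p q n P) := by
  refine ⟨isBKLPositive_append (isBKLPositive_append (isBKLPositive_append
    (isBKLPositive_dualGarside le_rfl) ?_) ?_) ?_, [], ?_⟩
  · intro b hb
    obtain ⟨k, hk, hb⟩ := List.mem_flatMap.1 hb
    obtain ⟨r, hr, rfl⟩ := List.mem_map.1 hb
    rw [List.mem_range'_1] at hk hr
    have h1 : 1 * p ≤ k * p := Nat.mul_le_mul_right p hk.1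
    have h2 : (k + 1) * p ≤ n * p := Nat.mul_le_mul_right p (by omega)
    rw [mul_comm p n]
    rw [add_mul] at h2 ⊢
    dsimp only
    omega
  · intro b hb
    obtain ⟨l, hl, hb⟩ := List.mem_flatten.1 hb
    rw [List.eq_of_mem_replicate hl] at hb
    exact isBKLPositive_dualGarside (Nat.le_mul_of_pos_right p hn) b hb
  · intro b hb
    obtain ⟨a, ha, hb⟩ := List.mem_flatMap.1 hb
    obtain ⟨k, hk, rfl⟩ := List.mem_map.1 hb
    rw [List.mem_range] at hk
    obtain ⟨h1, h2, h3⟩ := hP a ha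
    have e1 : p * 1 ≤ p * a.1 := Nat.mul_le_mul_left p h1
    have e2 : p * (a.1 + 1) ≤ p * a.2 := Nat.mul_le_mul_left p h2
    have e3 : p * a.2 ≤ p * n := Nat.mul_le_mul_left p h3
    rw [mul_add] at e2
    dsimp only
    omega
  · rw [cabledStaircase, cabledDualGarside]
    exact ⟨_, by rw [List.nil_append, List.append_assoc, List.append_assoc]⟩

theorem isWordOn_artinWord {n : ℕ} {W : List Band} (hW : IsBKLPositive n W) :
    IsWordOn n (artinWord W) := by
  intro a ha
  obtain ⟨b, hb, ha⟩ := List.mem_flatMap.1 ha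
  obtain ⟨h1, h2, h3⟩ := hW b hb
  simp only [bandWord, List.mem_append, List.mem_map, List.mem_reverse, List.mem_range'_1,
    List.mem_singleton] at ha
  rcases ha with (⟨i, hi, rfl⟩ | rfl) | ⟨i, hi, rfl⟩ <;> dsimp only <;> omega

theorem writhe_append (v w : List ArtinLetter) : writhe (v ++ w) = writhe v + writhe w := by
  rw [writhe, List.map_append, List.sum_append, writhe, writhe]

theorem writhe_bandWord (b : Band) : writhe (bandWord b) = 1 := by
  rw [bandWord]
  simp only [writhe_append]
  simp [writhe, Function.comp_def]

theorem writhe_artinWord (W : List Band) : writhe (artinWord W) = W.length := by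
  induction W with
  | nil => rfl
  | cons b W ih =>
    have : artinWord (b :: W) = bandWord b ++ artinWord W := rfl
    rw [this, writhe_append, writhe_bandWord, ih, List.length_cons]
    push_cast
    ring

/-! ### The orientation of a solid torus -/

theorem det_prod_real (f : ℂ × ℝ →L[ℝ] ℂ × ℝ) : f.det =
    Matrix.det !![(f (1, 0)).1.re, (f (Complex.I, 0)).1.re, (f (0, 1)).1.re;
      (f (1, 0)).1.im, (f (Complex.I, 0)).1.im, (f (0, 1)).1.im;
      (f (1, 0)).2, (f (Complex.I, 0)).2, (f (0, 1)).2] := by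
  let b : Module.Basis (Fin 3) ℝ (ℂ × ℝ) :=
    (Complex.basisOneI.prod (Module.Basis.singleton (Fin 1) ℝ)).reindex finSumFinEquiv
  have h0 : finSumFinEquiv.symm (0 : Fin (2 + 1)) = Sum.inl 0 := rfl
  have h1 : finSumFinEquiv.symm (1 : Fin (2 + 1)) = Sum.inl 1 := rfl
  have h2 : finSumFinEquiv.symm (2 : Fin (2 + 1)) = Sum.inr 0 := rfl
  rw [ContinuousLinearMap.det, ← LinearMap.det_toMatrix b]
  congr 1
  have b0 : b 0 = (1, 0) := by simp [b, h0]
  have b1 : b 1 = (Complex.I, 0) := by simp [b, h1]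
  have b2 : b 2 = (0, 1) := by simp [b, h2]
  have r0 : ∀ x, b.repr x 0 = x.1.re := by intro x; simp [b, h0]
  have r1 : ∀ x, b.repr x 1 = x.1.im := by intro x; simp [b, h1]
  have r2 : ∀ x, b.repr x 2 = x.2 := by intro x; simp [b, h2]
  ext i j
  rw [LinearMap.toMatrix_apply]
  fin_cases i <;> fin_cases j <;> simp [b0, b1, b2, r0, r1, r2]

theorem hasDerivAt_aroundAxis {z : ℝ → ℂ} {u : ℝ → ℝ} {z' : ℂ} {u' t : ℝ} (hz : HasDerivAt z z' t)
    (hu : HasDerivAt u u' t) : HasDerivAt (fun t => aroundAxis (z t) (u t))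
      (Complex.exp ((z t).im + 2 * Real.pi * u t * Complex.I) *
        (z'.im + 2 * Real.pi * u' * Complex.I), z'.re) t := by
  have h1 : HasDerivAt (fun t => (z t).re) z'.re t :=
    Complex.reCLM.hasFDerivAt.comp_hasDerivAt t hz
  have h2 : HasDerivAt (fun t => (z t).im) z'.im t :=
    Complex.imCLM.hasFDerivAt.comp_hasDerivAt t hz
  exact (((h2.ofReal_comp).add ((hu.ofReal_comp.const_mul _).mul_const _)).cexp).prodMk h1

/-- A tubular neighbourhood of a closed braid, whose meridian discs are parts of the half-planes
around the axis. -/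
def tube (n : ℕ) (B c : ℝ → ℂ) (y : ℂ × ℝ) : Space :=
  aroundAxis (B (n * y.2) + c y.2 * y.1) (n * y.2)

theorem contDiff_tube {n : ℕ} {B c : ℝ → ℂ} (hB : ContDiff ℝ ∞ B) (hc : ContDiff ℝ ∞ c) :
    ContDiff ℝ ∞ (tube n B c) := by
  refine contDiff_aroundAxis.comp (f := fun y : ℂ × ℝ => (B (n * y.2) + c y.2 * y.1, n * y.2)) ?_
  exact ((hB.comp (by fun_prop)).add ((hc.comp contDiff_snd).mul contDiff_fst)).prodMk (by fun_prop)

/-- On a meridian disc the tube is the conformal embedding of a half-plane, scaled by `c`, and the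
longitudinal derivative turns around the axis at the rate `2πn`. The movement of `B` and `c` along
the core only shears and drops out of the determinant. -/
theorem det_fderiv_tube_pos {n : ℕ} (hn : 0 < n) {B c : ℝ → ℂ} (hB : ContDiff ℝ ∞ B)
    (hc : ContDiff ℝ ∞ c) (hc0 : ∀ s, c s ≠ 0) (x : ℂ) (s : ℝ) :
    0 < (fderiv ℝ (tube n B c) (x, s)).det := by
  have hh : HasFDerivAt (tube n B c) (fderiv ℝ (tube n B c) (x, s)) (x, s) :=
    ((contDiff_tube hB hc).differentiable (by simp) _).hasFDerivAt
  set f := fderiv ℝ (tube n B c) (x, s)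
  set e := Complex.exp ((B (n * s) + c s * x).im + 2 * Real.pi * (n * s : ℝ) * Complex.I) with he
  have hv : ∀ v : ℂ, f (v, 0) = (e * (c s * v).im, (c s * v).re) := by
    intro v
    have h1 : HasDerivAt (fun t : ℝ => (x + t * v, s)) ((v, 0) : ℂ × ℝ) 0 := by
      refine HasDerivAt.prodMk ?_ (hasDerivAt_const _ _)
      simpa using ((hasDerivAt_id (0 : ℝ)).ofReal_comp.mul_const v).const_add x
    have h2 := hh.comp_hasDerivAt_of_eq 0 h1 (by simp)
    have h3 : HasDerivAt (fun t : ℝ => B (n * s) + c s * (x + t * v)) (c s * v) 0 := by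
      simpa using
        ((((hasDerivAt_id (0 : ℝ)).ofReal_comp.mul_const v).const_add x).const_mul (c s)).const_add
          (B (n * s))
    have h4 := hasDerivAt_aroundAxis h3 (hasDerivAt_const 0 ((n : ℝ) * s))
    have := h2.unique h4
    rw [this, he]
    simp
  obtain ⟨W, hW⟩ : ∃ W, HasDerivAt (fun t : ℝ => B (n * t) + c t * x) W s := by
    have : ContDiff ℝ ∞ fun t : ℝ => B (n * t) + c t * x :=
      (hB.comp (by fun_prop)).add (hc.mul contDiff_const)
    exact ⟨_, (this.differentiable (by simp) s).hasDerivAt⟩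
  have hr : f (0, 1) = (e * (W.im + 2 * Real.pi * n * Complex.I), W.re) := by
    have h1 : HasDerivAt (fun t : ℝ => (x, t)) ((0, 1) : ℂ × ℝ) s :=
      (hasDerivAt_const _ _).prodMk (hasDerivAt_id _)
    have h2 := hh.comp_hasDerivAt s h1
    have h3 : HasDerivAt (fun t : ℝ => (n : ℝ) * t) n s := by
      simpa using (hasDerivAt_id s).const_mul (n : ℝ)
    have := h2.unique (hasDerivAt_aroundAxis hW h3)
    rw [this]
    simp [he]
  have key : f.det = 2 * Real.pi * n * (Complex.normSq e * Complex.normSq (c s)) := by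
    rw [det_prod_real, hv, hv, hr, Matrix.det_fin_three, Complex.normSq_apply, Complex.normSq_apply]
    simp
    ring
  rw [key]
  have h1 : 0 < Complex.normSq e := Complex.normSq_pos.2 (Complex.exp_ne_zero _)
  have h2 : 0 < Complex.normSq (c s) := Complex.normSq_pos.2 (hc0 s)
  have := Real.pi_pos
  positivity

/-- Points on different strands are separated by `2ρ < ‖B (u + k) - B u‖`; on the same strand the
centres agree and multiplication by `c` is injective. -/
theorem isSolidTorus_tube {n : ℕ} (hn : 0 < n) {B c : ℝ → ℂ} (h : IsClosedBraid n B)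
    (hB : ContDiff ℝ ∞ B) (hc : ContDiff ℝ ∞ c) (hc1 : ∀ s, c (s + 1) = c s) {ρ : ℝ} (hρ : 0 < ρ)
    (hcρ : ∀ s, ‖c s‖ = ρ)
    (hsep : ∀ (u : ℝ) (k : ℤ), ¬(n : ℤ) ∣ k → 2 * ρ < ‖B (u + k) - B u‖) :
    IsSolidTorus (tube n B c) where
  smooth := contDiff_tube hB hc
  periodic x s := by
    refine aroundAxis_eq_iff.2 ⟨?_, n, by push_cast; ring⟩
    dsimp only
    rw [mul_add, mul_one, h.periodic, hc1]
  injective x y s t hx hy hst := by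
    obtain ⟨h1, k, hk⟩ := aroundAxis_eq_iff.1 hst
    dsimp only at h1 hk
    have hcx : ∀ s {x : ℂ}, ‖x‖ ≤ 1 → ‖c s * x‖ ≤ ρ := by
      intro s x hx
      rw [norm_mul, hcρ]
      nlinarith
    by_cases hd : (n : ℤ) ∣ k
    · obtain ⟨m, rfl⟩ := hd
      have hst : s = t + m := by
        have hn' : (n : ℝ) ≠ 0 := Nat.cast_ne_zero.2 hn.ne'
        refine mul_left_cancel₀ hn' ?_
        rw [hk]
        push_cast
        ring
      have e2 : c s = c t := by
        have : Function.Periodic c 1 := hc1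
        rw [hst]
        simpa using this.int_mul m t
      have e3 : B (n * s) = B (n * t) := by
        rw [hst, mul_add]
        exact h.add_mul _ m
      rw [e2, e3] at h1
      have hct : c t ≠ 0 := norm_pos_iff.1 (by rw [hcρ]; exact hρ)
      exact ⟨mul_left_cancel₀ hct (add_left_cancel h1), m, hst⟩
    · have h2 := hsep (n * t) k hd
      rw [← hk] at h2
      have h3 : B (n * s) - B (n * t) = c t * y - c s * x := by linear_combination h1
      rw [h3] at h2
      have := norm_sub_le (c t * y) (c s * x)
      linarith [hcx s hx, hcx t hy]
  orientation x s _ := det_fderiv_tube_pos hn hB hc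
    (fun s => norm_pos_iff.1 (by rw [hcρ]; exact hρ)) x s

/-- The braid of the word `cabledStaircase p q n P` closes to the `(p, q)`-cable. -/
theorem isCable_cabledStaircase {p q n : ℕ} (hp : 2 ≤ p) (hpq : Nat.Coprime p q) (hq : n ≤ q)
    {P : List Band} (hP : IsBKLPositive n P) {K : ℝ → Space}
    (hK : IsClosureOf n (dualGarside n ++ P) K) :
    IsCable p q K (braidClosure (p * n) (artinWord (cabledStaircase p q n P))) := by
  have : NeZero p := ⟨by omega⟩
  obtain ⟨hn, hcyc⟩ := perm_of_isKnot hK.isKnot_right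
  have hpos : IsBKLPositive n (dualGarside n ++ P) :=
    isBKLPositive_append (isBKLPositive_dualGarside le_rfl) hP
  have hE := writhe_artinWord (dualGarside n ++ P)
  set E : ℕ := (dualGarside n ++ P).length with hEdef
  -- The turns of `T_{p,q}` counted in the radial framing: `q` turns relative to a longitude that
  -- makes `-E` turns on each of `p` passages.
  set κ : ℤ := q - p * E with hκdef
  have hκ : IsCoprime (p : ℤ) κ := by
    have h1 : IsCoprime (p : ℤ) q := Nat.isCoprime_iff_coprime.2 hpq
    have h2 := h1.add_mul_left_right (-E)
    rwa [mul_neg, ← sub_eq_add_neg] at h2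
  have hsum := cableSum_cabledStaircase (p := p) (q := q) hn hq hP
  rw [← ofWord_artinWord, ← ofWord_artinWord] at hsum
  obtain ⟨ρ₀, hρ₀, hmain⟩ := hsum.closedHomotopic hp hn hcyc hκ
  set w := artinWord (dualGarside n ++ P) with hw
  set B := closeUp (wordMotion w) 1 with hBdef
  have hBc : IsClosedBraid n B := isClosedBraid_closeUp _ hcyc
  have hBs : ContDiff ℝ ∞ B := contDiff_closeUp_wordMotion w 1
  -- Below `ρ₀` for the homotopy of closed braids, and at most `1 / 4` for the argument at the
  -- crossings.
  let ρ : ℝ := min (ρ₀ / 2) (1 / 4)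
  have hρ : 0 < ρ := lt_min (by linarith) (by norm_num)
  have hρ1 : ρ < ρ₀ := lt_of_le_of_lt (min_le_left _ _) (by linarith)
  obtain ⟨hsep, hhom⟩ := hmain ρ hρ hρ1
  -- The framing of the tube: the point `1` of the meridian disc traces the null-homologous
  -- longitude.
  let c : ℝ → ℂ := fun s => ρ * (Complex.I *
    Complex.exp ((2 * Real.pi * (-(writhe w) * s) : ℝ) * Complex.I))
  have hc : ContDiff ℝ ∞ c := by
    have h1 : ContDiff ℝ ∞ fun s : ℝ => 2 * Real.pi * (-(writhe w) * s) := by fun_prop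
    have h2 := Complex.ofRealCLM.contDiff.comp h1
    exact contDiff_const.mul (contDiff_const.mul (h2.mul contDiff_const).cexp)
  have hc1 : ∀ s, c (s + 1) = c s := by
    intro s
    have : ((2 * Real.pi * (-(writhe w) * (s + 1)) : ℝ) : ℂ) * Complex.I =
        ((2 * Real.pi * (-(writhe w) * s) : ℝ) : ℂ) * Complex.I +
          (-(writhe w) : ℤ) * (2 * Real.pi * Complex.I) := by
      push_cast; ring
    simp only [c]
    rw [this, Complex.exp_add, Complex.exp_int_mul_two_pi_mul_I, mul_one]
  have hcρ : ∀ s, ‖c s‖ = ρ := by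
    intro s
    simp only [c]
    rw [norm_mul, norm_mul, Complex.norm_I, Complex.norm_exp_ofReal_mul_I, Complex.norm_real,
      Real.norm_eq_abs, abs_of_pos hρ, mul_one, mul_one]
  have hcore : core (tube n B c) = knotOf n B := by
    ext1 s
    simp [core, tube, knotOf]
  refine ⟨tube n B c, isSolidTorus_tube hn hBc hBs hc hc1 hρ hcρ hsep, ?_, ?_, ?_⟩
  · have hlong := nullHomologousIn_longitude (isWordOn_artinWord hpos) hn hcyc hρ
      (min_le_right _ _) hsep
    rw [hcore]
    have e : longitude (tube n B c) = fun s => aroundAxis (B (n * s) + ρ * (Complex.I *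
        Complex.exp ((2 * Real.pi * (-(writhe w) * s) : ℝ) * Complex.I))) (n * s) := by
      ext1 s
      simp only [longitude, tube, c, mul_one]
    rw [e]
    exact hlong
  · rw [hcore, ← braidClosure_eq]
    exact Isotopic.symm hK
  · have hpn : 0 < p * n := Nat.mul_pos (by omega) hn
    -- The angles `-E * (p s)` of the framing and `q s` of the torus knot add up to `κ s`, so the
    -- image is literally the uniformly winding curve of `CableSum.closedHomotopic`.
    have e : (fun s => tube n B c (torusKnot p q s)) = knotOf (p * n) fun u => B u +
        ρ * (Complex.I * Complex.exp ((2 * Real.pi * (κ * (u / n) / p) : ℝ) * Complex.I)) := by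
      ext1 s
      have hn' : (n : ℝ) ≠ 0 := Nat.cast_ne_zero.2 hn.ne'
      have hp' : (p : ℝ) ≠ 0 := Nat.cast_ne_zero.2 (NeZero.ne p)
      have e1 : (n : ℝ) * (p * s) = (p * n : ℕ) * s := by push_cast; ring
      have e2 : κ * (((p * n : ℕ) : ℝ) * s / n) / p = (q - p * E) * s := by
        simp only [κ]
        push_cast
        field_simp
      simp only [tube, torusKnot, knotOf, c]
      rw [e1, e2, hE, mul_assoc (ρ : ℂ), mul_assoc Complex.I, ← Complex.exp_add]
      congr 5
      push_cast
      ring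
    rw [e, braidClosure_eq]
    refine ClosedHomotopic.isotopic hpn hhom.symm ?_ (contDiff_closeUp_wordMotion _ 1)
    have h1 : ContDiff ℝ ∞ fun u : ℝ => 2 * Real.pi * (κ * (u / n) / p) := by fun_prop
    have h2 := Complex.ofRealCLM.contDiff.comp h1
    exact hBs.add (contDiff_const.mul (contDiff_const.mul (h2.mul contDiff_const).cexp))

end StaircaseCable

end

theorem proposition1p4 (p q n : ℕ) (hp : 2 ≤ p) (hpq : Nat.Coprime p q) (hq : n ≤ q)
    (P : List StaircaseCable.Band) (hP : StaircaseCable.IsBKLPositive n P)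
    (K : ℝ → StaircaseCable.Space)
    (hK : StaircaseCable.IsClosureOf n (StaircaseCable.dualGarside n ++ P) K) :
    StaircaseCable.IsStaircase (p * n) (StaircaseCable.cabledStaircase p q n P) ∧
      ∃ L : ℝ → StaircaseCable.Space, StaircaseCable.IsCable p q K L ∧
        StaircaseCable.IsClosureOf (p * n) (StaircaseCable.cabledStaircase p q n P) L := by
  -- The cable `L` is taken to be the closure of the word itself. That it is a knot, as needed for
  -- reflexivity of isotopy, is read off from the isotopy in `IsCable`.
  refine ⟨StaircaseCable.isStaircase_cabledStaircase q
    (StaircaseCable.perm_of_isKnot hK.isKnot_right).1 hP, _,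
    StaircaseCable.isCable_cabledStaircase hp hpq hq hP hK, ?_⟩
  obtain ⟨h, -, -, -, hL⟩ := StaircaseCable.isCable_cabledStaircase hp hpq hq hP hK
  exact StaircaseCable.Isotopic.refl hL.isKnot_right
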